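/- Let $G$ be a finite-dimensional Lie group with Lie algebra $\mathfrak g$, acting smoothly from the left on a smooth manifold $M$, and let $n\ge 1$. For $x\in\mathfrak g$ let $v_x|_p=\frac{d}{dt}\big|_{t=0}\exp(-tx)\cdot p$. Put $\varsigma(k)=-(-1)^{k(k+1)/2}$. **Bott–Shulman–Stasheff complex.** For $j\ge 0$ let $d_i:G^{j+1}\times M\to G^{j}\times M$ ($0\le i\le j+1$) be the face maps $$d_0(g_1,\dots,g_{j+1},p)=(g_2,\dots,g_{j+1},p),\quad d_i(g_1,\dots,g_{j+1},p)=(g_1,\dots,g_ig_{i+1},\dots,g_{j+1},p)\ (0<i<j+1),\quad d_{j+1}(g_1,\dots,g_{j+1},p)=(g_1,\dots,g_j,g_{j+1}p).$$ The complex has $\bigoplus_{j+k=N}\Omega^k(G^j\times M)$ in degree $N$ and differential $D=\partial+(-1)^jd$, where $\partial=\sum_i(-1)^id_i^*$ and $d$ is the de Rham differential on $G^j\times M$. **Homotopy moment maps.** Let $\omega\in\Omega^{n+1}(M)$ be closed and $G$-invariant ($\omega$ is a $G$-invariant pre-$n$-plectic form). The Lie $n$-algebra of observables $\mathsf{Ham}_\infty(M,\omega)$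 has in degree $0$ the pairs $(v,\alpha)$ of a vector field $v$ and $\alpha\in\Omega^{n-1}(M)$ with $d\alpha=-\iota_v\omega$, and has $\Omega^{n-1+i}(M)$ in degree $i$ for $1-n\le i<0$. Its brackets are: $l_1\alpha=d\alpha$ in degrees $<0$ (read as $(0,d\alpha)$ if $\deg\alpha=-1$); $l_2((v_1,\alpha_1),(v_2,\alpha_2))=([v_1,v_2],\iota_{v_2}\iota_{v_1}\omega)$; $l_k((v_1,\alpha_1),\dots,(v_k,\alpha_k))=\varsigma(k)\,\iota_{v_k}\cdots\iota_{v_1}\omega$ for $k\ge 3$; and zero in all other cases. A homotopy moment map for $\omega$ is an $L_\infty$-morphism $\mathfrak g\to\mathsf{Ham}_\infty(M,\omega)$ that lifts $x\mapsto v_x$ through the projection $(v,\alpha)\mapsto v$. Its structure maps are $x\mapsto(v_x,f_1(x))$ for $k=1$, and $f_k:\Lambda^k\mathfrak g\to\Omega^{n-k}(M)$ for $2\le k\le n$; it is denoted by $f=(f_k)_{1\le k\le n}$. **Restriction.** For $\beta\in\Omega^n(G\times M)$ and $0\le k\le n$ let $r(\beta)_k\in\Lambda^k\mathfrak g^\vee\otimes\Omega^{n-k}(M)$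 be given at $p\in M$ by $$r(\beta)_k(x_1,\dots,x_k)(u_1,\dots,u_{n-k})=\beta_{(e,p)}\bigl((x_1,0),\dots,(x_k,0),(0,u_1),\dots,(0,u_{n-k})\bigr).$$ **Theorem.** Let $\alpha=\sum_{i=0}^{n+1}\alpha_i$ with $\alpha_i\in\Omega^{n+1-i}(G^i\times M)$ satisfy $D\alpha=0$. 1. If $\alpha_0$ is $G$-invariant and $\alpha_1$ is invariant under the $G$-action $g'\cdot(g,p)=(g'g,p)$ on $G\times M$, then $\omega=\alpha_0$ is a $G$-invariant pre-$n$-plectic form, and the maps $f_k$ determined by $\varsigma(k)f_k=r(\alpha_1)_k$, $1\le k\le n$, define a homotopy moment map for $\omega$. 2. If $G$ is compact, let $\alpha_0^G$ be the average of $\alpha_0$ over the $G$-action on $M$ and $\alpha_1^G$ the average of $\alpha_1$ over the above $G$-action on $G\times M$, both with respect to the normalized Haar measure of $G$. Then $\omega=\alpha_0^G$ is a $G$-invariant pre-$n$-plectic form, and the maps $f_k$ determined by $\varsigma(k)f_k=r(\alpha_1^G)_k$, $1\le k\le n$, define a homotopy moment map for $\omega$. -/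

import Mathlib

open scoped Manifold ContDiff Nat

noncomputable section

/-! ## Differential forms on manifolds

For a manifold `M` modelled on the vector space `E`, the tangent space `TangentSpace I p` is by
definition `E` (through the preferred chart at `p`). Accordingly, a vector field is written as a
map `M → E`, and a differential form as a map from `M` to the alternating forms on `E`. -/

section Forms

variable {E : Type*} [NormedAddCommGroup E] [NormedSpace ℝ E]
  {H : Type*} [TopologicalSpace H] (I : ModelWithCorners ℝ E H)
  {M : Type*} [TopologicalSpace M] [ChartedSpace H M]
  {E' : Type*} [NormedAddCommGroup E'] [NormedSpace ℝ E']
  {H' : Type*} [TopologicalSpace H'] (I' : ModelWithCorners ℝ E' H')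
  {M' : Type*} [TopologicalSpace M'] [ChartedSpace H' M']

/-- The derivative `T_p M → T_{f(p)} M'` of a map between manifolds. -/
def tangentMapAt (f : M → M') (p : M) : E →L[ℝ] E' := mfderiv I I' f p

/-- The derivative at `y` of the inverse of the preferred chart at `p`. -/
def chartSymmDeriv (p : M) (y : E) : E →L[ℝ] E :=
  mfderivWithin 𝓘(ℝ, E) I (extChartAt I p).symm (Set.range I) y

variable (E M) in
/-- Not necessarily smooth graded differential forms on a manifold `M` modelled on `E`: a family
`(θ m)` where `θ m` assigns to every `p : M` an alternating `m`-linear form on `T_p M`. -/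
abbrev GradedForm : Type _ := ∀ m : ℕ, M → E [⋀^Fin m]→L[ℝ] ℝ

/-- The degree `m` part of `θ` written in the preferred chart at `p`, i.e. its pullback along the
inverse of that chart. -/
def formInChart (m : ℕ) (θ : M → E [⋀^Fin m]→L[ℝ] ℝ) (p : M) (y : E) : E [⋀^Fin m]→L[ℝ] ℝ :=
  (θ ((extChartAt I p).symm y)).compContinuousLinearMap (chartSymmDeriv I p y)

/-- A graded form is smooth if its components are smooth in the charts of `M`. -/
def IsSmoothForm (θ : GradedForm E M) : Prop :=
  ∀ (m : ℕ) (p : M), ContDiffOn ℝ ∞ (formInChart I m (θ m) p) (extChartAt I p).target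

/-- The pullback `f^* θ`. -/
def pullbackForm (f : M → M') (θ : GradedForm E' M') : GradedForm E M := fun m p =>
  (θ m (f p)).compContinuousLinearMap (tangentMapAt I I' f p)

/-- The de Rham differential: the exterior derivative computed in the preferred chart at `p`,
pulled back to `T_p M`. -/
def dForm (θ : GradedForm E M) : GradedForm E M
  | 0 => 0
  | m + 1 => fun p =>
      (extDerivWithin (formInChart I m (θ m) p) (Set.range I)
        (extChartAt I p p)).compContinuousLinearMap
          (tangentMapAt I 𝓘(ℝ, E) (extChartAt I p) p)

/-- The interior product `ι_v θ`, inserting `v` in the first slot. -/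
def interiorForm (v : M → E) (θ : GradedForm E M) : GradedForm E M :=
  fun m p => (θ (m + 1) p).curryLeft (v p)

/-- The iterated interior product `ι(v_1 ∧ ⋯ ∧ v_k) θ = ι_{v_k} ⋯ ι_{v_1} θ`. -/
def interiorForms : (k : ℕ) → (Fin k → M → E) → GradedForm E M → GradedForm E M
  | 0, _, θ => θ
  | k + 1, v, θ => interiorForms k (Fin.tail v) (interiorForm (v 0) θ)

theorem interiorForms_apply (k : ℕ) (v : Fin k → M → E)
    (θ : GradedForm E M) (m : ℕ) (p : M) (u : Fin m → E) :
    interiorForms k v θ m p u =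
      θ (k + m) p (Fin.append (fun i => v i p) u) := by
  induction k generalizing θ with
  | zero =>
    have key : ∀ (N : ℕ) (h : N = m), θ m p u = θ N p (u ∘ Fin.cast h) := by
      rintro N rfl; rfl
    rw [interiorForms, key (0 + m) (Nat.zero_add m)]
    congr 1
    ext i
    simp [Fin.append_left_nil]
  | succ k ih =>
    have key : ∀ (N N' : ℕ) (h : N' = N) (w : Fin N → E), θ N p w = θ N' p (w ∘ Fin.cast h) := by
      rintro N N' rfl w; rfl
    rw [interiorForms, ih, interiorForm, ContinuousAlternatingMap.curryLeft_apply_apply,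
      key (k + m + 1) (k + 1 + m) (by omega)]
    congr 1
    ext i
    refine Fin.addCases (fun j => ?_) (fun j => ?_) i
    · refine Fin.cases ?_ (fun j => ?_) j
      · simp [Matrix.vecCons]; rfl
      · rw [Fin.append_left]
        have : Fin.cast (by omega : k + 1 + m = k + m + 1) (Fin.castAdd m j.succ) =
          (Fin.castAdd m j).succ := by ext; simp
        simp [Matrix.vecCons, this, Fin.tail]
    · rw [Fin.append_right]
      have : Fin.cast (by omega : k + 1 + m = k + m + 1) (Fin.natAdd (k + 1) j) =
          (Fin.natAdd k j).succ := by ext; simp; omega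
      simp [Matrix.vecCons, this]

variable {I}

theorem formInChart_add (m : ℕ) (θ η : M → E [⋀^Fin m]→L[ℝ] ℝ) (p : M) :
    formInChart I m (θ + η) p = formInChart I m θ p + formInChart I m η p := by
  ext y v; simp [formInChart]

theorem formInChart_smul (m : ℕ) (c : ℝ) (θ : M → E [⋀^Fin m]→L[ℝ] ℝ) (p : M) :
    formInChart I m (c • θ) p = c • formInChart I m θ p := by
  ext y v; simp [formInChart]

theorem IsSmoothForm.zero : IsSmoothForm I (0 : GradedForm E M) := by
  intro m p
  have : formInChart I m ((0 : GradedForm E M) m) p = fun _ => 0 := by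
    ext y v; simp [formInChart]
  rw [this]
  exact contDiffOn_const

theorem IsSmoothForm.add {θ η : GradedForm E M} (hθ : IsSmoothForm I θ)
    (hη : IsSmoothForm I η) : IsSmoothForm I (θ + η) := fun m p => by
  rw [Pi.add_apply, formInChart_add]
  exact (hθ m p).add (hη m p)

theorem IsSmoothForm.smul (c : ℝ) {θ : GradedForm E M} (hθ : IsSmoothForm I θ) :
    IsSmoothForm I (c • θ) := fun m p => by
  rw [Pi.smul_apply, formInChart_smul]
  exact contDiffOn_const.smul (hθ m p)

theorem IsSmoothForm.differentiableWithinAt {θ : GradedForm E M} (hθ : IsSmoothForm I θ)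
    (m : ℕ) (p : M) :
    DifferentiableWithinAt ℝ (formInChart I m (θ m) p) (Set.range I) (extChartAt I p p) := by
  have h := ((hθ m p).differentiableOn (by simp)) (extChartAt I p p) (mem_extChartAt_target p)
  exact h.mono_of_mem_nhdsWithin (extChartAt_target_mem_nhdsWithin p)

theorem dForm_zero : dForm I (0 : GradedForm E M) = 0 := by
  funext m
  cases m with
  | zero => rfl
  | succ m =>
    funext p
    have : formInChart I m ((0 : GradedForm E M) m) p = (0 : ℝ) • fun _ => 0 := by
      ext y v; simp [formInChart]
    simp only [dForm, this]
    rw [extDerivWithin_smul _ _ (I.uniqueDiffOn _ (by simp))]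
    ext v; simp

theorem dForm_add {θ η : GradedForm E M} (hθ : IsSmoothForm I θ) (hη : IsSmoothForm I η) :
    dForm I (θ + η) = dForm I θ + dForm I η := by
  funext m
  cases m with
  | zero => simp [dForm]
  | succ m =>
    funext p
    simp only [dForm, Pi.add_apply]
    rw [formInChart_add, extDerivWithin_add (I.uniqueDiffOn _ (by simp))
      (hθ.differentiableWithinAt m p) (hη.differentiableWithinAt m p)]
    ext v; simp

theorem dForm_smul (c : ℝ) (θ : GradedForm E M) :
    dForm I (c • θ) = c • dForm I θ := by
  funext m
  cases m with
  | zero => simp [dForm]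
  | succ m =>
    funext p
    simp only [dForm, Pi.smul_apply]
    rw [formInChart_smul, extDerivWithin_smul _ _ (I.uniqueDiffOn _ (by simp))]
    ext v; simp

variable (I)

/-- The space `Ω^k(M)` of smooth differential forms of degree `k`; it is zero for `k < 0`. -/
def Omega (M : Type*) [TopologicalSpace M] [ChartedSpace H M] (k : ℤ) :
    Submodule ℝ (GradedForm E M) where
  carrier := {θ | IsSmoothForm I θ ∧ ∀ m : ℕ, (m : ℤ) ≠ k → θ m = 0}
  add_mem' := fun ha hb => ⟨ha.1.add hb.1, fun m hm => by simp [ha.2 m hm, hb.2 m hm]⟩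
  zero_mem' := ⟨IsSmoothForm.zero, fun _ _ => rfl⟩
  smul_mem' := fun c _ ha => ⟨ha.1.smul c, fun m hm => by simp [ha.2 m hm]⟩

/-- The space `𝔛(M)` of smooth vector fields on `M`. -/
def SmoothVectorField (M : Type*) [TopologicalSpace M] [ChartedSpace H M] [IsManifold I ∞ M] :
    Submodule ℝ (M → E) where
  carrier := {v | ContMDiff I I.tangent ∞ (fun p => (⟨p, v p⟩ : TangentBundle I M))}
  add_mem' := fun ha hb => ContMDiff.add_section ha hb
  zero_mem' := Bundle.contMDiff_zeroSection ℝ (TangentSpace I : M → Type _)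
  smul_mem' := fun _ _ ha => ContMDiff.const_smul_section ha

/-- The Lie bracket `[v, w]` of vector fields. -/
def bracketField (v w : M → E) (p : M) : E :=
  VectorField.mlieBracket I (fun q => (v q : TangentSpace I q)) (fun q => w q) p

end Forms

/-! ## `L_∞`-algebras and morphisms from Lie algebras -/

section LInfinity

/-- The data of an `L_∞`-structure: a graded vector space, given by its homogeneous parts
`gr i` (`i : ℤ`) in an ambient vector space `L`, and brackets `l k` of `k` arguments
(`k ≥ 1`; `l 0` is irrelevant). -/
structure LInftyData (L : Type*) [AddCommGroup L] [Module ℝ L] where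
  gr : ℤ → Submodule ℝ L
  l : ∀ k : ℕ, (Fin k → L) → L

open Classical in
/-- The unshuffles belonging to a composition `m = k_1 + ⋯ + k_p`: the permutations which are
increasing on each of the consecutive blocks of lengths `k_1, …, k_p`. -/
def unshuffles {m : ℕ} (c : Composition m) : Finset (Equiv.Perm (Fin m)) :=
  Finset.univ.filter fun σ => ∀ i : Fin c.length, StrictMono fun t => σ (c.embedding i t)

/-- The sum of `(-1)^{i+j+1} f([x_i,x_j], x_1, …, x̂_i, …, x̂_j, …, x_m)` over
`1 ≤ i < j ≤ m`.  A pair of positions is written `(i, j + 1)` with `i ≤ j` and `0`-based `i, j`, so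
that the sign exponent is `(i + 1) + (j + 2) + 1`. -/
def bracketSum {𝔤 L : Type*} [LieRing 𝔤] [AddCommGroup L] [Module ℝ L]
    (f : ∀ k : ℕ, (Fin k → 𝔤) → L) : (m : ℕ) → (Fin m → 𝔤) → L
  | 0, _ => 0
  | 1, _ => 0
  | m + 2, x => ∑ i : Fin (m + 1), ∑ j ∈ Finset.Ici i, ((-1 : ℝ) ^ ((i : ℕ) + (j : ℕ))) •
      f (m + 1) (Fin.cons ⁅x i.castSucc, x j.succ⁆ (j.removeNth (i.castSucc.removeNth x)))

/-- `L_∞`-morphisms from a Lie algebra `𝔤`, placed in degree `0`, to an `L_∞`-algebra, in terms of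
their structure maps `f_k : 𝔤^{⊗k} → L`, which are skew-symmetric of degree `1 - k` (`k ≥ 1`;
`f 0` is irrelevant).  The last field is the equation `F Q = Q' F` between the corresponding
coalgebra morphism and the codifferentials on the reduced symmetric coalgebras of the desuspensions,
projected to cogenerators and written out with the structure maps: the unique coalgebra morphism
with components `𝐬⁻¹ f_k 𝐬^{⊗k}` has the components
`F^p_m (x_1 ⊙ ⋯ ⊙ x_m) = ∑_{k_1+⋯+k_p=m} ∑_σ (ε(σ)/p!) f_{k_1}(x_σ) ⊙ ⋯ ⊙ f_{k_p}(x_σ)`,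
and the exponent `p(p-1)/2 + ∑_i (p-i) k_i` is the décalage sign of `l_p` on elements
of degrees `1 - k_1, …, 1 - k_p`. -/
structure IsLInftyMorphism {𝔤 L : Type*} [LieRing 𝔤] [LieAlgebra ℝ 𝔤] [AddCommGroup L]
    [Module ℝ L] (A : LInftyData L) (f : ∀ k : ℕ, 𝔤 [⋀^Fin k]→ₗ[ℝ] L) : Prop where
  degree : ∀ (k : ℕ), 1 ≤ k → ∀ x : Fin k → 𝔤, f k x ∈ A.gr (1 - (k : ℤ))
  compat : ∀ (m : ℕ), 1 ≤ m → ∀ x : Fin m → 𝔤,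
    bracketSum (fun k => (f k : (Fin k → 𝔤) → L)) m x =
      ∑ c : Composition m, ∑ σ ∈ unshuffles c,
        (((Equiv.Perm.sign σ : ℤ) : ℝ) / (c.length ! : ℝ) *
          (-1 : ℝ) ^ (c.length * (c.length - 1) / 2 +
            ∑ i : Fin c.length, (c.length - 1 - (i : ℕ)) * c.blocksFun i)) •
          A.l c.length (fun i => f (c.blocksFun i) (fun t => x (σ (c.embedding i t))))

/-- The sign `ς(k) = -(-1)^{k(k+1)/2}`. -/
def varsigma (k : ℕ) : ℝ := -(-1) ^ (k * (k + 1) / 2)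

end LInfinity

/-! ## The Lie `n`-algebra of observables of a pre-`n`-plectic manifold -/

section Observables

variable {E : Type*} [NormedAddCommGroup E] [NormedSpace ℝ E]
  {H : Type*} [TopologicalSpace H] (I : ModelWithCorners ℝ E H)
  {M : Type*} [TopologicalSpace M] [ChartedSpace H M]

variable (E M) in
/-- The ambient vector space of the Lie `n`-algebra of observables: pairs of a vector field and a
graded form. -/
abbrev ObsSpace : Type _ := (M → E) × GradedForm E M

theorem interiorForm_add (v w : M → E) (θ : GradedForm E M) :
    interiorForm (v + w) θ = interiorForm v θ + interiorForm w θ := by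
  funext m p
  exact map_add ((θ (m + 1) p).curryLeft) (v p) (w p)

theorem interiorForm_smul (c : ℝ) (v : M → E) (θ : GradedForm E M) :
    interiorForm (c • v) θ = c • interiorForm v θ := by
  funext m p
  exact map_smul ((θ (m + 1) p).curryLeft) c (v p)

theorem interiorForm_zero (θ : GradedForm E M) :
    interiorForm (0 : M → E) θ = 0 := by
  funext m p
  exact map_zero ((θ (m + 1) p).curryLeft)

variable [IsManifold I ∞ M]

/-- The homogeneous parts of the Lie `n`-algebra of observables of `(M, θ)`: in degree `0`
the pairs `(v, α)` with `α ∈ Ω^{n-1}(M)` and `dα = -ι_v θ`, in the degrees `i` with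
`1 - n ≤ i < 0` the pairs `(0, α)` with `α ∈ Ω^{n-1+i}(M)`, and zero in all other degrees. -/
def obsDegree (n : ℕ) (θ : GradedForm E M) (i : ℤ) : Submodule ℝ (ObsSpace E M) where
  carrier := {y | y.1 ∈ SmoothVectorField I M ∧ y.2 ∈ Omega I M ((n : ℤ) - 1 + i) ∧
    (i = 0 → dForm I y.2 = -interiorForm y.1 θ) ∧ (i ≠ 0 → y.1 = 0) ∧
    (i ∉ Set.Icc (1 - (n : ℤ)) 0 → y = 0)}
  add_mem' := by
    rintro a b ⟨ha1, ha2, ha3, ha4, ha5⟩ ⟨hb1, hb2, hb3, hb4, hb5⟩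
    refine ⟨Submodule.add_mem _ ha1 hb1, Submodule.add_mem _ ha2 hb2, fun h => ?_, fun h => ?_,
      fun h => ?_⟩
    · rw [Prod.snd_add, Prod.fst_add, dForm_add ha2.1 hb2.1, ha3 h, hb3 h, interiorForm_add]
      abel
    · rw [Prod.fst_add, ha4 h, hb4 h, add_zero]
    · rw [ha5 h, hb5 h, add_zero]
  zero_mem' := by
    refine ⟨Submodule.zero_mem _, Submodule.zero_mem _, fun _ => ?_, fun _ => rfl, fun _ => rfl⟩
    rw [Prod.snd_zero, Prod.fst_zero, dForm_zero, interiorForm_zero, neg_zero]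
  smul_mem' := by
    rintro c a ⟨ha1, ha2, ha3, ha4, ha5⟩
    refine ⟨Submodule.smul_mem _ c ha1, Submodule.smul_mem _ c ha2, fun h => ?_, fun h => ?_,
      fun h => ?_⟩
    · rw [Prod.smul_snd, Prod.smul_fst, dForm_smul, ha3 h, interiorForm_smul, smul_neg]
    · rw [Prod.smul_fst, ha4 h, smul_zero]
    · rw [ha5 h, smul_zero]

/-- The brackets of the Lie `n`-algebra of observables: `l_1` is `d` in the degrees `< 0` and
`0` in degree `0`; `l_2((v_1,α_1),(v_2,α_2)) = ([v_1,v_2], ι(v_1 ∧ v_2) θ)` in degree `0`, and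
`l_k = ς(k) ι(v_1 ∧ ⋯ ∧ v_k) θ` for `k > 2` in degree `0`. For `k ≥ 2` the bracket vanishes if an
argument has degree `< 0`, because the vector field of that argument is zero; the truncation in
`l_1` discards exactly the forms `dα` of degree `n`, which come from elements `(v, α)` of
degree `0`. -/
def obsBracket (n : ℕ) (θ : GradedForm E M) : (k : ℕ) → (Fin k → ObsSpace E M) → ObsSpace E M
  | 0, _ => 0
  | 1, y => (0, fun m => if m < n then dForm I (y 0).2 m else 0)
  | 2, y => (bracketField I (y 0).1 (y 1).1,
      interiorForms 2 (fun i => (y i).1) θ)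
  | k + 3, y => (0, varsigma (k + 3) • interiorForms (k + 3) (fun i => (y i).1) θ)

/-- The Lie `n`-algebra of observables `Ham_∞(M, θ)`. -/
def hamInfty (n : ℕ) (θ : GradedForm E M) : LInftyData (ObsSpace E M) where
  gr := obsDegree I n θ
  l := obsBracket I n θ

end Observables

/-! ## Group actions, homotopy moment maps, and the Bott–Shulman–Stasheff complex -/

section Actions

variable {EG : Type*} [NormedAddCommGroup EG] [NormedSpace ℝ EG]
  {HG : Type*} [TopologicalSpace HG] (I : ModelWithCorners ℝ EG HG)
  {G : Type*} [TopologicalSpace G] [ChartedSpace HG G] [Group G]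
  {EM : Type*} [NormedAddCommGroup EM] [NormedSpace ℝ EM]
  {HM : Type*} [TopologicalSpace HM] (J : ModelWithCorners ℝ EM HM)
  {M : Type*} [TopologicalSpace M] [ChartedSpace HM M]

instance lieGroupMinSmoothness [LieGroup I ∞ G] : LieGroup I (minSmoothness ℝ 3) G :=
  LieGroup.of_le (n := ∞) (by
    rw [minSmoothness_of_isRCLikeNormedField]
    exact ENat.LEInfty.out)

/-- The fundamental vector field `v_x|_p = d/dt|_{t=0} exp(-t x) · p`, that is, minus the
derivative at the identity of the orbit map `g ↦ g · p` in the direction `x`. -/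
def fundamentalField [MulAction G M] (x : GroupLieAlgebra I G) (p : M) : EM :=
  -tangentMapAt I J (fun g : G => g • p) 1 x

/-- Invariance of a form under a family of transformations. -/
def IsInvariantForm (ρ : G → M → M) (θ : GradedForm EM M) : Prop :=
  ∀ g : G, pullbackForm J J (ρ g) θ = θ

/-- The average `∫_G g · θ dμ(g)` of a form, where `g` acts on forms by pullback along the
transformation of `g⁻¹`. -/
def averageForm [MeasurableSpace G] (μ : MeasureTheory.Measure G) (ρ : G → M → M)
    (θ : GradedForm EM M) : GradedForm EM M :=
  fun m p => ∫ g, pullbackForm J J (ρ g⁻¹) θ m p ∂μ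

/-- `θ` is a `G`-invariant pre-`n`-plectic form: a closed invariant smooth `(n+1)`-form. -/
structure IsInvariantPrePlectic [MulAction G M] (n : ℕ) (θ : GradedForm EM M) : Prop where
  mem : θ ∈ Omega J M ((n : ℤ) + 1)
  closed : dForm J θ = 0
  invariant : IsInvariantForm J (fun (g : G) (p : M) => g • p) θ

/-- A homotopy moment map for the action of `G` on the pre-`n`-plectic manifold `(M, θ)`: an
`L_∞`-morphism `𝔤 → Ham_∞(M, θ)` whose composition with the strict morphism
`π : Ham_∞(M, θ) → 𝔛_Ham(M)`, `(v, α) ↦ v`, is the Lie algebra morphism `x ↦ v_x`. -/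
structure IsHomotopyMomentMap [FiniteDimensional ℝ EG] [LieGroup I ∞ G] [IsManifold J ∞ M]
    [MulAction G M] (n : ℕ) (θ : GradedForm EM M)
    (F : ∀ k : ℕ, GroupLieAlgebra I G [⋀^Fin k]→ₗ[ℝ] ObsSpace EM M) : Prop where
  morphism : IsLInftyMorphism (hamInfty J n θ) F
  lift_one : ∀ x : Fin 1 → GroupLieAlgebra I G, (F 1 x).1 = fundamentalField I J (x 0)
  lift_higher : ∀ k : ℕ, 2 ≤ k → ∀ x : Fin k → GroupLieAlgebra I G, (F k x).1 = 0

/-- The manifold model of `G^j × M`. -/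
abbrev levelModel (j : ℕ) :
    ModelWithCorners ℝ ((Fin j → EG) × EM) (ModelProd (ModelPi fun _ : Fin j => HG) HM) :=
  (ModelWithCorners.pi fun _ : Fin j => I).prod J

/-- The face maps `d_i : G^{j+1} × M → G^j × M`: `d_0` drops `g_1`, `d_i` for
`0 < i < j + 1` multiplies `g_i g_{i+1}`, and `d_{j+1}` drops `g_{j+1}` and lets it act on `M`.
(`Fin.contractNth i` multiplies the neighbours at the `0`-based positions `i` and `i + 1`, and drops
the last entry if `i` is the last position.) -/
def faceMap [MulAction G M] (j : ℕ) (i : Fin (j + 2)) (q : (Fin (j + 1) → G) × M) :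
    (Fin j → G) × M :=
  Fin.cases (Fin.tail q.1, q.2)
    (fun i : Fin (j + 1) => (i.contractNth (· * ·) q.1,
      if i = Fin.last j then q.1 (Fin.last j) • q.2 else q.2)) i

variable (EG G EM M) in
/-- Families `(α_j)` of graded forms `α_j` on `G^j × M`. -/
abbrev BSSCochain : Type _ := ∀ j : ℕ, GradedForm ((Fin j → EG) × EM) ((Fin j → G) × M)

/-- The simplicial differential `∂ = ∑_i (-1)^i d_i^*`. -/
def simplicialDiff [MulAction G M] (j : ℕ)
    (θ : GradedForm ((Fin j → EG) × EM) ((Fin j → G) × M)) :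
    GradedForm ((Fin (j + 1) → EG) × EM) ((Fin (j + 1) → G) × M) :=
  ∑ i : Fin (j + 2), ((-1 : ℝ) ^ (i : ℕ)) •
    pullbackForm (levelModel I J (j + 1)) (levelModel I J j) (faceMap j i) θ

/-- The total differential `D = ∂ + (-1)^j d`. -/
def bssDiff [MulAction G M] (α : BSSCochain EG G EM M) : BSSCochain EG G EM M
  | 0 => dForm (levelModel I J 0) (α 0)
  | j + 1 => simplicialDiff I J j (α j) +
      ((-1 : ℝ) ^ (j + 1)) • dForm (levelModel I J (j + 1)) (α (j + 1))

/-- Cocycles of total degree `N` in the Bott–Shulman–Stasheff complex: `α = ∑_j α_j`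
with `α_j ∈ Ω^{N-j}(G^j × M)` and `D α = 0`. -/
structure IsBSSCocycle [MulAction G M] (N : ℕ) (α : BSSCochain EG G EM M) : Prop where
  mem : ∀ j : ℕ, α j ∈ Omega (levelModel I J j) ((Fin j → G) × M) ((N : ℤ) - j)
  cocycle : bssDiff I J α = 0

/-- The component `α_0`, as a form on `M = G^0 × M`. -/
def bssZero (α : BSSCochain EG G EM M) : GradedForm EM M :=
  pullbackForm J (levelModel I J 0) (fun p : M => ((fun i : Fin 0 => i.elim0 : Fin 0 → G), p)) (α 0)

/-- The component `α_1`, as a form on `G × M = G^1 × M`. -/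
def bssOne (α : BSSCochain EG G EM M) : GradedForm (EG × EM) (G × M) :=
  pullbackForm (I.prod J) (levelModel I J 1) (fun q : G × M => ((fun _ : Fin 1 => q.1), q.2)) (α 1)

variable (G M) in
/-- The action `g' · (g, p) = (g' g, p)` on `G × M`. -/
def leftTranslation (g' : G) (q : G × M) : G × M := (g' * q.1, q.2)

/-- The component `r(β)_k` of the restriction of a form `β` on `G × M` to `{e} × M`:
`r(β)_k(x_1, …, x_k)` is the form `(u_1, …, u_l) ↦ β((x_1,0), …, (x_k,0), (0,u_1), …, (0,u_l))`
on `M = {e} × M`. -/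
def restrictToUnit (β : GradedForm (EG × EM) (G × M)) (k : ℕ)
    (x : Fin k → GroupLieAlgebra I G) : GradedForm EM M :=
  pullbackForm J (I.prod J) (fun p : M => ((1 : G), p))
    (interiorForms k
      (fun i q => ((mulInvariantVectorField (x i) q.1 : EG), (0 : EM))) β)

end Actions

end

set_option linter.unusedSectionVars false

/-! Only the two lowest components of `D α = 0` enter. With ω = α_0 and β = α_1 they read dω = 0 and
dβ = pr^*ω - a^*ω, where pr, a : G × M → M are the projection and the action
(`IsBSSCocycle.dForm_bssOne`).

Evaluate the second equation at (e, p) on k ≥ 1 vectors (x_i, 0) followed by vectors (0, u_j), and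
write r_k for r(β)_k. If β is left invariant, its values on left invariant fields are constant along
G, so in the group directions Palais' formula leaves only bracket terms. Hence dβ contributes -∑ ±
r_{k-1}([x_i,x_j], …) + (-1)^k d r_k (`IsInvariantForm.dForm_apply_appendProd`). The term pr^*ω
vanishes because k ≥ 1, and a has differential (x, u) ↦ u - v_x at (e, p), so a^*ω contributes
(-1)^k ι(v_{x_1} ∧ ⋯ ∧ v_{x_k})ω. Therefore ∑ ± r_{k-1}([x_i,x_j], …) = (-1)^k (d r_k + ι(v_{x_1} ∧
⋯ ∧ v_{x_k})ω) (`bracketSum_restrictToUnit`). Since ς(k) = (-1)^k ς(k-1), the forms f_k = ς(k) r_k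
satisfy ∑ ± f_{k-1}([x_i,x_j], …) = d f_k + ς(k) ι(v_{x_1} ∧ ⋯ ∧ v_{x_k})ω.

This is the form part of the L_∞-morphism equation. The brackets of arity ≥ 2 of `hamInfty` see only
vector fields, and f_k has none for k ≥ 2, so only the compositions (m) and (1, …, 1) of m
contribute (`sum_compositionTerm`). The vector field part is [v_x, v_y] = v_{[x,y]}
(`bracketField_fundamentalField`).

For compact G, averaging commutes with d and with pullbacks. Left translation by g⁻¹ on G × M
preserves pr and turns a into g⁻¹ · a, so the averaged forms satisfy dβ^G = pr^*ω - a^*ω^G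
(`dForm_averageForm_leftTranslation`). The unaveraged ω under pr^* does no harm, because that term
drops out when k ≥ 1; for this reason `isHomotopyMomentMap_momentMap` allows two different forms
under pr^* and a^*. -/

section Preliminaries

open Set Filter Topology

/-! ### Pullbacks of forms and naturality of the de Rham differential -/

section Pullback

variable {E : Type*} [NormedAddCommGroup E] [NormedSpace ℝ E]
  {H : Type*} [TopologicalSpace H] {I : ModelWithCorners ℝ E H}
  {M : Type*} [TopologicalSpace M] [ChartedSpace H M]
  {E' : Type*} [NormedAddCommGroup E'] [NormedSpace ℝ E']
  {H' : Type*} [TopologicalSpace H'] {I' : ModelWithCorners ℝ E' H'}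
  {M' : Type*} [TopologicalSpace M'] [ChartedSpace H' M']
  {E'' : Type*} [NormedAddCommGroup E''] [NormedSpace ℝ E'']
  {H'' : Type*} [TopologicalSpace H''] {I'' : ModelWithCorners ℝ E'' H''}
  {M'' : Type*} [TopologicalSpace M''] [ChartedSpace H'' M'']

theorem tangentMapAt_comp {g : M' → M''} {f : M → M'} {p : M}
    (hg : MDifferentiableAt I' I'' g (f p)) (hf : MDifferentiableAt I I' f p) :
    tangentMapAt I I'' (g ∘ f) p =
      (tangentMapAt I' I'' g (f p)).comp (tangentMapAt I I' f p) :=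
  mfderiv_comp p hg hf

theorem tangentMapAt_id (p : M) : tangentMapAt I I (id : M → M) p = ContinuousLinearMap.id ℝ E :=
  mfderiv_id

theorem pullbackForm_comp {g : M' → M''} {f : M → M'}
    (hg : MDifferentiable I' I'' g) (hf : MDifferentiable I I' f) (θ : GradedForm E'' M'') :
    pullbackForm I I' f (pullbackForm I' I'' g θ) = pullbackForm I I'' (g ∘ f) θ := by
  funext m p
  ext v
  simp only [pullbackForm, tangentMapAt_comp (hg (f p)) (hf p)]
  rfl

theorem pullbackForm_add (f : M → M') (θ η : GradedForm E' M') :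
    pullbackForm I I' f (θ + η) = pullbackForm I I' f θ + pullbackForm I I' f η := rfl

theorem pullbackForm_smul (f : M → M') (c : ℝ) (θ : GradedForm E' M') :
    pullbackForm I I' f (c • θ) = c • pullbackForm I I' f θ := rfl

theorem pullbackForm_zero (f : M → M') :
    pullbackForm I I' f (0 : GradedForm E' M') = 0 := rfl

theorem chartSymmDeriv_comp_tangentMapAt [IsManifold I 1 M] {p : M} {x : M}
    (hx : x ∈ (extChartAt I p).source) :
    (chartSymmDeriv I p (extChartAt I p x)).comp
      (tangentMapAt I 𝓘(ℝ, E) (extChartAt I p) x) = ContinuousLinearMap.id ℝ E :=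
  mfderivWithin_extChartAt_symm_comp_mfderiv_extChartAt' hx

theorem tangentMapAt_extChartAt_self [IsManifold I 1 M] (p : M) :
    tangentMapAt I 𝓘(ℝ, E) (extChartAt I p) p = ContinuousLinearMap.id ℝ E :=
  mfderiv_extChartAt_self

theorem chartSymmDeriv_self [IsManifold I 1 M] (p : M) :
    chartSymmDeriv I p (extChartAt I p p) = ContinuousLinearMap.id ℝ E :=
  mfderivWithin_range_extChartAt_symm

variable [I.Boundaryless]

theorem mdifferentiableAt_extChartAt_symm [IsManifold I 1 M] {p : M} {y : E}
    (hy : y ∈ (extChartAt I p).target) :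
    MDifferentiableAt 𝓘(ℝ, E) I (extChartAt I p).symm y := by
  have h := mdifferentiableWithinAt_extChartAt_symm hy
  rwa [I.range_eq_univ, mdifferentiableWithinAt_univ] at h

theorem chartSymmDeriv_eq (p : M) (y : E) :
    chartSymmDeriv I p y = tangentMapAt 𝓘(ℝ, E) I (extChartAt I p).symm y := by
  rw [chartSymmDeriv, I.range_eq_univ, mfderivWithin_univ]
  rfl

/-- The derivative of the expression of a map in the charts at `p` and `p'`. -/
theorem fderiv_chart_comp [IsManifold I 1 M] [IsManifold I' 1 M'] {f : M → M'} {p : M} {p' : M'}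
    {y : E} (hy : y ∈ (extChartAt I p).target)
    (hy' : f ((extChartAt I p).symm y) ∈ (extChartAt I' p').source)
    (hf : MDifferentiableAt I I' f ((extChartAt I p).symm y)) :
    fderiv ℝ (fun z => extChartAt I' p' (f ((extChartAt I p).symm z))) y =
      ((tangentMapAt I' 𝓘(ℝ, E') (extChartAt I' p') (f ((extChartAt I p).symm y))).comp
        (tangentMapAt I I' f ((extChartAt I p).symm y))).comp (chartSymmDeriv I p y) := by
  have h1 := mdifferentiableAt_extChartAt_symm (I := I) hy
  have h2 : MDifferentiableAt I' 𝓘(ℝ, E') (extChartAt I' p') (f ((extChartAt I p).symm y)) :=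
    mdifferentiableAt_extChartAt (by rwa [extChartAt_source] at hy')
  have h3 := tangentMapAt_comp (p := y) (h2.comp _ hf) h1
  rw [tangentMapAt_comp h2 hf, ← chartSymmDeriv_eq] at h3
  rw [← h3, tangentMapAt, mfderiv_eq_fderiv]
  rfl

/-- The expression of a pullback in charts. -/
theorem formInChart_pullbackForm [IsManifold I 1 M] [IsManifold I' 1 M'] {f : M → M'} {p : M}
    {p' : M'} {y : E} (hy : y ∈ (extChartAt I p).target)
    (hy' : f ((extChartAt I p).symm y) ∈ (extChartAt I' p').source)
    (hf : MDifferentiableAt I I' f ((extChartAt I p).symm y)) (θ : GradedForm E' M') (m : ℕ) :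
    formInChart I m (pullbackForm I I' f θ m) p y =
      (formInChart I' m (θ m) p' (extChartAt I' p' (f ((extChartAt I p).symm y)))
        ).compContinuousLinearMap
          (fderiv ℝ (fun z => extChartAt I' p' (f ((extChartAt I p).symm z))) y) := by
  rw [fderiv_chart_comp hy hy' hf]
  ext v
  have h := chartSymmDeriv_comp_tangentMapAt (I := I') hy'
  have h' : ∀ w, chartSymmDeriv I' p' (extChartAt I' p' (f ((extChartAt I p).symm y)))
      (tangentMapAt I' 𝓘(ℝ, E') (extChartAt I' p') (f ((extChartAt I p).symm y)) w) = w :=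
    fun w => DFunLike.congr_fun h w
  simp only [formInChart, pullbackForm,
    ContinuousAlternatingMap.compContinuousLinearMap_apply, (extChartAt I' p').left_inv hy']
  congr 1
  ext i
  exact (h' _).symm

theorem eventually_mem_target_source {f : M → M'} {p : M} {p' : M'} {y : E}
    (hy : y ∈ (extChartAt I p).target)
    (hy' : f ((extChartAt I p).symm y) ∈ (extChartAt I' p').source) (hf : Continuous f) :
    ∀ᶠ z in 𝓝 y, z ∈ (extChartAt I p).target ∧
      f ((extChartAt I p).symm z) ∈ (extChartAt I' p').source := by
  have h1 := extChartAt_target_mem_nhds' (I := I) hy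
  refine (eventually_of_mem h1 fun _ h => h).and ?_
  have h2 : ContinuousAt (fun z => f ((extChartAt I p).symm z)) y :=
    hf.continuousAt.comp (continuousAt_extChartAt_symm'' hy)
  exact h2 ((isOpen_extChartAt_source p').mem_nhds hy')

theorem contDiffAt_chart_comp [IsManifold I ∞ M] [IsManifold I' ∞ M'] {f : M → M'}
    (hf : ContMDiff I I' ∞ f) {p : M} {p' : M'}
    {y : E} (hy : y ∈ (extChartAt I p).target)
    (hy' : f ((extChartAt I p).symm y) ∈ (extChartAt I' p').source) :
    ContDiffAt ℝ ∞ (fun z => extChartAt I' p' (f ((extChartAt I p).symm z))) y := by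
  rw [← contMDiffAt_iff_contDiffAt]
  have h1 : ContMDiffAt 𝓘(ℝ, E) I ∞ (extChartAt I p).symm y :=
    (contMDiffOn_extChartAt_symm p).contMDiffAt (extChartAt_target_mem_nhds' hy)
  have h2 : ContMDiffAt I' 𝓘(ℝ, E') ∞ (extChartAt I' p') (f ((extChartAt I p).symm y)) :=
    contMDiffAt_extChartAt' (by rwa [extChartAt_source] at hy')
  exact h2.comp y (hf.contMDiffAt.comp y h1)

/-- The preferred chart at `p` has the identity as derivative at `p`, so the pullback in `dForm`
disappears; without boundary the range of `I` is everything. -/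
theorem dForm_succ [IsManifold I 1 M] (θ : GradedForm E M) (m : ℕ) (p : M) :
    dForm I θ (m + 1) p = extDeriv (formInChart I m (θ m) p) (extChartAt I p p) := by
  simp only [dForm]
  rw [tangentMapAt_extChartAt_self, I.range_eq_univ, extDerivWithin_univ]
  rfl

theorem IsSmoothForm.contDiffAt {θ : GradedForm E M} (hθ : IsSmoothForm I θ) (m : ℕ) {p : M}
    {y : E} (hy : y ∈ (extChartAt I p).target) :
    ContDiffAt ℝ ∞ (formInChart I m (θ m) p) y :=
  (hθ m p).contDiffAt (extChartAt_target_mem_nhds' hy)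

/-- The de Rham differential commutes with pullbacks. -/
theorem dForm_pullbackForm [IsManifold I ∞ M] [I'.Boundaryless] [IsManifold I' ∞ M'] {f : M → M'}
    (hf : ContMDiff I I' ∞ f) {θ : GradedForm E' M'} (hθ : IsSmoothForm I' θ) :
    dForm I (pullbackForm I I' f θ) = pullbackForm I I' f (dForm I' θ) := by
  have : IsManifold I 1 M := .of_le (n := ∞) (by simp)
  have : IsManifold I' 1 M' := .of_le (n := ∞) (by simp)
  funext m
  cases m with
  | zero => rfl
  | succ m =>
    funext p
    have hp := mem_extChartAt_target (I := I) p
    have hx : (extChartAt I p).symm (extChartAt I p p) = p := extChartAt_to_inv p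
    have hp' : f ((extChartAt I p).symm (extChartAt I p p)) ∈ (extChartAt I' (f p)).source := by
      rw [hx]; exact mem_extChartAt_source (f p)
    have hmd : MDifferentiable I I' f := hf.mdifferentiable (by simp)
    have key : formInChart I m (pullbackForm I I' f θ m) p =ᶠ[𝓝 (extChartAt I p p)] fun y =>
        (formInChart I' m (θ m) (f p) (extChartAt I' (f p) (f ((extChartAt I p).symm y)))
        ).compContinuousLinearMap
          (fderiv ℝ (fun z => extChartAt I' (f p) (f ((extChartAt I p).symm z))) y) := by
      filter_upwards [eventually_mem_target_source hp hp' hf.continuous] with y hy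
      exact formInChart_pullbackForm hy.1 hy.2 (hmd _) θ m
    -- This reduces to naturality of the exterior derivative in vector spaces, applied to the chart
    -- expression of `f`; at `p` itself the chart derivatives are identities.
    rw [dForm_succ, key.extDeriv_eq, extDeriv_pullback (r := ∞) _
      (contDiffAt_chart_comp hf hp hp')]
    · rw [fderiv_chart_comp hp hp' (hmd _)]
      simp only [pullbackForm, hx, dForm_succ, tangentMapAt_extChartAt_self, chartSymmDeriv_self]
      rfl
    · simp [minSmoothness_of_isRCLikeNormedField]
      exact ENat.LEInfty.out
    · rw [hx]
      exact (hθ.contDiffAt m (mem_extChartAt_target _)).differentiableAt (by simp)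

/-! ### Smoothness of pullbacks -/

section Smoothness

open ContinuousAlternatingMap in
/-- Alternatization, divided by the factorial, as a continuous projection of the multilinear onto
the alternating maps. -/
noncomputable def altProjection (F : Type*) [NormedAddCommGroup F] [NormedSpace ℝ F] (m : ℕ) :
    ContinuousMultilinearMap ℝ (fun _ : Fin m => F) ℝ →L[ℝ] F [⋀^Fin m]→L[ℝ] ℝ :=
  LinearMap.mkContinuous
    { toFun := fun f => (m ! : ℝ)⁻¹ • ContinuousMultilinearMap.alternatization f
      map_add' := fun f g => by rw [map_add, smul_add]
      map_smul' := fun c f => by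
        ext v
        simp [ContinuousMultilinearMap.alternatization_apply_apply, Finset.mul_sum,
          Units.smul_def, mul_left_comm] }
    1 fun f => by
      rw [one_mul]
      refine ContinuousAlternatingMap.opNorm_le_bound _ (norm_nonneg f) fun v => ?_
      have h1 : ‖∑ σ : Equiv.Perm (Fin m), Equiv.Perm.sign σ • f (v ∘ σ)‖ ≤
          (m ! : ℝ) * (‖f‖ * ∏ i, ‖v i‖) := by
        refine (norm_sum_le _ _).trans ?_
        have h2 : ∀ σ : Equiv.Perm (Fin m), ‖Equiv.Perm.sign σ • f (v ∘ σ)‖ ≤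
            ‖f‖ * ∏ i, ‖v i‖ := fun σ => by
          have h3 : ‖Equiv.Perm.sign σ • f (v ∘ σ)‖ = ‖f (v ∘ σ)‖ := by
            rcases Int.units_eq_one_or (Equiv.Perm.sign σ) with h | h <;> simp [h]
          rw [h3, ← Equiv.prod_comp σ fun i => ‖v i‖]
          exact f.le_opNorm _
        refine (Finset.sum_le_sum fun σ _ => h2 σ).trans ?_
        simp [Fintype.card_perm]
      have h0 : (0 : ℝ) < m ! := by positivity
      simp only [LinearMap.coe_mk, AddHom.coe_mk, ContinuousAlternatingMap.smul_apply,
        ContinuousMultilinearMap.alternatization_apply_apply, norm_smul, norm_inv,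
        Real.norm_natCast]
      rw [inv_mul_le_iff₀ h0]
      exact h1

theorem altProjection_coe {F : Type*} [NormedAddCommGroup F] [NormedSpace ℝ F] {m : ℕ}
    (f : F [⋀^Fin m]→L[ℝ] ℝ) : altProjection F m f.toContinuousMultilinearMap = f := by
  ext v
  have h0 : (m ! : ℝ) ≠ 0 := by positivity
  have h : ∀ σ : Equiv.Perm (Fin m),
      Equiv.Perm.sign σ • f.toContinuousMultilinearMap (v ∘ σ) = f v := fun σ => by
    have h1 : f.toContinuousMultilinearMap (v ∘ σ) = Equiv.Perm.sign σ • f v :=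
      f.toAlternatingMap.map_perm v σ
    rw [h1, smul_smul, Int.units_mul_self, one_smul]
  change (m ! : ℝ)⁻¹ • ContinuousMultilinearMap.alternatization f.toContinuousMultilinearMap v = f v
  rw [ContinuousMultilinearMap.alternatization_apply_apply, Finset.sum_congr rfl fun σ _ => h σ]
  simp [Fintype.card_perm, h0]

/-- For multilinear maps, precomposition is continuous multilinear in the linear maps and hence
smooth. `altProjection` carries this over to alternating maps, because it is continuous linear and
fixes them. -/
theorem ContDiffAt.compContinuousLinearMap_alternating {F F' V : Type*}
    [NormedAddCommGroup F] [NormedSpace ℝ F] [NormedAddCommGroup F'] [NormedSpace ℝ F']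
    [NormedAddCommGroup V] [NormedSpace ℝ V] {m : ℕ} {n : WithTop ℕ∞}
    {f : V → F' [⋀^Fin m]→L[ℝ] ℝ} {g : V → F →L[ℝ] F'} {x : V}
    (hf : ContDiffAt ℝ n f x) (hg : ContDiffAt ℝ n g x) :
    ContDiffAt ℝ n (fun y => (f y).compContinuousLinearMap (g y)) x := by
  have h1 : ContDiffAt ℝ n (fun y =>
      ContinuousMultilinearMap.compContinuousLinearMapContinuousMultilinear ℝ
        (fun _ : Fin m => F) (fun _ => F') ℝ (fun _ => g y)) x :=
    (ContinuousMultilinearMap.contDiff _).contDiffAt.comp x (contDiffAt_pi.2 fun _ => hg)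
  have h2 : ContDiffAt ℝ n (fun y =>
      ContinuousAlternatingMap.toContinuousMultilinearMapCLM ℝ (f y)) x :=
    (ContinuousLinearMap.contDiff _).contDiffAt.comp x hf
  refine ((altProjection F m).contDiff.contDiffAt.comp x (h1.clm_apply h2)).congr_of_eventuallyEq
    (Eventually.of_forall fun y => ?_)
  exact (altProjection_coe ((f y).compContinuousLinearMap (g y))).symm

theorem IsSmoothForm.pullback [IsManifold I ∞ M] [I'.Boundaryless] [IsManifold I' ∞ M']
    {f : M → M'} (hf : ContMDiff I I' ∞ f) {θ : GradedForm E' M'} (hθ : IsSmoothForm I' θ) :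
    IsSmoothForm I (pullbackForm I I' f θ) := by
  have : IsManifold I 1 M := .of_le (n := ∞) (by simp)
  have : IsManifold I' 1 M' := .of_le (n := ∞) (by simp)
  intro m p y hy
  -- The target chart is centred at the image of the point under consideration, since `f` need not
  -- send the whole chart domain around `p` into one chart.
  obtain ⟨q, hq⟩ : ∃ q, q = f ((extChartAt I p).symm y) := ⟨_, rfl⟩
  have hy' : f ((extChartAt I p).symm y) ∈ (extChartAt I' q).source := by
    rw [hq]; exact mem_extChartAt_source _
  have key : formInChart I m (pullbackForm I I' f θ m) p =ᶠ[𝓝 y] fun y =>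
      (formInChart I' m (θ m) q
        (extChartAt I' q (f ((extChartAt I p).symm y)))
      ).compContinuousLinearMap
        (fderiv ℝ (fun z => extChartAt I' q
          (f ((extChartAt I p).symm z))) y) := by
    filter_upwards [eventually_mem_target_source hy hy' hf.continuous] with z hz
    exact formInChart_pullbackForm hz.1 hz.2 (hf.mdifferentiable (by simp) _) θ m
  have h1 := contDiffAt_chart_comp hf hy hy'
  refine (ContDiffAt.congr_of_eventuallyEq ?_ key).contDiffWithinAt
  refine ContDiffAt.compContinuousLinearMap_alternating ?_ (h1.fderiv_right (by simp))
  exact ContDiffAt.comp y (hθ.contDiffAt m ((extChartAt I' q).map_source hy')) h1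

theorem pullbackForm_mem_Omega [IsManifold I ∞ M] [I'.Boundaryless] [IsManifold I' ∞ M']
    {f : M → M'} (hf : ContMDiff I I' ∞ f) {k : ℤ} {θ : GradedForm E' M'} (hθ : θ ∈ Omega I' M' k) :
    pullbackForm I I' f θ ∈ Omega I M k :=
  ⟨hθ.1.pullback hf, fun m hm => by
    funext p
    simp only [pullbackForm, hθ.2 m hm]
    rfl⟩

end Smoothness

end Pullback

/-! ### Finite powers of a manifold -/

section PiManifold

universe u v w

variable {ι : Type u} [Fintype ι] {E : Type v} [NormedAddCommGroup E] [NormedSpace ℝ E]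
  {H : Type w} [TopologicalSpace H] {I : ModelWithCorners ℝ E H}
  {G : Type*} [TopologicalSpace G] [ChartedSpace H G]
  {E' : Type*} [NormedAddCommGroup E'] [NormedSpace ℝ E']
  {H' : Type*} [TopologicalSpace H'] {J : ModelWithCorners ℝ E' H'}
  {M : Type*} [TopologicalSpace M] [ChartedSpace H' M]

instance ModelWithCorners.boundaryless_pi [I.Boundaryless] :
    (ModelWithCorners.pi fun _ : ι => I).Boundaryless := by
  constructor
  change range (Pi.map fun _ : ι => (I : H → E)) = univ
  rw [Set.range_piMap]
  simp [I.range_eq_univ]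

/-- The charts of the power are products of charts, so the transition maps are smooth componentwise.
-/
instance IsManifold.pi [IsManifold I ∞ G] :
    IsManifold (ModelWithCorners.pi fun _ : ι => I) ∞ (ι → G) := by
  refine isManifold_of_contDiffOn _ _ _ ?_
  rintro _ _ ⟨e, he, rfl⟩ ⟨e', he', rfl⟩
  refine contDiffOn_pi.2 fun i => ?_
  have h := (contDiffGroupoid ∞ I).compatible (he i (mem_univ i)) (he' i (mem_univ i))
  have h1 : ContDiffOn ℝ ∞ (I ∘ ((e i).symm ≫ₕ e' i) ∘ I.symm)
      (I.symm ⁻¹' ((e i).symm ≫ₕ e' i).source ∩ range I) :=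
    (mem_groupoid_of_pregroupoid.1 h).1
  refine h1.comp (t := _) (contDiff_apply ℝ E i).contDiffOn ?_
  rintro y ⟨hy, z, rfl⟩
  refine ⟨?_, z i, rfl⟩
  simp only [mem_preimage, OpenPartialHomeomorph.trans_source, mem_inter_iff] at hy ⊢
  exact ⟨hy.1 i (mem_univ i), hy.2 i (mem_univ i)⟩

theorem contMDiff_eval (i : ι) [IsManifold I ∞ G] :
    ContMDiff (ModelWithCorners.pi fun _ : ι => I) I ∞ (fun g : ι → G => g i) := by
  intro g
  rw [contMDiffAt_iff]
  refine ⟨(continuous_apply i).continuousAt, ?_⟩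
  have h : ContDiffWithinAt ℝ ∞ (fun y : ι → E => y i)
    (range (ModelWithCorners.pi fun _ : ι => I)) (extChartAt (ModelWithCorners.pi fun _ : ι => I) g g) :=
    (contDiff_apply ℝ E i).contDiffWithinAt
  refine h.congr_of_eventuallyEq ?_ ?_
  · filter_upwards [extChartAt_target_mem_nhdsWithin g] with y hy
    rw [extChartAt_target] at hy
    obtain ⟨hy, z, rfl⟩ := hy
    refine (extChartAt I (g i)).right_inv ?_
    rw [extChartAt_target]
    exact ⟨hy i (mem_univ i), z i, rfl⟩
  · exact (extChartAt I (g i)).right_inv ((extChartAt I (g i)).map_source (mem_extChartAt_source _))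

theorem contMDiff_piMk {f : M → ι → G} (hf : ∀ i, ContMDiff J I ∞ fun x => f x i) :
    ContMDiff J (ModelWithCorners.pi fun _ : ι => I) ∞ f := by
  intro x
  rw [contMDiffAt_iff]
  exact ⟨(continuous_pi fun i => (hf i).continuous).continuousAt,
    contDiffWithinAt_pi.2 fun i => (contMDiffAt_iff.1 (hf i x)).2⟩

end PiManifold

/-! ### The cocycle equations on M and on G × M -/

section Cocycle

variable {EG : Type*} [NormedAddCommGroup EG] [NormedSpace ℝ EG]
  {HG : Type*} [TopologicalSpace HG] {I : ModelWithCorners ℝ EG HG} [I.Boundaryless]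
  {G : Type*} [TopologicalSpace G] [ChartedSpace HG G] [Group G] [LieGroup I ∞ G]
  {EM : Type*} [NormedAddCommGroup EM] [NormedSpace ℝ EM]
  {HM : Type*} [TopologicalSpace HM] {J : ModelWithCorners ℝ EM HM} [J.Boundaryless]
  {M : Type*} [TopologicalSpace M] [ChartedSpace HM M] [IsManifold J ∞ M]
  [MulAction G M] [ContMDiffSMul I J ∞ G M]

theorem contMDiff_zeroLevel : ContMDiff J (levelModel I J 0) ∞
    (fun p : M => ((fun i : Fin 0 => i.elim0 : Fin 0 → G), p)) :=
  contMDiff_const.prodMk contMDiff_id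

theorem contMDiff_oneLevel : ContMDiff (I.prod J) (levelModel I J 1) ∞
    (fun q : G × M => ((fun _ : Fin 1 => q.1 : Fin 1 → G), q.2)) :=
  (contMDiff_piMk fun _ => contMDiff_fst).prodMk contMDiff_snd

theorem contMDiff_smul_prod : ContMDiff (I.prod J) J ∞ (fun q : G × M => q.1 • q.2) :=
  contMDiff_smul

theorem contMDiff_faceMap_zero (i : Fin 2) :
    ContMDiff (levelModel I J 1) (levelModel I J 0) ∞ (faceMap (G := G) (M := M) 0 i) := by
  have h0 : ContMDiff (levelModel I J 1) (ModelWithCorners.pi fun _ : Fin 0 => I) ∞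
      (fun q : (Fin 1 → G) × M => (faceMap 0 i q).1) := contMDiff_piMk fun i => i.elim0
  refine h0.prodMk ?_
  have h1 : ContMDiff (levelModel I J 1) I ∞ (fun q : (Fin 1 → G) × M => q.1 0) :=
    (contMDiff_eval 0).comp contMDiff_fst
  have h2 : ContMDiff (levelModel I J 1) J ∞ (fun q : (Fin 1 → G) × M => q.2) := contMDiff_snd
  fin_cases i
  · exact h2
  · exact contMDiff_smul_prod.comp (h1.prodMk h2)

variable {n : ℕ} {α : BSSCochain EG G EM M}

theorem neg_one_smul_gradedForm {E N : Type*} [NormedAddCommGroup E] [NormedSpace ℝ E]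
    (θ : GradedForm E N) : (-1 : ℝ) • θ = -θ := by
  funext m p
  ext v
  simp

theorem IsBSSCocycle.bssZero_mem (hα : IsBSSCocycle I J (n + 1) α) :
    bssZero I J α ∈ Omega J M ((n : ℤ) + 1) := by
  have h := hα.mem 0
  rw [show (((n + 1 : ℕ) : ℤ) - ((0 : ℕ) : ℤ)) = (n : ℤ) + 1 by push_cast; ring] at h
  exact pullbackForm_mem_Omega contMDiff_zeroLevel h

theorem IsBSSCocycle.bssOne_mem (hα : IsBSSCocycle I J (n + 1) α) :
    bssOne I J α ∈ Omega (I.prod J) (G × M) (n : ℤ) := by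
  have h := hα.mem 1
  rw [show (((n + 1 : ℕ) : ℤ) - ((1 : ℕ) : ℤ)) = (n : ℤ) by push_cast; ring] at h
  exact pullbackForm_mem_Omega contMDiff_oneLevel h

theorem IsBSSCocycle.dForm_bssZero (hα : IsBSSCocycle I J (n + 1) α) :
    dForm J (bssZero I J α) = 0 := by
  rw [bssZero, dForm_pullbackForm contMDiff_zeroLevel (hα.mem 0).1]
  have h : dForm (levelModel I J 0) (α 0) = 0 := congrFun hα.cocycle 0
  rw [h, pullbackForm_zero]

/-- The component of `D α = 0` on `G^1 × M` is ∂α_0 - dα_1 = 0, and the two faces `G × M → M` are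
the projection (sign +) and the action (sign -). -/
theorem IsBSSCocycle.dForm_bssOne (hα : IsBSSCocycle I J (n + 1) α) :
    dForm (I.prod J) (bssOne I J α) =
      pullbackForm (I.prod J) J (fun q : G × M => q.2) (bssZero I J α) -
        pullbackForm (I.prod J) J (fun q : G × M => q.1 • q.2) (bssZero I J α) := by
  have h : simplicialDiff I J 0 (α 0) +
      ((-1 : ℝ) ^ 1) • dForm (levelModel I J 1) (α 1) = 0 := congrFun hα.cocycle 1
  have h1 : dForm (levelModel I J 1) (α 1) = simplicialDiff I J 0 (α 0) := by
    rw [pow_one, neg_one_smul_gradedForm, ← sub_eq_add_neg, sub_eq_zero] at h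
    exact h.symm
  have hz : MDifferentiable J (levelModel I J 0)
      (fun p : M => ((fun i : Fin 0 => i.elim0 : Fin 0 → G), p)) :=
    contMDiff_zeroLevel.mdifferentiable (by simp)
  have ho : MDifferentiable (I.prod J) (levelModel I J 1)
      (fun q : G × M => ((fun _ : Fin 1 => q.1 : Fin 1 → G), q.2)) :=
    contMDiff_oneLevel.mdifferentiable (by simp)
  have hf : ∀ i, MDifferentiable (levelModel I J 1) (levelModel I J 0)
      (faceMap (G := G) (M := M) 0 i) := fun i =>
    (contMDiff_faceMap_zero i).mdifferentiable (by simp)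
  have hs : MDifferentiable (I.prod J) J (fun q : G × M => q.2) :=
    (contMDiff_snd (n := ∞)).mdifferentiable (by simp)
  have ha : MDifferentiable (I.prod J) J (fun q : G × M => q.1 • q.2) :=
    (contMDiff_smul_prod (I := I) (J := J)).mdifferentiable (by simp)
  rw [bssOne, dForm_pullbackForm contMDiff_oneLevel (hα.mem 1).1, h1, simplicialDiff,
    Fin.sum_univ_two, pullbackForm_add, pullbackForm_smul, pullbackForm_smul,
    pullbackForm_comp (hf 0) ho, pullbackForm_comp (hf 1) ho, bssZero,
    pullbackForm_comp hz hs, pullbackForm_comp hz ha]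
  -- The identifications of `M` with `G^0 × M` and of `G × M` with `G^1 × M` intertwine the faces
  -- with projection and action; the components in `G^0` agree because it is a point.
  have e0 : faceMap (G := G) (M := M) 0 0 ∘
      (fun q : G × M => ((fun _ : Fin 1 => q.1 : Fin 1 → G), q.2)) =
      (fun p : M => ((fun i : Fin 0 => i.elim0 : Fin 0 → G), p)) ∘ fun q : G × M => q.2 := by
    funext q
    exact Prod.ext (Subsingleton.elim _ _) rfl
  have e1 : faceMap (G := G) (M := M) 0 1 ∘
      (fun q : G × M => ((fun _ : Fin 1 => q.1 : Fin 1 → G), q.2)) =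
      (fun p : M => ((fun i : Fin 0 => i.elim0 : Fin 0 → G), p)) ∘
        fun q : G × M => q.1 • q.2 := by
    funext q
    exact Prod.ext (Subsingleton.elim _ _) rfl
  rw [e0, e1]
  simp only [Fin.val_zero, pow_zero, one_smul, Fin.val_one, pow_one, neg_one_smul_gradedForm,
    sub_eq_add_neg]

end Cocycle

/-! ### Integrals over a compact parameter space -/

section ParametricIntegral

open MeasureTheory

variable {K : Type*} [TopologicalSpace K] [CompactSpace K] [MeasurableSpace K]
  [OpensMeasurableSpace K] {μ : Measure K} [IsFiniteMeasure μ]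
  {E : Type*} [NormedAddCommGroup E] [NormedSpace ℝ E]
  {V : Type*} [NormedAddCommGroup V] [NormedSpace ℝ V]

theorem Continuous.integrable_of_compactSpace {f : K → V} (hf : Continuous f) : Integrable f μ :=
  hf.integrable_of_hasCompactSupport (HasCompactSupport.of_compactSpace f)

theorem ContinuousOn.integrable_slice {f : K → E → V} {U : Set E}
    (hf : ContinuousOn (Function.uncurry f) (univ ×ˢ U)) {x : E} (hx : x ∈ U) :
    Integrable (fun k => f k x) μ :=
  Continuous.integrable_of_compactSpace
    (hf.comp_continuous (by fun_prop : Continuous fun k : K => (k, x)) fun _ => ⟨trivial, hx⟩)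

/-- Differentiation under the integral sign over a compact space. -/
theorem hasFDerivAt_integral_of_compactSpace [FiniteDimensional ℝ E]
    {f : K → E → V} {f' : K → E → E →L[ℝ] V} {U : Set E}
    (hU : IsOpen U) (hf : ContinuousOn (Function.uncurry f) (univ ×ˢ U))
    (hf' : ContinuousOn (Function.uncurry f') (univ ×ˢ U))
    (hd : ∀ k, ∀ y ∈ U, HasFDerivAt (f k) (f' k y) y) {x : E} (hx : x ∈ U) :
    HasFDerivAt (fun y => ∫ k, f k y ∂μ) (∫ k, f' k x ∂μ) x := by
  have : ProperSpace E := FiniteDimensional.proper ℝ E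
  obtain ⟨S, hS, hSU, hSc⟩ := local_compact_nhds (hU.mem_nhds hx)
  -- Continuity on the compact set `K × S` bounds the derivative uniformly; the constant bound is
  -- integrable because the measure is finite.
  obtain ⟨C, hC⟩ := ((isCompact_univ (X := K)).prod hSc).exists_bound_of_continuousOn
    (hf'.mono (prod_mono_right hSU))
  refine hasFDerivAt_integral_of_dominated_of_fderiv_le (𝕜 := ℝ) (bound := fun _ => C) hS ?_
    (hf.integrable_slice hx) (hf'.integrable_slice hx).aestronglyMeasurable
    (ae_of_all _ fun k y hy => hC (k, y) ⟨trivial, hy⟩) (integrable_const C)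
    (ae_of_all _ fun k y hy => hd k y (hSU hy))
  filter_upwards [hU.mem_nhds hx] with y hy
  exact (hf.integrable_slice hy).aestronglyMeasurable

/-- The Taylor series of the integral is the integral of the Taylor series: joint continuity of
every iterated derivative allows differentiation under the integral at each order. -/
theorem contDiffOn_integral_of_compactSpace [FiniteDimensional ℝ E] [CompleteSpace V]
    {f : K → E → V} {U : Set E} (hU : IsOpen U)
    (hf : ∀ k, ContDiffOn ℝ ∞ (f k) U)
    (hc : ∀ j : ℕ, ContinuousOn (fun q : K × E => iteratedFDerivWithin ℝ j (f q.1) U q.2)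
      (univ ×ˢ U)) :
    ContDiffOn ℝ ∞ (fun y => ∫ k, f k y ∂μ) U := by
  have hT := fun k => (hf k).ftaylorSeriesWithin hU.uniqueDiffOn
  let L := fun j : ℕ => (continuousMultilinearCurryLeftEquiv ℝ (fun _ : Fin j.succ => E) V)
  have hd : ∀ j : ℕ, ∀ x ∈ U, HasFDerivAt
      (fun y => ∫ k, iteratedFDerivWithin ℝ j (f k) U y ∂μ)
      (∫ k, (iteratedFDerivWithin ℝ (j + 1) (f k) U x).curryLeft ∂μ) x := by
    intro j x hx
    refine hasFDerivAt_integral_of_compactSpace hU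
      (f := fun k y => iteratedFDerivWithin ℝ j (f k) U y) (hc j)
      (f' := fun k y => (iteratedFDerivWithin ℝ (j + 1) (f k) U y).curryLeft) ?_ ?_ hx
    · exact (L j).continuous.comp_continuousOn (hc (j + 1))
    · intro k y hy
      exact ((hT k).fderivWithin j (WithTop.coe_lt_coe.2 (WithTop.coe_lt_top j)) y hy).hasFDerivAt
        (hU.mem_nhds hy)
  have key : HasFTaylorSeriesUpToOn ((⊤ : ℕ∞) : WithTop ℕ∞) (fun y => ∫ k, f k y ∂μ)
      (fun y j => ∫ k, iteratedFDerivWithin ℝ j (f k) U y ∂μ) U := by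
    refine ⟨fun x hx => ?_, fun j _ x hx => ?_, fun j _ x hx => ?_⟩
    · have h := ((continuousMultilinearCurryFin0 ℝ E V).toContinuousLinearEquiv :
        ContinuousMultilinearMap ℝ (fun _ : Fin 0 => E) V →L[ℝ] V).integral_comp_comm (μ := μ)
        ((hc 0).integrable_slice (f := fun k y => iteratedFDerivWithin ℝ 0 (f k) U y) hx)
      refine h.symm.trans ?_
      refine integral_congr_ae (ae_of_all _ fun k => ?_)
      exact (hT k).zero_eq x hx
    · refine HasFDerivAt.hasFDerivWithinAt ?_
      have h := ContinuousLinearMap.integral_comp_comm (𝕜 := ℝ) (μ := μ)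
        (E := ContinuousMultilinearMap ℝ (fun _ : Fin (j + 1) => E) V)
        (Fₗ := E →L[ℝ] ContinuousMultilinearMap ℝ (fun _ : Fin j => E) V)
        (L j).toContinuousLinearEquiv.toContinuousLinearMap ((hc (j + 1)).integrable_slice
          (f := fun k y => iteratedFDerivWithin ℝ (j + 1) (f k) U y) hx)
      have h2 := hd j x hx
      have h3 : (∫ k, (iteratedFDerivWithin ℝ (j + 1) (f k) U x).curryLeft ∂μ) =
        (∫ k, iteratedFDerivWithin ℝ (j + 1) (f k) U x ∂μ).curryLeft := h
      rw [h3] at h2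
      exact h2
    · exact (hd j x hx).continuousAt.continuousWithinAt
  exact key.contDiffOn

/-- The iterated partial derivatives of a smooth function are continuous. -/
theorem ContDiffOn.continuousOn_iteratedFDerivWithin_snd {E₁ E₂ : Type*}
    [NormedAddCommGroup E₁] [NormedSpace ℝ E₁] [NormedAddCommGroup E₂] [NormedSpace ℝ E₂]
    {F : E₁ × E₂ → V} {A : Set E₁} {U : Set E₂} (hA : IsOpen A) (hU : IsOpen U)
    (hF : ContDiffOn ℝ ∞ F (A ×ˢ U)) (j : ℕ) :
    ContinuousOn (fun q : E₁ × E₂ => iteratedFDerivWithin ℝ j (fun y => F (q.1, y)) U q.2)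
      (A ×ˢ U) := by
  have hAU := hA.prod hU
  have hj : ((j : ℕ∞) : WithTop ℕ∞) ≤ ∞ := WithTop.coe_le_coe.2 le_top
  have key : ∀ q ∈ A ×ˢ U, iteratedFDerivWithin ℝ j (fun y => F (q.1, y)) U q.2 =
      (iteratedFDeriv ℝ j F q).compContinuousLinearMap
        fun _ => ContinuousLinearMap.inr ℝ E₁ E₂ := by
    rintro ⟨z, y⟩ hq
    -- The slice of `F` at `z` is the translate of `F` by `(z, 0)` composed with the linear
    -- inclusion `inr`, so the chain rule for linear maps expresses its derivatives through those of
    -- `F`.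
    have hcont : Continuous fun w : E₁ × E₂ => w + (z, (0 : E₂)) := by fun_prop
    have hS : IsOpen ((fun w : E₁ × E₂ => w + (z, 0)) ⁻¹' (A ×ˢ U)) := hAU.preimage hcont
    have hFz : ContDiffOn ℝ ∞ (fun w : E₁ × E₂ => F (w + (z, 0)))
        ((fun w : E₁ × E₂ => w + (z, 0)) ⁻¹' (A ×ˢ U)) :=
      hF.comp (by fun_prop) fun _ h => h
    have hpre : (ContinuousLinearMap.inr ℝ E₁ E₂) ⁻¹'
        ((fun w : E₁ × E₂ => w + (z, 0)) ⁻¹' (A ×ˢ U)) = U := by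
      ext u
      simp [hq.1]
    have h := (ContinuousLinearMap.inr ℝ E₁ E₂).iteratedFDerivWithin_comp_right hFz
      hS.uniqueDiffOn (by rw [hpre]; exact hU.uniqueDiffOn) (x := y)
      (by simpa using hq) hj
    rw [hpre, iteratedFDerivWithin_of_isOpen j hS (by simpa using hq),
      iteratedFDeriv_comp_add_right] at h
    simpa [Function.comp_def] using h
  refine ContinuousOn.congr ?_ key
  have h1 : ContinuousOn (iteratedFDeriv ℝ j F) (A ×ˢ U) := fun q hq =>
    ((hF.contDiffAt (hAU.mem_nhds hq)).continuousAt_iteratedFDeriv hj).continuousWithinAt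
  exact (ContinuousMultilinearMap.compContinuousLinearMapL
    fun _ : Fin j => ContinuousLinearMap.inr ℝ E₁ E₂).continuous.comp_continuousOn h1

end ParametricIntegral

/-! ### Integrating pullbacks of a form along a family of maps -/

section IntegralForm

open MeasureTheory

theorem ContDiffOn.continuousOn_fderiv_family {K : Type*} [TopologicalSpace K]
    {E : Type*} [NormedAddCommGroup E] [NormedSpace ℝ E]
    {V : Type*} [NormedAddCommGroup V] [NormedSpace ℝ V]
    {f : K → E → V} {U : Set E} (hU : IsOpen U)
    (hf : ∀ k, ContDiffOn ℝ ∞ (f k) U)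
    (hc : ∀ j : ℕ, ContinuousOn (fun q : K × E => iteratedFDerivWithin ℝ j (f q.1) U q.2)
      (univ ×ˢ U)) :
    ContinuousOn (fun q : K × E => fderiv ℝ (f q.1) q.2) (univ ×ˢ U) := by
  refine ((continuousMultilinearCurryFin1 ℝ E V).continuous.comp_continuousOn (hc 1)).congr ?_
  intro q hq
  exact (((hf q.1).ftaylorSeriesWithin hU.uniqueDiffOn).hasFDerivAt (by simp)
    (hU.mem_nhds hq.2)).fderiv

/-- The map `L` is kept general so that it can be the antisymmetrization that turns a derivative
into an exterior derivative. -/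
theorem clm_apply_fderiv_integral {K : Type*} [TopologicalSpace K] [CompactSpace K]
    [MeasurableSpace K] [OpensMeasurableSpace K] {μ : Measure K} [IsFiniteMeasure μ]
    {E : Type*} [NormedAddCommGroup E] [NormedSpace ℝ E] [FiniteDimensional ℝ E]
    {V : Type*} [NormedAddCommGroup V] [NormedSpace ℝ V] [CompleteSpace V]
    {W : Type*} [NormedAddCommGroup W] [NormedSpace ℝ W] [CompleteSpace W]
    (L : (E →L[ℝ] V) →L[ℝ] W) {f : K → E → V} {U : Set E} (hU : IsOpen U)
    (hf : ∀ k, ContDiffOn ℝ ∞ (f k) U)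
    (hc : ∀ j : ℕ, ContinuousOn (fun q : K × E => iteratedFDerivWithin ℝ j (f q.1) U q.2)
      (univ ×ˢ U)) {x : E} (hx : x ∈ U) :
    L (fderiv ℝ (fun y => ∫ k, f k y ∂μ) x) = ∫ k, L (fderiv ℝ (f k) x) ∂μ := by
  have hc0 : ContinuousOn (Function.uncurry f) (univ ×ˢ U) :=
    (continuousMultilinearCurryFin0 ℝ E _).continuous.comp_continuousOn (hc 0)
  have hc1 : ContinuousOn (Function.uncurry fun k y => fderiv ℝ (f k) y) (univ ×ˢ U) :=
    ContDiffOn.continuousOn_fderiv_family hU hf hc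
  have hd : ∀ k, ∀ y ∈ U, HasFDerivAt (f k) (fderiv ℝ (f k) y) y := fun k y hy =>
    (((hf k).contDiffAt (hU.mem_nhds hy)).differentiableAt (by simp)).hasFDerivAt
  rw [(hasFDerivAt_integral_of_compactSpace (μ := μ) hU hc0 hc1 hd hx).fderiv]
  exact (L.integral_comp_comm (hc1.integrable_slice hx)).symm

variable {EK : Type*} [NormedAddCommGroup EK] [NormedSpace ℝ EK]
  {HK : Type*} [TopologicalSpace HK] {IK : ModelWithCorners ℝ EK HK} [IK.Boundaryless]
  {K : Type*} [TopologicalSpace K] [ChartedSpace HK K] [IsManifold IK ∞ K]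
  {E : Type*} [NormedAddCommGroup E] [NormedSpace ℝ E]
  {H : Type*} [TopologicalSpace H] {I : ModelWithCorners ℝ E H} [I.Boundaryless]
  {M : Type*} [TopologicalSpace M] [ChartedSpace H M] [IsManifold I ∞ M]
  {E' : Type*} [NormedAddCommGroup E'] [NormedSpace ℝ E']
  {H' : Type*} [TopologicalSpace H'] {I' : ModelWithCorners ℝ E' H'} [I'.Boundaryless]
  {M' : Type*} [TopologicalSpace M'] [ChartedSpace H' M'] [IsManifold I' ∞ M']
  {Φ : K → M → M'} {θ : GradedForm E' M'}

theorem contMDiff_slice (hΦ : ContMDiff (IK.prod I) I' ∞ (Function.uncurry Φ)) (k : K) :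
    ContMDiff I I' ∞ (Φ k) :=
  hΦ.comp (contMDiff_const.prodMk contMDiff_id)

/-- In charts, the pullbacks by a family of maps are slices of the pullback by the total map. -/
theorem formInChart_pullbackForm_slice (hΦ : ContMDiff (IK.prod I) I' ∞ (Function.uncurry Φ))
    (θ : GradedForm E' M') (m : ℕ) {k₀ k : K} (hk : k ∈ (extChartAt IK k₀).source) {p : M} {y : E}
    (hy : y ∈ (extChartAt I p).target) :
    formInChart I m (pullbackForm I I' (Φ k) θ m) p y =
      (formInChart (IK.prod I) m (pullbackForm (IK.prod I) I' (Function.uncurry Φ) θ m) (k₀, p)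
        (extChartAt IK k₀ k, y)).compContinuousLinearMap (ContinuousLinearMap.inr ℝ EK E) := by
  have : IsManifold IK 1 K := .of_le (n := ∞) (by simp)
  have : IsManifold I 1 M := .of_le (n := ∞) (by simp)
  have hι : ContMDiff I (IK.prod I) ∞ (fun x : M => (k, x)) := contMDiff_const.prodMk contMDiff_id
  have hι' : MDifferentiable I (IK.prod I) (fun x : M => (k, x)) := hι.mdifferentiable (by simp)
  have h1 : pullbackForm I I' (Φ k) θ =
      pullbackForm I (IK.prod I) (fun x : M => (k, x))
        (pullbackForm (IK.prod I) I' (Function.uncurry Φ) θ) :=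
    (pullbackForm_comp (hΦ.mdifferentiable (by simp)) hι' θ).symm
  have hmem : (k, (extChartAt I p).symm y) ∈ (extChartAt (IK.prod I) (k₀, p)).source := by
    rw [extChartAt_prod]
    exact ⟨hk, (extChartAt I p).map_target hy⟩
  rw [h1, formInChart_pullbackForm hy hmem (hι' _)]
  have h2 : (fun z => extChartAt (IK.prod I) (k₀, p) (k, (extChartAt I p).symm z)) =ᶠ[𝓝 y]
      fun z => (extChartAt IK k₀ k, z) := by
    filter_upwards [extChartAt_target_mem_nhds' hy] with z hz
    rw [extChartAt_prod]
    exact Prod.ext rfl ((extChartAt I p).right_inv hz)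
  have h3 : HasFDerivAt (fun z : E => (extChartAt IK k₀ k, z)) (ContinuousLinearMap.inr ℝ EK E) y :=
    hasFDerivAt_prodMk_right _ _
  have h4 := h2.self_of_nhds
  simp only at h4
  rw [h2.fderiv_eq, h3.fderiv, h4]

theorem contDiffOn_formInChart_slice (hΦ : ContMDiff (IK.prod I) I' ∞ (Function.uncurry Φ))
    (hθ : IsSmoothForm I' θ) (m : ℕ) (p : M) (k : K) :
    ContDiffOn ℝ ∞ (formInChart I m (pullbackForm I I' (Φ k) θ m) p) (extChartAt I p).target :=
  hθ.pullback (contMDiff_slice hΦ k) m p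

/-- The parameter lives on a manifold. Near `k₀` a chart of `K` makes it a coordinate, and the
family becomes the slices of one smooth function on a product of open sets, to which
`ContDiffOn.continuousOn_iteratedFDerivWithin_snd` applies. -/
theorem continuousOn_iteratedFDerivWithin_formInChart_slice
    (hΦ : ContMDiff (IK.prod I) I' ∞ (Function.uncurry Φ))
    (hθ : IsSmoothForm I' θ) (m : ℕ) (p : M) (j : ℕ) :
    ContinuousOn (fun q : K × E => iteratedFDerivWithin ℝ j
      (formInChart I m (pullbackForm I I' (Φ q.1) θ m) p) (extChartAt I p).target q.2)
      (univ ×ˢ (extChartAt I p).target) := by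
  rintro ⟨k₀, y₀⟩ ⟨-, hy₀⟩
  have hU := isOpen_extChartAt_target (I := I) p
  have hF : ContDiffOn ℝ ∞ (fun w : EK × E => (formInChart (IK.prod I) m
      (pullbackForm (IK.prod I) I' (Function.uncurry Φ) θ m) (k₀, p) w).compContinuousLinearMap
        (ContinuousLinearMap.inr ℝ EK E)) ((extChartAt IK k₀).target ×ˢ (extChartAt I p).target) := by
    have h1 := hθ.pullback hΦ m (k₀, p)
    rw [extChartAt_prod] at h1
    exact (ContinuousAlternatingMap.compContinuousLinearMapCLM
      (ContinuousLinearMap.inr ℝ EK E)).contDiff.comp_contDiffOn h1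
  have h1 := hF.continuousOn_iteratedFDerivWithin_snd (isOpen_extChartAt_target k₀) hU j
  have h2 : ContinuousOn (fun q : K × E => (extChartAt IK k₀ q.1, q.2))
      ((extChartAt IK k₀).source ×ˢ (extChartAt I p).target) :=
    ((continuousOn_extChartAt k₀).comp continuousOn_fst fun _ h => h.1).prodMk continuousOn_snd
  have h3 := h1.comp h2 fun q hq => ⟨(extChartAt IK k₀).map_source hq.1, hq.2⟩
  have hopen : IsOpen ((extChartAt IK k₀).source ×ˢ (extChartAt I p).target) :=
    (isOpen_extChartAt_source k₀).prod hU
  have hmem : (k₀, y₀) ∈ (extChartAt IK k₀).source ×ˢ (extChartAt I p).target :=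
    ⟨mem_extChartAt_source k₀, hy₀⟩
  refine ContinuousAt.continuousWithinAt ?_
  refine (h3.continuousAt (hopen.mem_nhds hmem)).congr ?_
  filter_upwards [hopen.mem_nhds hmem] with q hq
  refine iteratedFDerivWithin_congr (fun y hy => ?_) hq.2 j
  exact (formInChart_pullbackForm_slice hΦ θ m hq.1 hy).symm

variable [MeasurableSpace K]

variable (I I') in
/-- The integral of the pullbacks of a form along a family of maps. -/
noncomputable def integralForm (μ : Measure K) (Φ : K → M → M') (θ : GradedForm E' M') :
    GradedForm E M :=
  fun m p => ∫ k, pullbackForm I I' (Φ k) θ m p ∂μ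

theorem formInChart_self (m : ℕ) (θ : M → E [⋀^Fin m]→L[ℝ] ℝ) (p : M) :
    formInChart I m θ p (extChartAt I p p) = θ p := by
  have : IsManifold I 1 M := .of_le (n := ∞) (by simp)
  rw [formInChart, extChartAt_to_inv, chartSymmDeriv_self]
  rfl

variable [CompactSpace K] [OpensMeasurableSpace K] {μ : Measure K} [IsFiniteMeasure μ]

theorem integrable_pullbackForm (hΦ : ContMDiff (IK.prod I) I' ∞ (Function.uncurry Φ))
    (hθ : IsSmoothForm I' θ) (m : ℕ) (p : M) :
    Integrable (fun k => pullbackForm I I' (Φ k) θ m p) μ := by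
  have h1 := continuousOn_iteratedFDerivWithin_formInChart_slice hΦ hθ m p 0
  have h2 := (continuousMultilinearCurryFin0 ℝ E _).continuous.comp_continuousOn h1
  have h3 := h2.integrable_slice (μ := μ) (f := fun k y =>
    formInChart I m (pullbackForm I I' (Φ k) θ m) p y) (mem_extChartAt_target p)
  simpa only [formInChart_self] using h3

/-- Passing to a chart is, at each point, a continuous linear map on alternating forms and so
commutes with the integral. -/
theorem formInChart_integralForm (hΦ : ContMDiff (IK.prod I) I' ∞ (Function.uncurry Φ))
    (hθ : IsSmoothForm I' θ) (m : ℕ) (p : M) (y : E) :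
    formInChart I m (integralForm I I' μ Φ θ m) p y =
      ∫ k, formInChart I m (pullbackForm I I' (Φ k) θ m) p y ∂μ :=
  ((ContinuousAlternatingMap.compContinuousLinearMapCLM
    (chartSymmDeriv I p y)).integral_comp_comm (integrable_pullbackForm hΦ hθ m _)).symm

variable [FiniteDimensional ℝ E]

theorem IsSmoothForm.integralForm (hΦ : ContMDiff (IK.prod I) I' ∞ (Function.uncurry Φ))
    (hθ : IsSmoothForm I' θ) : IsSmoothForm I (integralForm I I' μ Φ θ) := by
  intro m p
  refine (contDiffOn_integral_of_compactSpace (μ := μ) (isOpen_extChartAt_target p)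
    (contDiffOn_formInChart_slice hΦ hθ m p)
    (continuousOn_iteratedFDerivWithin_formInChart_slice hΦ hθ m p)).congr fun y _ => ?_
  exact formInChart_integralForm hΦ hθ m p y

theorem integralForm_mem_Omega (hΦ : ContMDiff (IK.prod I) I' ∞ (Function.uncurry Φ)) {k : ℤ}
    (hθ : θ ∈ Omega I' M' k) : integralForm I I' μ Φ θ ∈ Omega I M k := by
  refine ⟨hθ.1.integralForm hΦ, fun m hm => ?_⟩
  funext p
  have h : ∀ x, pullbackForm I I' (Φ x) θ m p = 0 := fun x => by
    simp only [pullbackForm, hθ.2 m hm]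
    rfl
  simp [_root_.integralForm, h]

/-- In the chart at a point, `d` is a linear map applied to the derivative, which passes under the
integral; for each single parameter `d` commutes with the pullback. -/
theorem dForm_integralForm (hΦ : ContMDiff (IK.prod I) I' ∞ (Function.uncurry Φ))
    (hθ : IsSmoothForm I' θ) :
    dForm I (integralForm I I' μ Φ θ) = integralForm I I' μ Φ (dForm I' θ) := by
  have : IsManifold I 1 M := .of_le (n := ∞) (by simp)
  funext m
  cases m with
  | zero =>
    funext p
    have h : ∀ k, pullbackForm I I' (Φ k) (dForm I' θ) 0 p = 0 := fun _ => rfl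
    simp [integralForm, h]
    rfl
  | succ m =>
    funext p
    have hU := isOpen_extChartAt_target (I := I) p
    have hf := contDiffOn_formInChart_slice hΦ hθ m p
    have hc := continuousOn_iteratedFDerivWithin_formInChart_slice hΦ hθ m p
    have h2 : formInChart I m (integralForm I I' μ Φ θ m) p =
        fun y => ∫ k, formInChart I m (pullbackForm I I' (Φ k) θ m) p y ∂μ :=
      funext fun y => formInChart_integralForm hΦ hθ m p y
    rw [dForm_succ, extDeriv, h2]
    refine (clm_apply_fderiv_integral (ContinuousAlternatingMap.alternatizeUncurryFinCLM ℝ E ℝ)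
      hU hf hc (mem_extChartAt_target p)).trans ?_
    refine integral_congr_ae (ae_of_all _ fun k => ?_)
    have h4 := congrFun (congrFun (dForm_pullbackForm (contMDiff_slice hΦ k) hθ) (m + 1)) p
    rw [dForm_succ] at h4
    exact h4

end IntegralForm

/-! ### Lie brackets of related vector fields -/

section LieBracket

variable {E : Type*} [NormedAddCommGroup E] [NormedSpace ℝ E]
  {H : Type*} [TopologicalSpace H] {I : ModelWithCorners ℝ E H}
  {M : Type*} [TopologicalSpace M] [ChartedSpace H M]
  {E' : Type*} [NormedAddCommGroup E'] [NormedSpace ℝ E']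
  {H' : Type*} [TopologicalSpace H'] {I' : ModelWithCorners ℝ E' H'}
  {M' : Type*} [TopologicalSpace M'] [ChartedSpace H' M']
  {E'' : Type*} [NormedAddCommGroup E''] [NormedSpace ℝ E'']
  {H'' : Type*} [TopologicalSpace H''] {I'' : ModelWithCorners ℝ E'' H''}
  {M'' : Type*} [TopologicalSpace M''] [ChartedSpace H'' M'']

theorem tangentMapAt_prod_apply {f : M × M' → M''} {p : M × M'} (v : E × E')
    (hf : MDifferentiableAt (I.prod I') I'' f p) :
    tangentMapAt (I.prod I') I'' f p v =
      tangentMapAt I I'' (fun z => f (z, p.2)) p.1 v.1 +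
        tangentMapAt I' I'' (fun z => f (p.1, z)) p.2 v.2 :=
  mfderiv_prod_eq_add_apply hf

theorem tangentMapAt_prodMk {f : M → M'} {g : M → M''} {p : M}
    (hf : MDifferentiableAt I I' f p) (hg : MDifferentiableAt I I'' g p) (v : E) :
    tangentMapAt I (I'.prod I'') (fun x => (f x, g x)) p v =
      (tangentMapAt I I' f p v, tangentMapAt I I'' g p v) := by
  rw [tangentMapAt, hf.mfderiv_prod hg]
  rfl

theorem tangentMapAt_const (c : M') (p : M) : tangentMapAt I I' (fun _ : M => c) p = 0 :=
  mfderiv_const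

variable (I) in
/-- The expression of a vector field in the preferred chart at `p`. -/
noncomputable def fieldInChart (V : M → E) (p : M) (y : E) : E :=
  tangentMapAt I 𝓘(ℝ, E) (extChartAt I p) ((extChartAt I p).symm y) (V ((extChartAt I p).symm y))

theorem mpullbackWithin_eq_fieldInChart [IsManifold I 1 M] (V : M → E) {p : M} {y : E}
    (hy : y ∈ (extChartAt I p).target) :
    VectorField.mpullbackWithin 𝓘(ℝ, E) I (extChartAt I p).symm
      (fun q => (V q : TangentSpace I q)) (range I) y = fieldInChart I V p y := by
  have h := ContinuousLinearMap.inverse_eq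
    (mfderivWithin_extChartAt_symm_comp_mfderiv_extChartAt (I := I) hy)
    (mfderiv_extChartAt_comp_mfderivWithin_extChartAt_symm hy)
  exact DFunLike.congr_fun h (V ((extChartAt I p).symm y))

theorem fieldInChart_self [IsManifold I 1 M] (V : M → E) (p : M) :
    fieldInChart I V p (extChartAt I p p) = V p := by
  rw [fieldInChart, extChartAt_to_inv, tangentMapAt_extChartAt_self]
  rfl

variable [I.Boundaryless]

/-- The bracket on the manifold is the chart bracket pulled back to `T_p M`, and this last pullback
is trivial because the preferred chart has derivative the identity at `p`. -/
theorem bracketField_eq_lieBracket [IsManifold I 1 M] (V W : M → E) (p : M) :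
    bracketField I V W p =
      VectorField.lieBracket ℝ (fieldInChart I V p) (fieldInChart I W p) (extChartAt I p p) := by
  let P : (M → E) → E → E := fun X => VectorField.mpullbackWithin 𝓘(ℝ, E) I
    (extChartAt I p).symm (fun q => (X q : TangentSpace I q)) (range I)
  have hev : ∀ X : M → E, P X =ᶠ[𝓝 (extChartAt I p p)] fieldInChart I X p := fun X => by
    filter_upwards [extChartAt_target_mem_nhds (I := I) p] with y hy
    exact mpullbackWithin_eq_fieldInChart X hy
  have h := (hev V).lieBracket_vectorField_eq (𝕜 := ℝ) (hev W)
  let A : E →L[ℝ] E := tangentMapAt I 𝓘(ℝ, E) (extChartAt I p) p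
  let B : E := VectorField.lieBracketWithin ℝ (P V) (P W)
    ((extChartAt I p).symm ⁻¹' univ ∩ range I) (extChartAt I p p)
  have hb : bracketField I V W p = A.inverse B := VectorField.mlieBracketWithin_apply
  have h2 : A = ContinuousLinearMap.id ℝ E := tangentMapAt_extChartAt_self p
  rw [← h, hb, h2, ContinuousLinearMap.inverse_id]
  change VectorField.lieBracketWithin ℝ (P V) (P W)
    ((extChartAt I p).symm ⁻¹' univ ∩ range I) (extChartAt I p p) = _
  rw [preimage_univ, univ_inter, I.range_eq_univ, VectorField.lieBracketWithin_univ]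

theorem differentiableAt_fieldInChart [IsManifold I 2 M] [CompleteSpace E] {V : M → E} {p : M}
    (hV : MDifferentiableAt I I.tangent (fun q => (⟨q, V q⟩ : TangentBundle I M)) p) :
    DifferentiableAt ℝ (fieldInChart I V p) (extChartAt I p p) := by
  have : IsManifold I 1 M := .of_le (n := 2) (by norm_num)
  have h := (mdifferentiableWithinAt_univ.2 hV)
    |>.differentiableWithinAt_mpullbackWithin_vectorField
  rw [preimage_univ, univ_inter] at h
  have h' : DifferentiableWithinAt ℝ (VectorField.mpullbackWithin 𝓘(ℝ, E) I (extChartAt I p).symm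
      (fun q => (V q : TangentSpace I q)) (range I) : E → E) univ (extChartAt I p p) := by
    rw [I.range_eq_univ] at h ⊢
    exact h
  refine (differentiableWithinAt_univ.1 h').congr_of_eventuallyEq ?_
  filter_upwards [extChartAt_target_mem_nhds (I := I) p] with y hy
  exact (mpullbackWithin_eq_fieldInChart V hy).symm

theorem fderiv_fieldInChart_of_related [IsManifold I 1 M] [IsManifold I' 1 M']
    {f : M → M'} (hf : MDifferentiable I I' f) {V : M → E} {W : M' → E'}
    (hVW : ∀ q, tangentMapAt I I' f q (V q) = W (f q)) {p : M} {p' : M'} {y : E}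
    (hy : y ∈ (extChartAt I p).target)
    (hy' : f ((extChartAt I p).symm y) ∈ (extChartAt I' p').source) :
    fderiv ℝ (fun z => extChartAt I' p' (f ((extChartAt I p).symm z))) y (fieldInChart I V p y) =
      fieldInChart I' W p' (extChartAt I' p' (f ((extChartAt I p).symm y))) := by
  rw [fderiv_chart_comp hy hy' (hf _)]
  have h := chartSymmDeriv_comp_tangentMapAt (I := I) ((extChartAt I p).map_target hy)
  rw [(extChartAt I p).right_inv hy] at h
  have h' : ∀ w, chartSymmDeriv I p y
    (tangentMapAt I 𝓘(ℝ, E) (extChartAt I p) ((extChartAt I p).symm y) w) = w :=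
    fun w => DFunLike.congr_fun h w
  simp only [fieldInChart, ContinuousLinearMap.comp_apply, (extChartAt I' p').left_inv hy', h', hVW]

/-- The Lie bracket is natural with respect to related vector fields. -/
theorem bracketField_of_related [IsManifold I ∞ M] [IsManifold I' ∞ M'] [I'.Boundaryless]
    [CompleteSpace E] [CompleteSpace E']
    {f : M → M'} (hf : ContMDiff I I' ∞ f) {V₁ V₂ : M → E} {W₁ W₂ : M' → E'}
    (h₁ : ∀ q, tangentMapAt I I' f q (V₁ q) = W₁ (f q))
    (h₂ : ∀ q, tangentMapAt I I' f q (V₂ q) = W₂ (f q)) {p : M}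
    (hV₁ : MDifferentiableAt I I.tangent (fun q => (⟨q, V₁ q⟩ : TangentBundle I M)) p)
    (hV₂ : MDifferentiableAt I I.tangent (fun q => (⟨q, V₂ q⟩ : TangentBundle I M)) p)
    (hW₁ : MDifferentiableAt I' I'.tangent (fun q => (⟨q, W₁ q⟩ : TangentBundle I' M')) (f p))
    (hW₂ : MDifferentiableAt I' I'.tangent (fun q => (⟨q, W₂ q⟩ : TangentBundle I' M')) (f p)) :
    tangentMapAt I I' f p (bracketField I V₁ V₂ p) = bracketField I' W₁ W₂ (f p) := by
  have : IsManifold I 1 M := .of_le (n := ∞) (by simp)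
  have : IsManifold I' 1 M' := .of_le (n := ∞) (by simp)
  have hle : (2 : WithTop ℕ∞) ≤ ∞ := ENat.LEInfty.out
  have : IsManifold I 2 M := .of_le hle
  have : IsManifold I' 2 M' := .of_le hle
  have hmd : MDifferentiable I I' f := hf.mdifferentiable (by simp)
  have hp := mem_extChartAt_target (I := I) p
  have hx : (extChartAt I p).symm (extChartAt I p p) = p := extChartAt_to_inv p
  have hp' : f ((extChartAt I p).symm (extChartAt I p p)) ∈ (extChartAt I' (f p)).source := by
    rw [hx]; exact mem_extChartAt_source (f p)
  have hψ := contDiffAt_chart_comp hf hp hp'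
  have hev : ∀ {V : M → E} {W : M' → E'}, (∀ q, tangentMapAt I I' f q (V q) = W (f q)) →
      (fun y => fderiv ℝ (fun z => extChartAt I' (f p) (f ((extChartAt I p).symm z))) y
        (fieldInChart I V p y)) =ᶠ[𝓝 (extChartAt I p p)]
      (fieldInChart I' W (f p)) ∘ fun y => extChartAt I' (f p) (f ((extChartAt I p).symm y)) := by
    intro V W h
    filter_upwards [eventually_mem_target_source hp hp' hf.continuous] with y hy
    exact fderiv_fieldInChart_of_related hmd h hy.1 hy.2
  have hd1 := differentiableAt_fieldInChart hV₁
  have hd2 := differentiableAt_fieldInChart hV₂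
  have hψ' : DifferentiableAt ℝ (fun z => extChartAt I' (f p) (f ((extChartAt I p).symm z)))
    (extChartAt I p p) := hψ.differentiableAt (by simp)
  -- Pushing the bracket forward produces second derivatives of the chart expression, which cancel
  -- by symmetry. What remains are derivatives of the pushed-forward fields, which `hev` replaces by
  -- the related fields along the map.
  have key := VectorField.fderiv_apply_lieBracket hψ
    (by rw [minSmoothness_of_isRCLikeNormedField]; exact hle) hd2 hd1
  have hy0 : extChartAt I' (f p) (f ((extChartAt I p).symm (extChartAt I p p))) =
    extChartAt I' (f p) (f p) := by rw [hx]
  have e1 := differentiableAt_fieldInChart hW₁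
  have e2 := differentiableAt_fieldInChart hW₂
  rw [← hy0] at e1 e2
  rw [(hev h₂).fderiv_eq, (hev h₁).fderiv_eq, fderiv_comp
    (f := fun z => extChartAt I' (f p) (f ((extChartAt I p).symm z))) _ e2 hψ', fderiv_comp
    (f := fun z => extChartAt I' (f p) (f ((extChartAt I p).symm z))) _ e1 hψ'] at key
  have c1 := (hev h₁).self_of_nhds
  have c2 := (hev h₂).self_of_nhds
  simp only [Function.comp_apply] at c1 c2
  simp only [ContinuousLinearMap.comp_apply, c1, c2] at key
  rw [bracketField_eq_lieBracket, bracketField_eq_lieBracket, ← hy0]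
  refine Eq.trans ?_ key
  rw [fderiv_chart_comp hp hp' (hmd _), hx, chartSymmDeriv_self, tangentMapAt_extChartAt_self]
  rfl

end LieBracket

/-! ### Fundamental vector fields -/

section FundamentalField

variable {EG : Type*} [NormedAddCommGroup EG] [NormedSpace ℝ EG]
  {HG : Type*} [TopologicalSpace HG] {I : ModelWithCorners ℝ EG HG}
  {G : Type*} [TopologicalSpace G] [ChartedSpace HG G] [Group G]
  {EM : Type*} [NormedAddCommGroup EM] [NormedSpace ℝ EM]
  {HM : Type*} [TopologicalSpace HM] {J : ModelWithCorners ℝ EM HM}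
  {M : Type*} [TopologicalSpace M] [ChartedSpace HM M]

theorem mdifferentiable_of_mem_smoothVectorField [IsManifold J ∞ M] {V : M → EM}
    (hV : V ∈ SmoothVectorField J M) :
    MDifferentiable J J.tangent (fun q => (⟨q, V q⟩ : TangentBundle J M)) := by
  have h : ContMDiff J J.tangent ∞ (fun q => (⟨q, V q⟩ : TangentBundle J M)) := hV
  exact h.mdifferentiable (by simp)

theorem fundamentalField_add [MulAction G M] (x y : GroupLieAlgebra I G) :
    fundamentalField I J (M := M) (x + y) = fundamentalField I J x + fundamentalField I J y := by
  funext p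
  have h : tangentMapAt I J (fun g : G => g • p) 1 (x + y) =
    tangentMapAt I J (fun g : G => g • p) 1 x + tangentMapAt I J (fun g : G => g • p) 1 y :=
    map_add (tangentMapAt I J (fun g : G => g • p) 1) _ _
  rw [Pi.add_apply, fundamentalField, fundamentalField, fundamentalField, h, neg_add]

theorem fundamentalField_smul [MulAction G M] (c : ℝ) (x : GroupLieAlgebra I G) :
    fundamentalField I J (M := M) (c • x) = c • fundamentalField I J x := by
  funext p
  have h : tangentMapAt I J (fun g : G => g • p) 1 (c • x) =
    c • tangentMapAt I J (fun g : G => g • p) 1 x :=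
    map_smul (tangentMapAt I J (fun g : G => g • p) 1) _ _
  rw [Pi.smul_apply, fundamentalField, fundamentalField, h, smul_neg]

variable [LieGroup I ∞ G] [IsManifold J ∞ M] [MulAction G M] [ContMDiffSMul I J ∞ G M]

theorem mdifferentiable_smul_prod : MDifferentiable (I.prod J) J fun q : G × M => q.1 • q.2 :=
  (contMDiff_smul (I := I) (n := ∞)).mdifferentiable (by simp)

theorem contMDiff_inv_smul_left (q : M) : ContMDiff I J ∞ fun g : G => g⁻¹ • q :=
  (contMDiff_inv I ∞).smul (contMDiff_const (c := q))

/-- At the unit, the action is the identity in the direction of `M`, and in the direction of `G` it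
is the orbit map, whose derivative is -v_x by the sign convention. All signs (-1)^k in front of
ι(v_{x_1} ∧ ⋯ ∧ v_{x_k})ω come from here. -/
theorem tangentMapAt_smul_one (p : M) (x : GroupLieAlgebra I G) (u : EM) :
    tangentMapAt (I.prod J) J (fun q : G × M => q.1 • q.2) (1, p) ((x : EG), u) =
      u - fundamentalField I J x p := by
  rw [tangentMapAt_prod_apply _ (mdifferentiable_smul_prod (I := I) (J := J) _)]
  simp only [one_smul]
  rw [show (fun z : M => z) = id from rfl, tangentMapAt_id, fundamentalField, sub_neg_eq_add,
    add_comm]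
  rfl

/-- Up to sign, the field is the tangent map of the action applied to the smooth family of vectors
(x, 0) along {e} × M. -/
theorem fundamentalField_mem (x : GroupLieAlgebra I G) :
    fundamentalField I J x ∈ SmoothVectorField J M := by
  rw [← neg_neg (fundamentalField I J x)]
  refine Submodule.neg_mem _ ?_
  have h₁ : ContMDiff J (I.tangent.prod J.tangent) ∞ fun p : M =>
      ((⟨(1 : G), x⟩ : TangentBundle I G), (⟨p, (0 : EM)⟩ : TangentBundle J M)) :=
    contMDiff_const.prodMk (Bundle.contMDiff_zeroSection ℝ (TangentSpace J : M → Type _))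
  have h₂ : ContMDiff (I.tangent.prod J.tangent) (I.prod J).tangent ∞
      (equivTangentBundleProd I G J M).symm := contMDiff_equivTangentBundleProd_symm
  have h₃ : ContMDiff (I.prod J).tangent J.tangent ∞
      (tangentMap (I.prod J) J fun q : G × M => q.1 • q.2) :=
    (contMDiff_smul (I := I) (n := ∞)).contMDiff_tangentMap (m := ∞) (by simp)
  have h := (h₃.comp h₂).comp h₁
  -- The composite has base point `1 • p`, which equals `p` only propositionally.
  have key : ∀ (p q : M) (v : EM), q = p →
      (⟨q, v⟩ : TangentBundle J M) = (⟨p, v⟩ : TangentBundle J M) := by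
    rintro p q v rfl; rfl
  refine h.congr fun p => ?_
  refine Eq.trans ?_ (key p ((1 : G) • p)
    (tangentMapAt (I.prod J) J (fun q : G × M => q.1 • q.2) (1, p) (x, 0)) (one_smul G p)).symm
  rw [tangentMapAt_smul_one, zero_sub]
  rfl

/-- Differentiate the constant map g ↦ g · (g⁻¹ · q) = q at the unit. -/
theorem tangentMapAt_inv_smul_one (q : M) (x : GroupLieAlgebra I G) :
    tangentMapAt I J (fun g : G => g⁻¹ • q) 1 x = fundamentalField I J x q := by
  have hd := (contMDiff_inv_smul_left (I := I) (J := J) (G := G) q).mdifferentiable (by simp) 1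
  have hc := tangentMapAt_comp (I := I) (I' := I.prod J) (I'' := J)
    (f := fun g : G => (g, g⁻¹ • q)) (g := fun r : G × M => r.1 • r.2) (p := 1)
    (mdifferentiable_smul_prod (I := I) (J := J) _) (mdifferentiableAt_id.prodMk hd)
  have h0 : (fun r : G × M => r.1 • r.2) ∘ (fun g : G => (g, g⁻¹ • q)) = fun _ => q := by
    funext g; simp
  rw [h0, tangentMapAt_const] at hc
  have h1 : (0 : EM) = tangentMapAt (I.prod J) J (fun r : G × M => r.1 • r.2) (1, (1 : G)⁻¹ • q)
    (tangentMapAt I (I.prod J) (fun g : G => (g, g⁻¹ • q)) 1 x) := DFunLike.congr_fun hc x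
  have h2 : tangentMapAt I (I.prod J) (fun g : G => (g, g⁻¹ • q)) 1 x =
      ((x : EG), tangentMapAt I J (fun g : G => g⁻¹ • q) 1 x) := by
    refine (tangentMapAt_prodMk (f := fun g : G => g) mdifferentiableAt_id hd _).trans ?_
    rw [show (fun g : G => g) = id from rfl, tangentMapAt_id]
    rfl
  rw [h2, inv_one, one_smul] at h1
  exact sub_eq_zero.1 ((tangentMapAt_smul_one q x _).symm.trans h1.symm)

/-- Since (gh)⁻¹ · p = h⁻¹ · (g⁻¹ · p), the derivative at `g` along a left invariant field is the
derivative at the unit for the point g⁻¹ · p. -/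
theorem tangentMapAt_inv_smul_mulInvariantVectorField (p : M) (x : GroupLieAlgebra I G) (g : G) :
    tangentMapAt I J (fun g : G => g⁻¹ • p) g (mulInvariantVectorField x g) =
      fundamentalField I J x (g⁻¹ • p) := by
  have hmul : ContMDiff I I ∞ fun h : G => g * h := contMDiff_mul_left
  have hc := tangentMapAt_comp (I := I) (I' := I) (I'' := J) (f := fun h : G => g * h)
    (g := fun g : G => g⁻¹ • p) (p := 1) ((contMDiff_inv_smul_left p).mdifferentiable (by simp) _)
    (hmul.mdifferentiable (by simp) _)
  have h0 : (fun g : G => g⁻¹ • p) ∘ (fun h : G => g * h) = fun h => h⁻¹ • (g⁻¹ • p) := by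
    funext h; simp [mul_smul]
  rw [h0] at hc
  rw [mul_one] at hc
  exact (DFunLike.congr_fun hc x).symm.trans (tangentMapAt_inv_smul_one _ x)

/-- The map g ↦ g⁻¹ · p relates left invariant fields to fundamental fields, and related fields have
related brackets. Using the inverse, which matches the sign in exp(-tx), gives a homomorphism rather
than an antihomomorphism. -/
theorem bracketField_fundamentalField [FiniteDimensional ℝ EG] [FiniteDimensional ℝ EM]
    [J.Boundaryless] [I.Boundaryless] (x y : GroupLieAlgebra I G) :
    bracketField J (fundamentalField I J (M := M) x) (fundamentalField I J y) =
      fundamentalField I J ⁅x, y⁆ := by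
  funext p
  have : CompleteSpace EG := FiniteDimensional.complete ℝ EG
  have : CompleteSpace EM := FiniteDimensional.complete ℝ EM
  have h := bracketField_of_related (contMDiff_inv_smul_left (I := I) (J := J) (G := G) p)
    (fun g => tangentMapAt_inv_smul_mulInvariantVectorField p x g)
    (fun g => tangentMapAt_inv_smul_mulInvariantVectorField p y g)
    (p := 1) (mdifferentiableAt_mulInvariantVectorField x)
    (mdifferentiableAt_mulInvariantVectorField y) 
    (mdifferentiable_of_mem_smoothVectorField (fundamentalField_mem x) _)
    (mdifferentiable_of_mem_smoothVectorField (fundamentalField_mem y) _)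
  rw [inv_one, one_smul] at h
  rw [← h]
  exact tangentMapAt_inv_smul_one p _

end FundamentalField

/-! ### The exterior derivative on a product of vector spaces -/

section ExteriorDerivativeProd

variable {F₁ F₂ : Type*} [NormedAddCommGroup F₁] [NormedSpace ℝ F₁]
  [NormedAddCommGroup F₂] [NormedSpace ℝ F₂]

theorem Fin.append_update_left {α : Type*} {k l : ℕ} (X : Fin k → α) (u : Fin l → α) (i : Fin k)
    (a : α) : Fin.append (Function.update X i a) u =
      Function.update (Fin.append X u) (Fin.castAdd l i) a := by
  ext j
  refine Fin.addCases (fun j => ?_) (fun j => ?_) j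
  · rw [Fin.append_left]
    rcases eq_or_ne j i with rfl | h
    · simp
    · rw [Function.update_of_ne h, Function.update_of_ne (by simpa using h), Fin.append_left]
  · rw [Fin.append_right, Function.update_of_ne, Fin.append_right]
    intro h
    have := congrArg Fin.val h
    simp at this
    omega

theorem Fin.append_update_right {α : Type*} {k l : ℕ} (X : Fin k → α) (u : Fin l → α) (i : Fin l)
    (a : α) : Fin.append X (Function.update u i a) =
      Function.update (Fin.append X u) (Fin.natAdd k i) a := by
  ext j
  refine Fin.addCases (fun j => ?_) (fun j => ?_) j
  · rw [Fin.append_left, Function.update_of_ne, Fin.append_left]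
    intro h
    have := congrArg Fin.val h
    simp at this
    omega
  · rw [Fin.append_right]
    rcases eq_or_ne j i with rfl | h
    · simp
    · rw [Function.update_of_ne h, Function.update_of_ne (by simpa using h), Fin.append_right]

/-- The tuple `(X_1, 0), …, (X_k, 0), (0, u_1), …, (0, u_l)` in a product. -/
def appendProd {k l : ℕ} (X : Fin k → F₁) (u : Fin l → F₂) : Fin (k + l) → F₁ × F₂ :=
  Fin.append (fun i => (X i, 0)) (fun j => (0, u j))

@[simp] theorem appendProd_castAdd {k l : ℕ} (X : Fin k → F₁) (u : Fin l → F₂) (i : Fin k) :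
    appendProd X u (Fin.castAdd l i) = (X i, 0) := Fin.append_left _ _ _

@[simp] theorem appendProd_natAdd {k l : ℕ} (X : Fin k → F₁) (u : Fin l → F₂) (j : Fin l) :
    appendProd X u (Fin.natAdd k j) = (0, u j) := Fin.append_right _ _ _

theorem appendProd_update_left {k l : ℕ} [DecidableEq (Fin k)] (X : Fin k → F₁) (u : Fin l → F₂)
    (i : Fin k) (a : F₁) : appendProd (Function.update X i a) u =
      Function.update (appendProd X u) (Fin.castAdd l i) (a, 0) := by
  rw [appendProd, appendProd, ← Fin.append_update_left]
  congr 1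
  ext1 j
  rcases eq_or_ne j i with rfl | h
  · simp
  · simp [h]

theorem appendProd_update_right {k l : ℕ} [DecidableEq (Fin l)] (X : Fin k → F₁) (u : Fin l → F₂)
    (i : Fin l) (a : F₂) : appendProd X (Function.update u i a) =
      Function.update (appendProd X u) (Fin.natAdd k i) (0, a) := by
  rw [appendProd, appendProd, ← Fin.append_update_right]
  congr 1
  ext1 j
  rcases eq_or_ne j i with rfl | h
  · simp
  · simp [h]

/-- The form on the first factor obtained by inserting `u` in the last slots. -/
noncomputable def fixTail {k l : ℕ} (u : Fin l → F₂) :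
    (F₁ × F₂) [⋀^Fin (k + l)]→L[ℝ] ℝ →L[ℝ] F₁ [⋀^Fin k]→L[ℝ] ℝ :=
  AlternatingMap.mkContinuousLinear
    { toFun := fun θ =>
        { toFun := fun X => θ (appendProd X u)
          map_update_add' := fun X i a b => by
            rw [appendProd_update_left, appendProd_update_left, appendProd_update_left,
              ← θ.map_update_add, Prod.mk_add_mk, add_zero]
          map_update_smul' := fun X i c a => by
            rw [appendProd_update_left, appendProd_update_left, ← θ.map_update_smul, Prod.smul_mk,
              smul_zero]
          map_eq_zero_of_eq' := fun X i j h hij => θ.map_eq_zero_of_eq _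
            (i := Fin.castAdd l i) (j := Fin.castAdd l j) (by simp [h]) (by simpa using hij) }
      map_add' := fun _ _ => rfl
      map_smul' := fun _ _ => rfl }
    (∏ j, ‖u j‖) fun θ X => by
      refine (θ.le_opNorm (appendProd X u)).trans_eq ?_
      rw [Fin.prod_univ_add]
      simp only [appendProd_castAdd, appendProd_natAdd, Prod.norm_mk, norm_zero, norm_nonneg,
        sup_of_le_left, sup_of_le_right]
      ring

/-- The form on the second factor obtained by inserting `X` in the first slots. -/
noncomputable def fixHead {k l : ℕ} (X : Fin k → F₁) :
    (F₁ × F₂) [⋀^Fin (k + l)]→L[ℝ] ℝ →L[ℝ] F₂ [⋀^Fin l]→L[ℝ] ℝ :=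
  AlternatingMap.mkContinuousLinear
    { toFun := fun θ =>
        { toFun := fun u => θ (appendProd X u)
          map_update_add' := fun u i a b => by
            rw [appendProd_update_right, appendProd_update_right, appendProd_update_right,
              ← θ.map_update_add, Prod.mk_add_mk, add_zero]
          map_update_smul' := fun u i c a => by
            rw [appendProd_update_right, appendProd_update_right, ← θ.map_update_smul,
              Prod.smul_mk, smul_zero]
          map_eq_zero_of_eq' := fun u i j h hij => θ.map_eq_zero_of_eq _
            (i := Fin.natAdd k i) (j := Fin.natAdd k j) (by simp [h]) (by simpa using hij) }
      map_add' := fun _ _ => rfl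
      map_smul' := fun _ _ => rfl }
    (∏ j, ‖X j‖) fun θ u => by
      refine (θ.le_opNorm (appendProd X u)).trans_eq ?_
      rw [Fin.prod_univ_add]
      simp only [appendProd_castAdd, appendProd_natAdd, Prod.norm_mk, norm_zero, norm_nonneg,
        sup_of_le_left, sup_of_le_right]
      ring

@[simp] theorem fixTail_apply {k l : ℕ} (u : Fin l → F₂) (θ : (F₁ × F₂) [⋀^Fin (k + l)]→L[ℝ] ℝ)
    (X : Fin k → F₁) : fixTail u θ X = θ (appendProd X u) := rfl

@[simp] theorem fixHead_apply {k l : ℕ} (X : Fin k → F₁) (θ : (F₁ × F₂) [⋀^Fin (k + l)]→L[ℝ] ℝ)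
    (u : Fin l → F₂) : fixHead X θ u = θ (appendProd X u) := rfl

/-- The degrees k + l + 1, k + 1 + l and their like are equal only propositionally; this moves a
form between them. -/
theorem gradedForm_cast {F N : Type*} [NormedAddCommGroup F] [NormedSpace ℝ F]
    (θ : GradedForm F N) {m m' : ℕ} (h : m' = m) (p : N) (v : Fin m → F) :
    θ m p v = θ m' p (v ∘ Fin.cast h) := by
  subst h; rfl

theorem removeNth_castAdd_appendProd {k l : ℕ} (X : Fin (k + 1) → F₁) (u : Fin l → F₂)
    (i : Fin (k + 1)) (h : k + l + 1 = k + 1 + l) :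
    (Fin.cast h.symm (Fin.castAdd l i)).removeNth (appendProd X u ∘ Fin.cast h) =
      appendProd (i.removeNth X) u := by
  ext1 j
  refine Fin.addCases (fun j => ?_) (fun j => ?_) j
  · rw [appendProd_castAdd, Fin.removeNth_apply, Fin.removeNth_apply, Function.comp_apply,
      show Fin.cast h ((Fin.cast h.symm (Fin.castAdd l i)).succAbove (Fin.castAdd l j)) =
        Fin.castAdd l (i.succAbove j) from ?_, appendProd_castAdd]
    ext
    simp only [Fin.succAbove, Fin.lt_def, Fin.val_cast, Fin.val_castSucc, Fin.val_castAdd]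
    split_ifs <;> simp
  · rw [appendProd_natAdd, Fin.removeNth_apply, Function.comp_apply,
      show Fin.cast h ((Fin.cast h.symm (Fin.castAdd l i)).succAbove (Fin.natAdd k j)) =
        Fin.natAdd (k + 1) j from ?_, appendProd_natAdd]
    ext
    simp only [Fin.succAbove, Fin.lt_def, Fin.val_cast, Fin.val_castSucc, Fin.val_castAdd,
      Fin.val_natAdd]
    rw [if_neg (by omega)]
    simp only [Fin.val_succ, Fin.val_natAdd]
    omega

theorem removeNth_natAdd_appendProd {k l : ℕ} (X : Fin (k + 1) → F₁) (u : Fin (l + 1) → F₂)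
    (j : Fin (l + 1)) (h : k + (l + 1) + 1 = k + 1 + (l + 1)) (h' : k + (l + 1) = k + 1 + l) :
    (Fin.cast h.symm (Fin.natAdd (k + 1) j)).removeNth (appendProd X u ∘ Fin.cast h) =
      appendProd X (j.removeNth u) ∘ Fin.cast h' := by
  ext1 i
  obtain ⟨i, rfl⟩ : ∃ i', i = Fin.cast h'.symm i' := ⟨Fin.cast h' i, by simp⟩
  rw [Function.comp_apply, Fin.cast_cast, Fin.cast_eq_self]
  refine Fin.addCases (fun i => ?_) (fun i => ?_) i
  · rw [appendProd_castAdd, Fin.removeNth_apply, Function.comp_apply,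
      show Fin.cast h ((Fin.cast h.symm (Fin.natAdd (k + 1) j)).succAbove
        (Fin.cast h'.symm (Fin.castAdd l i))) = Fin.castAdd (l + 1) i from ?_, appendProd_castAdd]
    ext
    simp only [Fin.succAbove, Fin.lt_def, Fin.val_cast, Fin.val_castSucc, Fin.val_castAdd,
      Fin.val_natAdd]
    rw [if_pos (by omega)]
    simp
  · rw [appendProd_natAdd, Fin.removeNth_apply, Fin.removeNth_apply, Function.comp_apply,
      show Fin.cast h ((Fin.cast h.symm (Fin.natAdd (k + 1) j)).succAbove
        (Fin.cast h'.symm (Fin.natAdd (k + 1) i))) = Fin.natAdd (k + 1) (j.succAbove i) from ?_,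
      appendProd_natAdd]
    ext
    simp only [Fin.succAbove, Fin.lt_def, Fin.val_cast, Fin.val_castSucc, Fin.val_natAdd,
      Nat.add_lt_add_iff_left]
    split_ifs
    · simp
    · simp only [Fin.val_succ, Fin.val_natAdd, Fin.val_cast]
      omega

theorem fderiv_comp_prodMk_left {F : Type*} [NormedAddCommGroup F] [NormedSpace ℝ F]
    {f : F₁ × F₂ → F} {z : F₁} {w : F₂} (hf : DifferentiableAt ℝ f (z, w)) (a : F₁) :
    fderiv ℝ (fun z' => f (z', w)) z a = fderiv ℝ f (z, w) (a, 0) := by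
  have h := HasFDerivAt.comp (g := f) (f := fun z' => (z', w)) z hf.hasFDerivAt
    (hasFDerivAt_prodMk_left (𝕜 := ℝ) z w)
  rw [show (fun z' => f (z', w)) = f ∘ fun z' => (z', w) from rfl, h.fderiv]
  rfl

theorem fderiv_comp_prodMk_right {F : Type*} [NormedAddCommGroup F] [NormedSpace ℝ F]
    {f : F₁ × F₂ → F} {z : F₁} {w : F₂} (hf : DifferentiableAt ℝ f (z, w)) (a : F₂) :
    fderiv ℝ (fun w' => f (z, w')) w a = fderiv ℝ f (z, w) (0, a) := by
  have h := HasFDerivAt.comp (g := f) (f := fun w' => (z, w')) w hf.hasFDerivAt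
    (hasFDerivAt_prodMk_right (𝕜 := ℝ) z w)
  rw [show (fun w' => f (z, w')) = f ∘ fun w' => (z, w') from rfl, h.fderiv]
  rfl

theorem differentiableAt_apply_const {F : Type*} [NormedAddCommGroup F] [NormedSpace ℝ F]
    {V : Type*} [NormedAddCommGroup V] [NormedSpace ℝ V] {m : ℕ} {θ : V → F [⋀^Fin m]→L[ℝ] ℝ}
    {y : V} (hθ : DifferentiableAt ℝ θ y) (v : Fin m → F) :
    DifferentiableAt ℝ (fun y => θ y v) y := by fun_prop

theorem differentiableAt_fixTail {k l : ℕ} {θ : F₁ × F₂ → (F₁ × F₂) [⋀^Fin (k + l)]→L[ℝ] ℝ}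
    {z : F₁} {w : F₂} (hθ : DifferentiableAt ℝ θ (z, w)) (u : Fin l → F₂) :
    DifferentiableAt ℝ (fun z' => fixTail u (θ (z', w))) z :=
  ((fixTail u).differentiable (θ (z, w))).comp z
    (DifferentiableAt.comp (g := θ) (f := fun z' => (z', w)) z hθ (differentiableAt_id.prodMk (differentiableAt_const w)))

theorem differentiableAt_fixHead {k l : ℕ} {θ : F₁ × F₂ → (F₁ × F₂) [⋀^Fin (k + l)]→L[ℝ] ℝ}
    {z : F₁} {w : F₂} (hθ : DifferentiableAt ℝ θ (z, w)) (X : Fin k → F₁) :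
    DifferentiableAt ℝ (fun w' => fixHead X (θ (z, w'))) w :=
  ((fixHead X).differentiable (θ (z, w))).comp w
    (DifferentiableAt.comp (g := θ) (f := fun w' => (z, w')) w hθ ((differentiableAt_const z).prodMk differentiableAt_id))

theorem extDeriv_appendProd_zero {k : ℕ} {θ : GradedForm (F₁ × F₂) (F₁ × F₂)}
    {z : F₁} {w : F₂} (hθ : ∀ m, DifferentiableAt ℝ (θ m) (z, w))
    (X : Fin (k + 1) → F₁) (u : Fin 0 → F₂) (h : k + 0 + 1 = k + 1 + 0) :
    extDeriv (θ (k + 0)) (z, w) (appendProd X u ∘ Fin.cast h) =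
      extDeriv (fun z' => fixTail u (θ (k + 0) (z', w))) z X := by
  rw [extDeriv_apply (hθ _), extDeriv_apply (differentiableAt_fixTail (hθ (k + 0)) u),
    ← (finCongr h.symm).sum_comp]
  simp only [finCongr_apply]
  refine Finset.sum_congr rfl fun i _ => ?_
  have hi := removeNth_castAdd_appendProd X u i h
  rw [Fin.castAdd_zero, Fin.cast_eq_self] at hi
  rw [hi]
  congr 1
  rw [show (fun x => fixTail u (θ (k + 0) (x, w)) (i.removeNth X)) = fun x =>
    (fun y => θ (k + 0) y (appendProd (i.removeNth X) u)) (x, w) from rfl,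
    fderiv_comp_prodMk_left (differentiableAt_apply_const (hθ _) _)]
  exact congrArg _ (appendProd_castAdd X u i)

/-- The alternating sum for the exterior derivative splits at position k + 1: the first terms
differentiate along the first factor with `u` fixed, and the others along the second factor with `X`
fixed. The sign (-1)^(k+1) comes from the shift of their index by k + 1. -/
theorem extDeriv_appendProd {k l : ℕ} {θ : GradedForm (F₁ × F₂) (F₁ × F₂)}
    {z : F₁} {w : F₂} (hθ : ∀ m, DifferentiableAt ℝ (θ m) (z, w))
    (X : Fin (k + 1) → F₁) (u : Fin (l + 1) → F₂) (h : k + (l + 1) + 1 = k + 1 + (l + 1)) :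
    extDeriv (θ (k + (l + 1))) (z, w) (appendProd X u ∘ Fin.cast h) =
      extDeriv (fun z' => fixTail u (θ (k + (l + 1)) (z', w))) z X +
      (-1) ^ (k + 1) * extDeriv (fun w' => fixHead X (θ (k + 1 + l) (z, w'))) w u := by
  rw [extDeriv_apply (hθ _), extDeriv_apply (differentiableAt_fixTail (hθ _) u),
    extDeriv_apply (differentiableAt_fixHead (hθ _) X),
    ← (finCongr h.symm).sum_comp, Fin.sum_univ_add, Finset.mul_sum]
  simp only [finCongr_apply]
  congr 1
  · refine Finset.sum_congr rfl fun i _ => ?_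
    rw [removeNth_castAdd_appendProd]
    congr 1
    rw [show (fun x => fixTail u (θ (k + (l + 1)) (x, w)) (i.removeNth X)) = fun x =>
      (fun y => θ (k + (l + 1)) y (appendProd (i.removeNth X) u)) (x, w) from rfl,
      fderiv_comp_prodMk_left (differentiableAt_apply_const (hθ _) _)]
    exact congrArg _ (appendProd_castAdd X u i)
  · refine Finset.sum_congr rfl fun j _ => ?_
    rw [removeNth_natAdd_appendProd X u j h (by omega), Fin.val_cast, Fin.val_natAdd, pow_add]
    simp only [← gradedForm_cast θ (show k + (l + 1) = k + 1 + l by omega)]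
    rw [show (fun x => fixHead X (θ (k + 1 + l) (z, x)) (j.removeNth u)) = fun x =>
      (fun y => θ (k + 1 + l) y (appendProd X (j.removeNth u))) (z, x) from rfl,
      fderiv_comp_prodMk_right (differentiableAt_apply_const (hθ _) _), Function.comp_apply,
      Fin.cast_cast, Fin.cast_eq_self, appendProd_natAdd]
    simp only [zsmul_eq_mul, Int.cast_pow, Int.cast_mul, Int.cast_neg, Int.cast_one,
      mul_assoc]

/-- Palais' formula for a form which is constant on a family of vector fields. -/
theorem extDeriv_apply_of_const {F : Type*} [NormedAddCommGroup F] [NormedSpace ℝ F] {k : ℕ}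
    {η : F → F [⋀^Fin (k + 1)]→L[ℝ] ℝ} {z : F} {V : Fin (k + 2) → F → F}
    (hη : DifferentiableAt ℝ η z) (hV : ∀ i, DifferentiableAt ℝ (V i) z)
    (hc : ∀ i : Fin (k + 2), ∃ c, (fun y => η y (i.removeNth (V · y))) =ᶠ[𝓝 z] fun _ => c) :
    extDeriv η z (V · z) = - ∑ i : Fin (k + 1), ∑ j ∈ Finset.Ici i, (-1 : ℝ) ^ (i + j : ℕ) *
      η z (Matrix.vecCons (VectorField.lieBracket ℝ (V i.castSucc) (V j.succ) z)
        (j.removeNth <| i.castSucc.removeNth (V · z))) := by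
  -- The first sum differentiates functions that are constant near `z`, so only the bracket terms
  -- survive.
  rw [extDeriv_apply_vectorField hη hV]
  rw [Finset.sum_eq_zero, zero_sub]
  · congr 1
    refine Finset.sum_congr rfl fun i _ => Finset.sum_congr ?_ fun j _ => ?_
    · ext; simp
    · simp
  · intro i _
    obtain ⟨c, hc⟩ := hc i
    rw [hc.fderiv_eq]
    simp

end ExteriorDerivativeProd

/-! ### Charts of a product manifold -/

section ProductCharts

variable {E : Type*} [NormedAddCommGroup E] [NormedSpace ℝ E]
  {H : Type*} [TopologicalSpace H] {I : ModelWithCorners ℝ E H}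
  {M : Type*} [TopologicalSpace M] [ChartedSpace H M]
  {E' : Type*} [NormedAddCommGroup E'] [NormedSpace ℝ E']
  {H' : Type*} [TopologicalSpace H'] {I' : ModelWithCorners ℝ E' H'}
  {M' : Type*} [TopologicalSpace M'] [ChartedSpace H' M']

theorem tangentMapAt_prodMk_left (p : M) (q : M') (v : E) :
    tangentMapAt I (I.prod I') (fun x : M => (x, q)) p v = (v, 0) := by
  refine (tangentMapAt_prodMk (f := fun x : M => x) (g := fun _ => q) mdifferentiableAt_id
    mdifferentiableAt_const v).trans ?_
  rw [show (fun x : M => x) = id from rfl, tangentMapAt_id, tangentMapAt_const]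
  rfl

theorem tangentMapAt_prodMk_right (p : M) (q : M') (v : E') :
    tangentMapAt I' (I.prod I') (fun x : M' => (p, x)) q v = (0, v) := by
  refine (tangentMapAt_prodMk (f := fun _ => p) (g := fun x : M' => x) mdifferentiableAt_const
    mdifferentiableAt_id v).trans ?_
  rw [show (fun x : M' => x) = id from rfl, tangentMapAt_id, tangentMapAt_const]
  rfl

theorem extChartAt_prod_target {a : M} {b : M'} {z : E} {w : E'}
    (hz : z ∈ (extChartAt I a).target) (hw : w ∈ (extChartAt I' b).target) :
    (z, w) ∈ (extChartAt (I.prod I') (a, b)).target := by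
  rw [extChartAt_prod]
  exact ⟨hz, hw⟩

variable [I.Boundaryless] [I'.Boundaryless] [IsManifold I 1 M] [IsManifold I' 1 M']

/-- In the product chart the slice x ↦ (x, q) is y ↦ (y, w). Differentiating this and cancelling the
derivative of the chart gives the value. -/
theorem chartSymmDeriv_prod_left {a : M} {b : M'} {z : E} {w : E'}
    (hz : z ∈ (extChartAt I a).target) (hw : w ∈ (extChartAt I' b).target) (v : E) :
    chartSymmDeriv (I.prod I') (a, b) (z, w) (v, 0) = (chartSymmDeriv I a z v, 0) := by
  have hs : ((extChartAt I a).symm z, (extChartAt I' b).symm w) ∈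
      (extChartAt (I.prod I') (a, b)).source := by
    rw [extChartAt_prod]
    exact ⟨(extChartAt I a).map_target hz, (extChartAt I' b).map_target hw⟩
  have hf : MDifferentiable I (I.prod I') fun x : M => (x, (extChartAt I' b).symm w) := fun x =>
    mdifferentiableAt_id.prodMk mdifferentiableAt_const
  have h := fderiv_chart_comp (p' := (a, b)) hz hs (hf _)
  have he : (fun y => extChartAt (I.prod I') (a, b)
      ((extChartAt I a).symm y, (extChartAt I' b).symm w)) =ᶠ[𝓝 z] fun y => (y, w) := by
    filter_upwards [extChartAt_target_mem_nhds' hz] with y hy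
    rw [extChartAt_prod]
    exact Prod.ext ((extChartAt I a).right_inv hy) ((extChartAt I' b).right_inv hw)
  have he0 := he.self_of_nhds
  have h2 := chartSymmDeriv_comp_tangentMapAt (I := I.prod I') hs
  dsimp only at he0
  rw [he0] at h2
  have h3 : tangentMapAt (I.prod I') 𝓘(ℝ, E × E') (extChartAt (I.prod I') (a, b))
      ((extChartAt I a).symm z, (extChartAt I' b).symm w) (chartSymmDeriv I a z v, 0) = (v, 0) := by
    rw [← tangentMapAt_prodMk_left (I := I) (I' := I') ((extChartAt I a).symm z)
      ((extChartAt I' b).symm w)]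
    refine (DFunLike.congr_fun h v).symm.trans ?_
    rw [he.fderiv_eq, (hasFDerivAt_prodMk_left (𝕜 := ℝ) z w).fderiv]
    rfl
  rw [← h3]
  exact DFunLike.congr_fun h2 _

theorem chartSymmDeriv_prod_right {a : M} {b : M'} {z : E} {w : E'}
    (hz : z ∈ (extChartAt I a).target) (hw : w ∈ (extChartAt I' b).target) (v : E') :
    chartSymmDeriv (I.prod I') (a, b) (z, w) (0, v) = (0, chartSymmDeriv I' b w v) := by
  have hs : ((extChartAt I a).symm z, (extChartAt I' b).symm w) ∈
      (extChartAt (I.prod I') (a, b)).source := by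
    rw [extChartAt_prod]
    exact ⟨(extChartAt I a).map_target hz, (extChartAt I' b).map_target hw⟩
  have hf : MDifferentiable I' (I.prod I') fun x : M' => ((extChartAt I a).symm z, x) := fun x =>
    mdifferentiableAt_const.prodMk mdifferentiableAt_id
  have h := fderiv_chart_comp (p' := (a, b)) hw hs (hf _)
  have he : (fun y => extChartAt (I.prod I') (a, b)
      ((extChartAt I a).symm z, (extChartAt I' b).symm y)) =ᶠ[𝓝 w] fun y => (z, y) := by
    filter_upwards [extChartAt_target_mem_nhds' hw] with y hy
    rw [extChartAt_prod]
    exact Prod.ext ((extChartAt I a).right_inv hz) ((extChartAt I' b).right_inv hy)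
  have he0 := he.self_of_nhds
  have h2 := chartSymmDeriv_comp_tangentMapAt (I := I.prod I') hs
  dsimp only at he0
  rw [he0] at h2
  have h3 : tangentMapAt (I.prod I') 𝓘(ℝ, E × E') (extChartAt (I.prod I') (a, b))
      ((extChartAt I a).symm z, (extChartAt I' b).symm w) (0, chartSymmDeriv I' b w v) =
        (0, v) := by
    rw [← tangentMapAt_prodMk_right (I := I) (I' := I') ((extChartAt I a).symm z)
      ((extChartAt I' b).symm w)]
    refine (DFunLike.congr_fun h v).symm.trans ?_
    rw [he.fderiv_eq, (hasFDerivAt_prodMk_right (𝕜 := ℝ) z w).fderiv]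
    rfl
  rw [← h3]
  exact DFunLike.congr_fun h2 _

end ProductCharts

/-! ### Left invariant forms on G × M and Cartan's formula at the unit -/

section Restriction

variable {EG : Type*} [NormedAddCommGroup EG] [NormedSpace ℝ EG]
  {HG : Type*} [TopologicalSpace HG] {I : ModelWithCorners ℝ EG HG}
  {G : Type*} [TopologicalSpace G] [ChartedSpace HG G] [Group G]
  {EM : Type*} [NormedAddCommGroup EM] [NormedSpace ℝ EM]
  {HM : Type*} [TopologicalSpace HM] {J : ModelWithCorners ℝ EM HM}
  {M : Type*} [TopologicalSpace M] [ChartedSpace HM M]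

variable (I G) in
/-- The left invariant vector field with value `x` at the unit. -/
noncomputable def leftInvariantField (x : EG) (g : G) : EG :=
  tangentMapAt I I (fun h : G => g * h) 1 x

theorem leftInvariantField_one (x : EG) : leftInvariantField I G x 1 = x := by
  have h : tangentMapAt I I (fun h : G => 1 * h) 1 = ContinuousLinearMap.id ℝ EG := by
    rw [show (fun h : G => 1 * h) = id from funext one_mul, tangentMapAt_id]
  exact DFunLike.congr_fun h x

theorem comp_appendProd {F₁ F₂ F₁' F₂' : Type*} [NormedAddCommGroup F₁] [NormedSpace ℝ F₁]
    [NormedAddCommGroup F₂] [NormedSpace ℝ F₂] [NormedAddCommGroup F₁'] [NormedSpace ℝ F₁']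
    [NormedAddCommGroup F₂'] [NormedSpace ℝ F₂'] {T : F₁ × F₂ → F₁' × F₂'} {k l : ℕ}
    {X : Fin k → F₁} {X' : Fin k → F₁'} {u : Fin l → F₂} {u' : Fin l → F₂'}
    (hX : ∀ i, T (X i, 0) = (X' i, 0)) (hu : ∀ j, T (0, u j) = (0, u' j)) :
    T ∘ appendProd X u = appendProd X' u' := by
  ext1 i
  refine Fin.addCases (fun i => ?_) (fun i => ?_) i
  · rw [Function.comp_apply, appendProd_castAdd, hX, appendProd_castAdd]
  · rw [Function.comp_apply, appendProd_natAdd, hu, appendProd_natAdd]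

/-- The left invariant extension of the `x i` is irrelevant here, as only its value at the unit
enters. -/
theorem restrictToUnit_apply (β : GradedForm (EG × EM) (G × M)) (k : ℕ)
    (x : Fin k → EG) (l : ℕ) (p : M) (u : Fin l → EM) :
    restrictToUnit I J β k x l p u = β (k + l) (1, p) (appendProd x u) := by
  refine (interiorForms_apply k _ β l (1, p) _).trans ?_
  refine congrArg (β (k + l) (1, p)) (congrArg₂ Fin.append (funext fun i => ?_)
    (funext fun j => ?_))
  · exact congrArg (fun v : EG => (v, (0 : EM))) (leftInvariantField_one (I := I) (G := G) (x i))
  · exact tangentMapAt_prodMk_right _ _ _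

variable [LieGroup I ∞ G] [IsManifold J ∞ M]

theorem tangentMapAt_leftTranslation (g : G) (q : M) (x : EG) (u : EM) :
    tangentMapAt (I.prod J) (I.prod J) (leftTranslation G M g) (1, q) (x, u) =
      (leftInvariantField I G x g, u) := by
  have hm : MDifferentiable I I fun h : G => g * h :=
    (contMDiff_mul_left (I := I) (n := ∞)).mdifferentiable (by simp)
  have hd : MDifferentiable (I.prod J) (I.prod J) (leftTranslation G M g) := fun r =>
    ((hm r.1).comp r mdifferentiableAt_fst).prodMk mdifferentiableAt_snd
  refine (tangentMapAt_prod_apply _ (hd _)).trans ?_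
  have h1 : tangentMapAt I (I.prod J) (fun z : G => leftTranslation G M g (z, q)) 1 x =
      (leftInvariantField I G x g, (0 : EM)) := by
    refine (tangentMapAt_prodMk (f := fun z : G => g * z) (g := fun _ => q) (hm _)
      mdifferentiableAt_const x).trans ?_
    rw [tangentMapAt_const]
    rfl
  have h2 : tangentMapAt J (I.prod J) (fun z : M => leftTranslation G M g (1, z)) q u = (0, u) :=
    tangentMapAt_prodMk_right (I := I) (g * 1) q u
  exact (congrArg₂ (· + ·) h1 h2).trans (by simp)

/-- Translation by `g` carries (e, q) to (g, q) and (x, u) to (value at `g` of the left invariant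
field of `x`, u), so invariance makes the value independent of `g`. -/
theorem IsInvariantForm.apply_appendProd {β : GradedForm (EG × EM) (G × M)}
    (hβ : IsInvariantForm (I.prod J) (leftTranslation G M) β) {k l : ℕ}
    (x : Fin k → EG) (g : G) (q : M) (u : Fin l → EM) :
    β (k + l) (g, q) (appendProd (fun i => leftInvariantField I G (x i) g) u) =
      restrictToUnit I J β k x l q u := by
  rw [restrictToUnit_apply]
  have h := congrFun (congrFun (hβ g) (k + l)) (1, q)
  rw [← h, pullbackForm, ContinuousAlternatingMap.compContinuousLinearMap_apply,
    show leftTranslation G M g (1, q) = (g, q) by simp [leftTranslation]]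
  refine congrArg _ (comp_appendProd (fun i => tangentMapAt_leftTranslation g q (x i) 0)
    fun j => ?_).symm
  refine (tangentMapAt_leftTranslation g q 0 (u j)).trans ?_
  rw [leftInvariantField, map_zero]

variable [I.Boundaryless] [J.Boundaryless]

/-- The right hand side does not involve `z`: this is the constancy along the group required by
`extDeriv_apply_of_const`. -/
theorem IsInvariantForm.formInChart_appendProd {β : GradedForm (EG × EM) (G × M)}
    (hβ : IsInvariantForm (I.prod J) (leftTranslation G M) β) {k l : ℕ}
    (x : Fin k → EG) {a : G} {p : M} {z : EG} {w : EM} (hz : z ∈ (extChartAt I a).target)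
    (hw : w ∈ (extChartAt J p).target) (u : Fin l → EM) :
    formInChart (I.prod J) (k + l) (β (k + l)) (a, p) (z, w)
        (appendProd (fun i => fieldInChart I (leftInvariantField I G (x i)) a z) u) =
      formInChart J l (restrictToUnit I J β k x l) p w u := by
  have : IsManifold I 1 G := .of_le (n := ∞) (by simp)
  have : IsManifold J 1 M := .of_le (n := ∞) (by simp)
  have h : ∀ v, chartSymmDeriv I a z
      (tangentMapAt I 𝓘(ℝ, EG) (extChartAt I a) ((extChartAt I a).symm z) v) = v := fun v => by
    have h := chartSymmDeriv_comp_tangentMapAt (I := I) ((extChartAt I a).map_target hz)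
    rw [(extChartAt I a).right_inv hz] at h
    exact DFunLike.congr_fun h v
  rw [formInChart, formInChart, ContinuousAlternatingMap.compContinuousLinearMap_apply,
    ContinuousAlternatingMap.compContinuousLinearMap_apply, ← hβ.apply_appendProd x
      ((extChartAt I a).symm z)]
  have hs : (extChartAt (I.prod J) (a, p)).symm (z, w) =
      ((extChartAt I a).symm z, (extChartAt J p).symm w) := by
    rw [extChartAt_prod]; rfl
  rw [hs]
  refine congrArg _ (comp_appendProd (fun i => ?_) fun j => chartSymmDeriv_prod_right hz hw (u j))
  rw [chartSymmDeriv_prod_left hz hw, fieldInChart, h]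

theorem differentiableAt_fieldInChart_leftInvariantField [CompleteSpace EG] (x : EG) (a : G) :
    DifferentiableAt ℝ (fieldInChart I (leftInvariantField I G x) a) (extChartAt I a a) := by
  have : IsManifold I 2 G := .of_le (n := ∞) ENat.LEInfty.out
  exact differentiableAt_fieldInChart (V := leftInvariantField I G x)
    (mdifferentiableAt_mulInvariantVectorField (x : GroupLieAlgebra I G))

theorem lieBracket_fieldInChart_leftInvariantField (x y : GroupLieAlgebra I G) :
    VectorField.lieBracket ℝ (fieldInChart I (leftInvariantField I G x) (1 : G))
      (fieldInChart I (leftInvariantField I G y) 1) (extChartAt I (1 : G) 1) = (⁅x, y⁆ :) := by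
  have : IsManifold I 1 G := .of_le (n := ∞) (by simp)
  exact (bracketField_eq_lieBracket _ _ _).symm

variable [FiniteDimensional ℝ EG]

/-- The exterior derivative, in the group directions, of the restriction of a left invariant form
to the unit. -/
theorem IsInvariantForm.extDeriv_fixTail {β : GradedForm (EG × EM) (G × M)}
    (hβ : IsInvariantForm (I.prod J) (leftTranslation G M) β)
    (hs : IsSmoothForm (I.prod J) β) {k l : ℕ} (x : Fin (k + 1) → EG) (p : M) (u : Fin l → EM) :
    extDeriv (fun z => fixTail u (formInChart (I.prod J) (k + l) (β (k + l)) (1, p)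
        (z, extChartAt J p p))) (extChartAt I (1 : G) 1) x =
      - bracketSum (𝔤 := GroupLieAlgebra I G) (fun k => restrictToUnit I J β k) (k + 1) x l p u := by
  have : CompleteSpace EG := FiniteDimensional.complete ℝ EG
  have : IsManifold I 1 G := .of_le (n := ∞) (by simp)
  have : IsManifold J 1 M := .of_le (n := ∞) (by simp)
  let V : Fin (k + 1) → EG → EG := fun i => fieldInChart I (leftInvariantField I G (x i)) 1
  have hV : ∀ i, DifferentiableAt ℝ (V i) (extChartAt I (1 : G) 1) := fun i =>
    differentiableAt_fieldInChart_leftInvariantField (x i) 1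
  have hx : (fun i => V i (extChartAt I (1 : G) 1)) = x := by
    funext i
    exact (fieldInChart_self _ _).trans (leftInvariantField_one _)
  have hη : DifferentiableAt ℝ (fun z => fixTail u (formInChart (I.prod J) (k + l) (β (k + l))
      (1, p) (z, extChartAt J p p))) (extChartAt I (1 : G) 1) :=
    differentiableAt_fixTail ((hs.contDiffAt _ (extChartAt_prod_target
      (mem_extChartAt_target (1 : G)) (mem_extChartAt_target p))).differentiableAt (by simp)) u
  have hc : ∀ i : Fin (k + 1), (fun y => fixTail u (formInChart (I.prod J) (k + l) (β (k + l))
      (1, p) (y, extChartAt J p p)) (i.removeNth (V · y))) =ᶠ[𝓝 (extChartAt I (1 : G) 1)]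
        fun _ => formInChart J l (restrictToUnit I J β k (i.removeNth x) l) p
          (extChartAt J p p) u := fun i => by
    filter_upwards [extChartAt_target_mem_nhds (I := I) (1 : G)] with y hy
    exact hβ.formInChart_appendProd (i.removeNth x) hy (mem_extChartAt_target p) u
  cases k with
  | zero =>
    conv_lhs => rw [← hx]
    -- A single field has no distinct partner, so the commutation hypothesis is vacuous; the
    -- remaining derivative is that of a constant, and `bracketSum` is zero for one argument.
    rw [extDeriv_apply_vectorField_of_pairwise_commute hη hV
      (fun i j h => (h (Fin.ext (by omega))).elim)]
    simp only [(hc _).fderiv_eq, bracketSum]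
    simp
  | succ k =>
    conv_lhs => rw [← hx]
    rw [extDeriv_apply_of_const hη hV fun i => ⟨_, hc i⟩]
    simp only [bracketSum, Finset.sum_apply, Pi.smul_apply, ContinuousAlternatingMap.sum_apply,
      ContinuousAlternatingMap.smul_apply, smul_eq_mul, hx]
    congr 1
    refine Finset.sum_congr rfl fun i _ => Finset.sum_congr rfl fun j _ => ?_
    congr 1
    refine Eq.trans ?_ (restrictToUnit_apply β (k + 1) _ l p u).symm
    rw [fixTail_apply]
    have h0 : (extChartAt I (1 : G) 1, extChartAt J p p) =
        extChartAt (I.prod J) ((1 : G), p) (1, p) := by rw [extChartAt_prod]; rfl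
    rw [h0, formInChart_self]
    exact congrArg (fun b : EG => β (k + 1 + l) (1, p) (appendProd
        (Matrix.vecCons b (j.removeNth (i.castSucc.removeNth x))) u))
      (lieBracket_fieldInChart_leftInvariantField (x i.castSucc) (x j.succ))

/-- At the coordinate of the unit the left invariant fields take the values `x`, so inserting `x`
there gives the chart expression of the restricted form on `M`. -/
theorem IsInvariantForm.extDeriv_fixHead {β : GradedForm (EG × EM) (G × M)}
    (hβ : IsInvariantForm (I.prod J) (leftTranslation G M) β) {k l : ℕ} (x : Fin k → EG) (p : M)
    (u : Fin (l + 1) → EM) :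
    extDeriv (fun w => fixHead x (formInChart (I.prod J) (k + l) (β (k + l)) (1, p)
        (extChartAt I (1 : G) 1, w))) (extChartAt J p p) u =
      dForm J (restrictToUnit I J β k x) (l + 1) p u := by
  have : IsManifold I 1 G := .of_le (n := ∞) (by simp)
  have : IsManifold J 1 M := .of_le (n := ∞) (by simp)
  rw [dForm_succ]
  congr 1
  refine Filter.EventuallyEq.extDeriv_eq ?_
  filter_upwards [extChartAt_target_mem_nhds (I := J) p] with w hw
  ext u
  have h := hβ.formInChart_appendProd x (mem_extChartAt_target (I := I) (1 : G)) hw u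
  simpa only [fieldInChart_self, leftInvariantField_one, fixHead_apply] using h

/-- Cartan's formula for the restriction of a left invariant form to the unit. -/
theorem IsInvariantForm.dForm_apply_appendProd {β : GradedForm (EG × EM) (G × M)}
    (hβ : IsInvariantForm (I.prod J) (leftTranslation G M) β)
    (hs : IsSmoothForm (I.prod J) β) {k l : ℕ} (x : Fin (k + 1) → EG) (p : M) (u : Fin l → EM) :
    dForm (I.prod J) β (k + 1 + l) (1, p) (appendProd x u) =
      - bracketSum (𝔤 := GroupLieAlgebra I G) (fun k => restrictToUnit I J β k) (k + 1) x l p u +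
      (-1) ^ (k + 1) * dForm J (restrictToUnit I J β (k + 1) x) l p u := by
  have : IsManifold I 1 G := .of_le (n := ∞) (by simp)
  have : IsManifold J 1 M := .of_le (n := ∞) (by simp)
  have h : k + l + 1 = k + 1 + l := by omega
  have h0 : extChartAt (I.prod J) ((1 : G), p) (1, p) =
      (extChartAt I (1 : G) 1, extChartAt J p p) := by rw [extChartAt_prod]; rfl
  have hd : ∀ m, DifferentiableAt ℝ (formInChart (I.prod J) m (β m) (1, p))
      (extChartAt I (1 : G) 1, extChartAt J p p) := fun m =>
    (hs.contDiffAt _ (extChartAt_prod_target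
      (mem_extChartAt_target (1 : G)) (mem_extChartAt_target p))).differentiableAt (by simp)
  rw [gradedForm_cast _ h, dForm_succ, h0]
  -- For l = 0 there are no directions along `M`; the second term is then zero because `dForm`
  -- vanishes in degree 0.
  cases l with
  | zero =>
    rw [extDeriv_appendProd_zero (θ := fun m => formInChart (I.prod J) m (β m) (1, p)) hd x u h,
      hβ.extDeriv_fixTail hs]
    simp [dForm]
  | succ l =>
    rw [extDeriv_appendProd (θ := fun m => formInChart (I.prod J) m (β m) (1, p)) hd x u h,
      hβ.extDeriv_fixTail hs, hβ.extDeriv_fixHead]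

end Restriction

/-! ### The right hand side of the morphism equation -/

section Unshuffles

/-- A strictly increasing permutation of a finite ordinal is the identity. -/
theorem mem_unshuffles_single {m : ℕ} (h : 0 < m) (σ : Equiv.Perm (Fin m)) :
    σ ∈ unshuffles (Composition.single m h) ↔ σ = 1 := by
  rw [unshuffles, Finset.mem_filter]
  refine ⟨fun hσ => ?_, ?_⟩
  · have h0 : StrictMono σ := fun s t hst => by
      have h1 : StrictMono fun t : Fin m => σ ((Composition.single m h).embedding (0 : Fin 1) t) :=
        hσ.2 (0 : Fin 1)
      have h2 := h1 hst
      simp only at h2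
      rwa [Composition.single_embedding, Composition.single_embedding] at h2
    have := Subsingleton.elim (h0.orderIsoOfSurjective σ σ.surjective) (OrderIso.refl _)
    ext t
    exact congrArg Fin.val (DFunLike.congr_fun this t)
  · rintro rfl
    exact ⟨Finset.mem_univ _, fun i => (Composition.embedding _ i).strictMono⟩

theorem unshuffles_ones (m : ℕ) : unshuffles (Composition.ones m) = Finset.univ := by
  rw [unshuffles, Finset.filter_true_of_mem]
  intro σ _ i
  have : Subsingleton (Fin ((Composition.ones m).blocksFun i)) := by
    rw [Composition.ones_blocksFun]; infer_instance
  exact Subsingleton.strictMono _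

/-- Both summands equal K(K-1)/2, so the décalage sign of the composition (1, …, 1) is +1. -/
theorem even_decalage_ones (K : ℕ) :
    Even (K * (K - 1) / 2 + ∑ i : Fin K, (K - 1 - (i : ℕ))) := by
  rw [Fin.sum_univ_eq_sum_range (fun i => K - 1 - i) K, Finset.sum_range_reflect (fun i => i) K,
    Finset.sum_range_id]
  exact ⟨_, rfl⟩

variable {𝔤 L : Type*} [LieRing 𝔤] [LieAlgebra ℝ 𝔤] [AddCommGroup L] [Module ℝ L]

/-- The summand of the morphism equation belonging to a composition and an unshuffle. -/
noncomputable def compositionTerm (A : LInftyData L) (f : ∀ k : ℕ, 𝔤 [⋀^Fin k]→ₗ[ℝ] L) {m : ℕ}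
    (x : Fin m → 𝔤) (c : Composition m) (σ : Equiv.Perm (Fin m)) : L :=
  (((Equiv.Perm.sign σ : ℤ) : ℝ) / (c.length ! : ℝ) *
    (-1 : ℝ) ^ (c.length * (c.length - 1) / 2 +
      ∑ i : Fin c.length, (c.length - 1 - (i : ℕ)) * c.blocksFun i)) •
    A.l c.length (fun i => f (c.blocksFun i) (fun t => x (σ (c.embedding i t))))

variable (A : LInftyData L) (f : ∀ k : ℕ, 𝔤 [⋀^Fin k]→ₗ[ℝ] L) {m : ℕ} (x : Fin m → 𝔤)

theorem sum_compositionTerm_single (h : 0 < m) :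
    ∑ σ ∈ unshuffles (Composition.single m h), compositionTerm A f x (Composition.single m h) σ =
      A.l 1 (fun _ => f m x) := by
  rw [show unshuffles (Composition.single m h) = {1} from
    Finset.ext fun σ => by rw [mem_unshuffles_single, Finset.mem_singleton], Finset.sum_singleton]
  have hl : A.l (Composition.single m h).length (fun i => f ((Composition.single m h).blocksFun i)
      (fun t => x ((1 : Equiv.Perm (Fin m)) ((Composition.single m h).embedding i t)))) =
      A.l 1 (fun _ => f m x) := by
    refine congrArg (A.l 1) (funext fun i => ?_)
    obtain rfl : i = (0 : Fin 1) := Subsingleton.elim (α := Fin 1) _ _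
    refine congrArg (f m) (funext fun t => congrArg x ?_)
    exact Composition.single_embedding h t
  rw [compositionTerm, hl]
  have hs : ∑ i : Fin (Composition.single m h).length, ((Composition.single m h).length - 1 -
      (i : ℕ)) * (Composition.single m h).blocksFun i = 0 :=
    Finset.sum_eq_zero fun i _ => by simp [Composition.single_length]
  rw [hs, Composition.single_length]
  simp

theorem l_cast {K K' : ℕ} (h : K' = K) (y : Fin K → L) : A.l K y = A.l K' (y ∘ Fin.cast h) := by
  subst h; rfl

theorem alternating_cast {K K' : ℕ} (h : K' = K) (y : Fin K → 𝔤) :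
    f K y = f K' (y ∘ Fin.cast h) := by
  subst h; rfl

theorem compositionTerm_ones (σ : Equiv.Perm (Fin m)) :
    compositionTerm A f x (Composition.ones m) σ =
      (((Equiv.Perm.sign σ : ℤ) : ℝ) / (m ! : ℝ)) • A.l m (fun i => f 1 fun _ => x (σ i)) := by
  have hl : A.l (Composition.ones m).length (fun i => f ((Composition.ones m).blocksFun i)
      (fun t => x (σ ((Composition.ones m).embedding i t)))) =
      A.l m (fun i => f 1 fun _ => x (σ i)) := by
    rw [l_cast A (Composition.ones_length m).symm]
    refine congrArg (A.l m) (funext fun i => ?_)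
    rw [Function.comp_apply, alternating_cast f (Composition.ones_blocksFun m _).symm]
    refine congrArg (f 1) (funext fun t => congrArg x (congrArg σ ?_))
    obtain rfl : t = 0 := Subsingleton.elim _ _
    exact (Composition.ones_embedding _ (by simp)).trans (by ext; simp)
  rw [compositionTerm, hl]
  simp only [Composition.ones_blocksFun, mul_one]
  rw [(even_decalage_ones _).neg_one_pow, mul_one, Composition.ones_length]

/-- The right hand side of the morphism equation if only the compositions `(m)` and `(1, …, 1)`
contribute. -/
theorem sum_compositionTerm (hm : 2 ≤ m)
    (hzero : ∀ (K : ℕ) (y : Fin K → L), 2 ≤ K →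
      (∃ i k, 2 ≤ k ∧ ∃ z : Fin k → 𝔤, y i = f k z) → A.l K y = 0)
    (halt : ∀ σ : Equiv.Perm (Fin m), A.l m (fun i => f 1 fun _ => x (σ i)) =
      ((Equiv.Perm.sign σ : ℤ) : ℝ) • A.l m (fun i => f 1 fun _ => x i)) :
    ∑ c : Composition m, ∑ σ ∈ unshuffles c, compositionTerm A f x c σ =
      A.l 1 (fun _ => f m x) + A.l m (fun i => f 1 fun _ => x i) := by
  have h0 : 0 < m := by omega
  have hne : Composition.single m h0 ≠ Composition.ones m := by
    intro h
    have := congrArg Composition.length h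
    rw [Composition.single_length, Composition.ones_length] at this
    omega
  rw [Fintype.sum_eq_add _ _ hne, sum_compositionTerm_single, unshuffles_ones]
  · congr 1
    -- Antisymmetry of the bracket makes all m! permutations contribute equally, which cancels the
    -- factor 1/m!.
    simp only [compositionTerm_ones, halt, smul_smul]
    have h1 : ∀ σ : Equiv.Perm (Fin m), ((Equiv.Perm.sign σ : ℤ) : ℝ) / (m ! : ℝ) *
        ((Equiv.Perm.sign σ : ℤ) : ℝ) = (m ! : ℝ)⁻¹ := fun σ => by
      have : ((Equiv.Perm.sign σ : ℤ) : ℝ) * ((Equiv.Perm.sign σ : ℤ) : ℝ) = 1 := by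
        rw [← Int.cast_mul, ← Units.val_mul, Int.units_mul_self]; simp
      rw [div_mul_eq_mul_div, this, one_div]
    simp only [h1]
    rw [Finset.sum_const, Finset.card_univ, Fintype.card_perm, Fintype.card_fin,
      ← Nat.cast_smul_eq_nsmul ℝ, smul_smul, mul_inv_cancel₀ (by positivity), one_smul]
  -- Any other composition has at least two blocks, one of which has length at least 2, so `hzero`
  -- applies.
  · rintro c ⟨hc1, hc2⟩
    refine Finset.sum_eq_zero fun σ _ => ?_
    rw [compositionTerm, hzero, smul_zero]
    · have h1 : c.length ≠ 1 := fun h => hc1 ((Composition.eq_single_iff_length h0).2 h)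
      have h2 := c.length_pos_of_pos h0
      omega
    · obtain ⟨k, hk, hk2⟩ := Composition.ne_ones_iff.1 hc2
      obtain ⟨i, rfl⟩ := List.mem_iff_get.1 hk
      exact ⟨i, _, hk2, _, rfl⟩

theorem sum_compositionTerm_one (x : Fin 1 → 𝔤) :
    ∑ c : Composition 1, ∑ σ ∈ unshuffles c, compositionTerm A f x c σ =
      A.l 1 (fun _ => f 1 x) := by
  rw [Fintype.sum_eq_single (Composition.single 1 one_pos), sum_compositionTerm_single]
  intro c hc
  refine absurd ((Composition.eq_single_iff_length one_pos).2 ?_) hc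
  have h2 := c.length_pos_of_pos one_pos
  have h1 := c.length_le
  omega

end Unshuffles

/-! ### Iterated interior products and the signs ς(k) -/

section InteriorProducts

variable {E : Type*} [NormedAddCommGroup E] [NormedSpace ℝ E]
  {N : Type*} [TopologicalSpace N]

/-- Pulling the form back along E × E → E, (a, b) ↦ a + b, turns `appendProd` into `Fin.append`.
Iterated interior products thus inherit multilinearity and antisymmetry in the vector fields from
`fixTail`. -/
theorem interiorForms_apply_eq_fixTail (k : ℕ) (v : Fin k → N → E) (θ : GradedForm E N) (m : ℕ)
    (p : N) (u : Fin m → E) :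
    interiorForms k v θ m p u = fixTail u ((θ (k + m) p).compContinuousLinearMap
      (ContinuousLinearMap.fst ℝ E E + ContinuousLinearMap.snd ℝ E E)) (fun i => v i p) := by
  rw [interiorForms_apply, fixTail_apply, ContinuousAlternatingMap.compContinuousLinearMap_apply]
  congr 1
  ext1 i
  refine Fin.addCases (fun i => ?_) (fun i => ?_) i
  · simp
  · simp

theorem interiorForms_perm (k : ℕ) (v : Fin k → N → E) (θ : GradedForm E N)
    (σ : Equiv.Perm (Fin k)) :
    interiorForms k (fun i => v (σ i)) θ = ((Equiv.Perm.sign σ : ℤ) : ℝ) • interiorForms k v θ := by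
  funext m p
  ext u
  rw [Pi.smul_apply, Pi.smul_apply, ContinuousAlternatingMap.smul_apply,
    interiorForms_apply_eq_fixTail, interiorForms_apply_eq_fixTail]
  refine ((fixTail u ((θ (k + m) p).compContinuousLinearMap
    (ContinuousLinearMap.fst ℝ E E + ContinuousLinearMap.snd ℝ E E))).toAlternatingMap.map_perm
      (fun i => v i p) σ).trans ?_
  rw [Units.smul_def, ← Int.cast_smul_eq_zsmul ℝ]
  rfl

theorem interiorForms_neg (k : ℕ) (v : Fin k → N → E) (θ : GradedForm E N) :
    interiorForms k (fun i => -v i) θ = (-1 : ℝ) ^ k • interiorForms k v θ := by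
  funext m p
  ext u
  rw [Pi.smul_apply, Pi.smul_apply, ContinuousAlternatingMap.smul_apply,
    interiorForms_apply_eq_fixTail, interiorForms_apply_eq_fixTail]
  have h := (fixTail u ((θ (k + m) p).compContinuousLinearMap
    (ContinuousLinearMap.fst ℝ E E + ContinuousLinearMap.snd ℝ E E))).map_smul_univ
      (fun _ => (-1 : ℝ)) (fun i => v i p)
  simpa using h

theorem interiorForms_eq_zero (k : ℕ) (v : Fin k → N → E) (θ : GradedForm E N) {i : Fin k}
    (hi : v i = 0) : interiorForms k v θ = 0 := by
  funext m p
  ext u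
  rw [interiorForms_apply]
  exact (θ (k + m) p).map_coord_zero (Fin.castAdd m i) (by simp [hi])

/-- The exponents are triangular numbers and grow by k + 1. This recursion absorbs the sign
(-1)^(k+1) of Cartan's formula. -/
theorem varsigma_succ (k : ℕ) : varsigma (k + 1) = (-1) ^ (k + 1) * varsigma k := by
  have h : (k + 1) * (k + 1 + 1) / 2 = k * (k + 1) / 2 + (k + 1) := by
    rw [show (k + 1) * (k + 1 + 1) = k * (k + 1) + (k + 1) * 2 by ring,
      Nat.add_mul_div_right _ _ two_pos]
  rw [varsigma, varsigma, h, pow_add]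
  ring

theorem varsigma_mul_self (k : ℕ) : varsigma k * varsigma k = 1 := by
  rw [varsigma, neg_mul_neg, ← pow_add]
  exact Even.neg_one_pow ⟨_, rfl⟩

theorem varsigma_one : varsigma 1 = 1 := by norm_num [varsigma]

theorem varsigma_two : varsigma 2 = 1 := by norm_num [varsigma]

end InteriorProducts

/-! ### Brackets of observables -/

section Observables

variable {E : Type*} [NormedAddCommGroup E] [NormedSpace ℝ E]
  {H : Type*} [TopologicalSpace H] {I : ModelWithCorners ℝ E H}
  {M : Type*} [TopologicalSpace M] [ChartedSpace H M] [IsManifold I ∞ M]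

theorem bracketField_zero_left (w : M → E) : bracketField I 0 w = 0 := by
  funext p
  exact congrFun (VectorField.mlieBracket_zero_left (𝕜 := ℝ) (I := I)
    (W := fun q => (w q : TangentSpace I q))) p

theorem bracketField_zero_right (v : M → E) : bracketField I v 0 = 0 := by
  funext p
  exact congrFun (VectorField.mlieBracket_zero_right (𝕜 := ℝ) (I := I)
    (W := fun q => (v q : TangentSpace I q))) p

/-- Brackets of arity ≥ 2 depend on their arguments only through the vector fields. This removes
every term of the morphism equation in which some f_k with k ≥ 2 enters such a bracket. -/
theorem obsBracket_eq_zero (n : ℕ) (θ : GradedForm E M) {K : ℕ} (hK : 2 ≤ K)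
    (y : Fin K → ObsSpace E M) {i : Fin K} (hi : (y i).1 = 0) : obsBracket I n θ K y = 0 := by
  match K, hK with
  | 2, _ =>
    refine Prod.ext ?_ (interiorForms_eq_zero 2 (fun i => (y i).1) θ hi)
    change bracketField I (y 0).1 (y 1).1 = 0
    fin_cases i
    · exact (congrArg (fun v => bracketField I v (y 1).1) hi).trans (bracketField_zero_left _)
    · exact (congrArg (fun v => bracketField I (y 0).1 v) hi).trans (bracketField_zero_right _)
  | K + 3, _ =>
    refine Prod.ext rfl ?_
    change varsigma (K + 3) • interiorForms (K + 3) (fun i => (y i).1) θ = 0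
    rw [interiorForms_eq_zero (K + 3) (fun i => (y i).1) θ hi, smul_zero]

theorem obsBracket_snd (n : ℕ) (θ : GradedForm E M) {K : ℕ} (hK : 2 ≤ K)
    (y : Fin K → ObsSpace E M) :
    (obsBracket I n θ K y).2 = varsigma K • interiorForms K (fun i => (y i).1) θ := by
  match K, hK with
  | 2, _ => rw [varsigma_two, one_smul]; rfl
  | K + 3, _ => rfl

theorem dForm_succ_eq_zero {θ : GradedForm E M} {l : ℕ} (h : θ l = 0) :
    dForm I θ (l + 1) = 0 := by
  refine Eq.trans ?_ (congrFun (dForm_zero (I := I) (M := M)) (l + 1))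
  simp only [dForm, h]
  rfl

/-- A form of degree d with d + 1 < n has its differential below the truncation degree, so the
truncation in l_1 loses nothing. -/
theorem obsBracket_one (n : ℕ) (θ : GradedForm E M) (y : Fin 1 → ObsSpace E M) {d : ℕ}
    (hd : d + 1 < n) (hy : ∀ l, l ≠ d → (y 0).2 l = 0) :
    obsBracket I n θ 1 y = (0, dForm I (y 0).2) := by
  refine Prod.ext rfl (funext fun m => ?_)
  change (if m < n then dForm I (y 0).2 m else 0) = dForm I (y 0).2 m
  split_ifs with h
  · rfl
  · match m with
    | 0 => rfl
    | l + 1 => exact (dForm_succ_eq_zero (hy l (by omega))).symm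

/-- The differential of a form of degree n - 1 has degree n, which the truncation discards: l_1
vanishes on elements of degree 0. -/
theorem obsBracket_one_eq_zero (n : ℕ) (θ : GradedForm E M) (y : Fin 1 → ObsSpace E M)
    (hy : ∀ l, l + 1 ≠ n → (y 0).2 l = 0) : obsBracket I n θ 1 y = 0 := by
  refine Prod.ext rfl (funext fun m => ?_)
  change (if m < n then dForm I (y 0).2 m else 0) = 0
  split_ifs with h
  · match m with
    | 0 => rfl
    | l + 1 => exact dForm_succ_eq_zero (hy l (by omega))
  · rfl

end Observables

/-! ### The homotopy moment map of a left invariant form -/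

section MomentMap

variable {EG : Type*} [NormedAddCommGroup EG] [NormedSpace ℝ EG]
  {HG : Type*} [TopologicalSpace HG] {I : ModelWithCorners ℝ EG HG}
  {G : Type*} [TopologicalSpace G] [ChartedSpace HG G] [Group G]
  {EM : Type*} [NormedAddCommGroup EM] [NormedSpace ℝ EM]
  {HM : Type*} [TopologicalSpace HM] {J : ModelWithCorners ℝ EM HM}
  {M : Type*} [TopologicalSpace M] [ChartedSpace HM M]

variable (I J) in
/-- The restriction of a form on `G × M` to the unit, with the signs of a moment map. -/
noncomputable def momentForm (β : GradedForm (EG × EM) (G × M)) (k : ℕ) :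
    GroupLieAlgebra I G [⋀^Fin k]→ₗ[ℝ] GradedForm EM M where
  toFun x := varsigma k • restrictToUnit I J β k x
  map_update_add' x i a b := by
    have h : ∀ l p u, restrictToUnit I J β k (Function.update x i (a + b)) l p u =
        restrictToUnit I J β k (Function.update x i a) l p u +
          restrictToUnit I J β k (Function.update x i b) l p u := fun l p u => by
      have h1 := (fixTail u (β (k + l) (1, p))).toAlternatingMap.map_update_add (x : Fin k → EG)
        i a b
      exact (restrictToUnit_apply β k _ l p u).trans (h1.trans (congrArg₂ (· + ·)
        (restrictToUnit_apply β k _ l p u).symm (restrictToUnit_apply β k _ l p u).symm))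
    rw [← smul_add]
    congr 1
    funext l p
    ext u
    exact h l p u
  map_update_smul' x i c a := by
    have h : ∀ l p u, restrictToUnit I J β k (Function.update x i (c • a)) l p u =
        c • restrictToUnit I J β k (Function.update x i a) l p u := fun l p u => by
      have h1 := (fixTail u (β (k + l) (1, p))).toAlternatingMap.map_update_smul (x : Fin k → EG)
        i c a
      exact (restrictToUnit_apply β k _ l p u).trans (h1.trans (congrArg (c • ·)
        (restrictToUnit_apply β k _ l p u).symm))
    rw [smul_comm]
    congr 1
    funext l p
    ext u
    exact h l p u
  map_eq_zero_of_eq' x i j hij hne := by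
    have h : restrictToUnit I J β k x = 0 := by
      funext l p
      ext u
      exact (restrictToUnit_apply β k x l p u).trans
        ((fixTail u (β (k + l) (1, p))).toAlternatingMap.map_eq_zero_of_eq (x : Fin k → EG) hij hne)
    rw [h, smul_zero]

variable (I J G M) in
/-- The fundamental vector fields as a linear map. -/
noncomputable def fundamentalFieldMap [MulAction G M] : GroupLieAlgebra I G →ₗ[ℝ] (M → EM) where
  toFun x := fundamentalField I J x
  map_add' := fundamentalField_add
  map_smul' := fundamentalField_smul

variable (I J) in
/-- The structure maps of the homotopy moment map belonging to a form on `G × M`. -/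
noncomputable def momentMap [MulAction G M] (β : GradedForm (EG × EM) (G × M)) :
    ∀ k : ℕ, GroupLieAlgebra I G [⋀^Fin k]→ₗ[ℝ] ObsSpace EM M
  | 0 => 0
  | 1 => (AlternatingMap.ofSubsingleton ℝ _ _ 0 (fundamentalFieldMap I G J M)).prod
      (momentForm I J β 1)
  | k + 2 => AlternatingMap.prod 0 (momentForm I J β (k + 2))

theorem momentMap_snd [MulAction G M] (β : GradedForm (EG × EM) (G × M)) {k : ℕ} (hk : 1 ≤ k)
    (x : Fin k → GroupLieAlgebra I G) :
    (momentMap I J β k x).2 = varsigma k • restrictToUnit I J β k x := by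
  match k, hk with
  | 1, _ => rfl
  | k + 2, _ => rfl

theorem momentMap_one_fst [MulAction G M] (β : GradedForm (EG × EM) (G × M))
    (x : Fin 1 → GroupLieAlgebra I G) :
    (momentMap I J β 1 x).1 = fundamentalField I J (x 0) := rfl

theorem momentMap_fst [MulAction G M] (β : GradedForm (EG × EM) (G × M)) {k : ℕ} (hk : 2 ≤ k)
    (x : Fin k → GroupLieAlgebra I G) : (momentMap I J β k x).1 = 0 := by
  match k, hk with
  | k + 2, _ => rfl

theorem restrictToUnit_eq_zero {β : GradedForm (EG × EM) (G × M)} {n : ℕ}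
    (hβ : β ∈ Omega (I.prod J) (G × M) (n : ℤ)) (k : ℕ) (x : Fin k → GroupLieAlgebra I G) {l : ℕ}
    (h : k + l ≠ n) : restrictToUnit I J β k x l = 0 := by
  funext p
  ext u
  refine (restrictToUnit_apply β k x l p u).trans ?_
  rw [hβ.2 (k + l) (by exact_mod_cast h)]
  rfl

variable [LieGroup I ∞ G] [IsManifold J ∞ M] [MulAction G M] [ContMDiffSMul I J ∞ G M]
  [FiniteDimensional ℝ EG] [FiniteDimensional ℝ EM] [I.Boundaryless] [J.Boundaryless]

/-- In charts the restricted form is the form on `G × M`, with the group coordinate frozen at the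
unit, followed by the continuous linear map `fixHead x`. -/
theorem IsInvariantForm.isSmoothForm_restrictToUnit {β : GradedForm (EG × EM) (G × M)}
    (hβ : IsInvariantForm (I.prod J) (leftTranslation G M) β) (hs : IsSmoothForm (I.prod J) β)
    (k : ℕ) (x : Fin k → EG) : IsSmoothForm J (restrictToUnit I J β k x) := by
  have : IsManifold I 1 G := .of_le (n := ∞) (by simp)
  intro l p
  have h₁ : ContDiffOn ℝ ∞ (fun w => formInChart (I.prod J) (k + l) (β (k + l)) (1, p)
      (extChartAt I (1 : G) 1, w)) (extChartAt J p).target :=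
    (hs (k + l) (1, p)).comp (contDiff_const.prodMk contDiff_id).contDiffOn
      fun w hw => extChartAt_prod_target (mem_extChartAt_target (1 : G)) hw
  have h : ContDiffOn ℝ ∞ (fun w => fixHead x (formInChart (I.prod J) (k + l)
      (β (k + l)) (1, p) (extChartAt I (1 : G) 1, w))) (extChartAt J p).target :=
    ContDiff.comp_contDiffOn (fixHead (F₂ := EM) (l := l) x).contDiff h₁
  refine h.congr fun w hw => ?_
  ext u
  have h := hβ.formInChart_appendProd x (mem_extChartAt_target (I := I) (1 : G)) hw u
  simp only [fieldInChart_self, leftInvariantField_one] at h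
  exact h.symm

/-- The projection kills the vector (x 0, 0), and the index k + 1 guarantees that there is one.
Hence `η` is arbitrary in what follows. -/
theorem pullbackForm_snd_apply_appendProd (η : GradedForm EM M) {k l : ℕ} (x : Fin (k + 1) → EG)
    (p : M) (u : Fin l → EM) :
    pullbackForm (I.prod J) J (fun q : G × M => q.2) η (k + 1 + l) (1, p) (appendProd x u) = 0 := by
  rw [pullbackForm, ContinuousAlternatingMap.compContinuousLinearMap_apply]
  refine (η (k + 1 + l) p).map_coord_zero (Fin.castAdd l 0) ?_
  rw [Function.comp_apply, appendProd_castAdd,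
    show tangentMapAt (I.prod J) J (fun q : G × M => q.2) (1, p) = ContinuousLinearMap.snd ℝ EG EM
      from mfderiv_snd]
  rfl

theorem pullbackForm_smul_apply_appendProd (θ : GradedForm EM M) {k l : ℕ}
    (x : Fin k → GroupLieAlgebra I G) (p : M) (u : Fin l → EM) :
    pullbackForm (I.prod J) J (fun q : G × M => q.1 • q.2) θ (k + l) (1, p)
        (appendProd (x : Fin k → EG) u) =
      (-1) ^ k * interiorForms k (fun i => fundamentalField I J (x i)) θ l p u := by
  have h := congrArg (fun θ => θ l p u)
    (interiorForms_neg k (fun i => fundamentalField I J (x i)) θ)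
  refine Eq.trans ?_ h
  rw [interiorForms_apply, pullbackForm, ContinuousAlternatingMap.compContinuousLinearMap_apply,
    one_smul]
  congr 1
  ext1 i
  refine Fin.addCases (fun i => ?_) (fun i => ?_) i
  · rw [Fin.append_left]
    exact (congrArg (tangentMapAt (I.prod J) J (fun q : G × M => q.1 • q.2) (1, p))
      (appendProd_castAdd (F₁ := EG) x u i)).trans
        ((tangentMapAt_smul_one p (x i) 0).trans (zero_sub _))
  · rw [Fin.append_right]
    refine (congrArg (tangentMapAt (I.prod J) J (fun q : G × M => q.1 • q.2) (1, p))
      (appendProd_natAdd (F₁ := EG) x u i)).trans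
        ((tangentMapAt_smul_one p (0 : GroupLieAlgebra I G) (u i)).trans ?_)
    rw [show fundamentalField I J (0 : GroupLieAlgebra I G) = (0 : M → EM) from
      map_zero (fundamentalFieldMap I G J M), Pi.zero_apply, sub_zero]

/-- Both sides of `hd` are evaluated at (e, p): the left by Cartan's formula, while on the right
only the action term survives. -/
theorem bracketSum_restrictToUnit {β : GradedForm (EG × EM) (G × M)} {η θ : GradedForm EM M}
    (hβ : IsInvariantForm (I.prod J) (leftTranslation G M) β) (hs : IsSmoothForm (I.prod J) β)
    (hd : dForm (I.prod J) β = pullbackForm (I.prod J) J (fun q => q.2) η -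
      pullbackForm (I.prod J) J (fun q => q.1 • q.2) θ) {k : ℕ}
    (x : Fin (k + 1) → GroupLieAlgebra I G) :
    bracketSum (fun k => restrictToUnit I J β k) (k + 1) x =
      (-1 : ℝ) ^ (k + 1) • (dForm J (restrictToUnit I J β (k + 1) x) +
        interiorForms (k + 1) (fun i => fundamentalField I J (x i)) θ) := by
  funext l p
  ext u
  have h := hβ.dForm_apply_appendProd hs x p u
  rw [hd] at h
  have h' := (congrArg₂ (· - ·) (pullbackForm_snd_apply_appendProd (I := I) (J := J) (G := G) η
    (x : Fin (k + 1) → EG) p u) (pullbackForm_smul_apply_appendProd (J := J) θ x p u)).symm.trans h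
  simp only [Pi.smul_apply, Pi.add_apply, ContinuousAlternatingMap.smul_apply,
    ContinuousAlternatingMap.add_apply, smul_eq_mul]
  linarith

theorem momentMap_mem_obsDegree {β : GradedForm (EG × EM) (G × M)} {η θ : GradedForm EM M}
    {n : ℕ} (hn : 1 ≤ n) (hβ : IsInvariantForm (I.prod J) (leftTranslation G M) β)
    (hs : β ∈ Omega (I.prod J) (G × M) (n : ℤ))
    (hd : dForm (I.prod J) β = pullbackForm (I.prod J) J (fun q => q.2) η -
      pullbackForm (I.prod J) J (fun q => q.1 • q.2) θ) {k : ℕ} (hk : 1 ≤ k)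
    (x : Fin k → GroupLieAlgebra I G) : momentMap I J β k x ∈ obsDegree J n θ (1 - (k : ℤ)) := by
  refine ⟨?_, ?_, ?_, ?_, ?_⟩
  · rcases hk.eq_or_lt with rfl | hk
    · exact fundamentalField_mem _
    · rw [momentMap_fst β hk]
      exact Submodule.zero_mem _
  · rw [momentMap_snd β hk]
    refine Submodule.smul_mem _ _ ⟨hβ.isSmoothForm_restrictToUnit hs.1 k x, fun l hl => ?_⟩
    exact restrictToUnit_eq_zero hs k x (by omega)
  · intro h
    -- In degree 0 the identity for one argument has an empty bracket sum and reads d r_1(x) =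
    -- -ι_{v_x} θ, which is the condition on an observable.
    obtain rfl : k = 1 := by omega
    have h1 := bracketSum_restrictToUnit hβ hs.1 hd (k := 0) x
    have h2 : (0 : GradedForm EM M) = (-1 : ℝ) ^ (0 + 1) • (dForm J (restrictToUnit I J β 1 x) +
      interiorForm (fundamentalField I J (x 0)) θ) := h1
    rw [pow_one, eq_comm, smul_eq_zero_iff_right (by norm_num)] at h2
    rw [momentMap_snd β le_rfl, varsigma_one, one_smul, momentMap_one_fst]
    exact eq_neg_of_add_eq_zero_left h2
  · intro h
    exact momentMap_fst β (by omega) x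
  · intro h
    -- Outside the degrees 1 - n, …, 0 one has k > n, and contracting an n-form with k vectors gives
    -- zero.
    have hkn : n < k := by
      by_contra hkn
      exact h ⟨by omega, by omega⟩
    refine Prod.ext (momentMap_fst β (by omega) x) ?_
    rw [momentMap_snd β hk]
    have : restrictToUnit I J β k x = 0 := funext fun l => restrictToUnit_eq_zero hs k x (by omega)
    rw [this, smul_zero]
    rfl

theorem bracketSum_momentMap_snd (β : GradedForm (EG × EM) (G × M)) (k : ℕ)
    (x : Fin (k + 2) → GroupLieAlgebra I G) :
    (bracketSum (fun k => (momentMap I J β k : (Fin k → GroupLieAlgebra I G) → ObsSpace EM M))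
      (k + 2) x).2 =
      varsigma (k + 1) • bracketSum (fun k => restrictToUnit I J β k) (k + 2) x := by
  simp only [bracketSum, Prod.snd_sum, Prod.smul_snd, Finset.smul_sum,
    momentMap_snd β (Nat.le_add_left 1 k)]
  refine Finset.sum_congr rfl fun i _ => Finset.sum_congr rfl fun j _ => smul_comm _ _ _

/-- Only two arguments have content, namely [v_x, v_y] = v_{[x,y]}; for more, both vector fields are
zero. -/
theorem obsBracket_momentMap_fst (n : ℕ) (θ : GradedForm EM M) (β : GradedForm (EG × EM) (G × M))
    (k : ℕ) (x : Fin (k + 2) → GroupLieAlgebra I G) :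
    (obsBracket J n θ (k + 2) fun i => momentMap I J β 1 fun _ => x i).1 =
      (bracketSum (fun k => (momentMap I J β k : (Fin k → GroupLieAlgebra I G) → ObsSpace EM M))
        (k + 2) x).1 := by
  cases k with
  | zero =>
    have h : bracketSum (fun k => (momentMap I J β k :
        (Fin k → GroupLieAlgebra I G) → ObsSpace EM M)) 2 x =
        momentMap I J β 1 (Fin.cons ⁅x 0, x 1⁆ ((0 : Fin 1).removeNth
          ((0 : Fin 2).removeNth x))) := by
      have hI : Finset.Ici (0 : Fin 1) = {0} := rfl
      simp [bracketSum, hI]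
    refine Eq.trans ?_ (congrArg Prod.fst h).symm
    exact bracketField_fundamentalField (x 0) (x 1)
  | succ k =>
    simp only [bracketSum, Prod.fst_sum, Prod.smul_fst,
      momentMap_fst β (show 2 ≤ k + 1 + 1 by omega), smul_zero, Finset.sum_const_zero]
    rfl

theorem obsBracket_momentMap_perm (n : ℕ) (θ : GradedForm EM M)
    (β : GradedForm (EG × EM) (G × M)) {m : ℕ} (hm : 2 ≤ m) (x : Fin m → GroupLieAlgebra I G)
    (σ : Equiv.Perm (Fin m)) :
    obsBracket J n θ m (fun i => momentMap I J β 1 fun _ => x (σ i)) =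
      ((Equiv.Perm.sign σ : ℤ) : ℝ) • obsBracket J n θ m fun i => momentMap I J β 1 fun _ => x i := by
  refine Prod.ext ?_ ?_
  · match m, hm with
    | 2, _ =>
      change bracketField J (fundamentalField I J (x (σ 0))) (fundamentalField I J (x (σ 1))) =
        ((Equiv.Perm.sign σ : ℤ) : ℝ) •
          bracketField J (fundamentalField I J (x 0)) (fundamentalField I J (x 1))
      rw [bracketField_fundamentalField, bracketField_fundamentalField]
      have hσ : ∀ σ : Equiv.Perm (Fin 2), σ = 1 ∨ σ = Equiv.swap 0 1 := by decide
      rcases hσ σ with rfl | rfl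
      · simp
      · rw [Equiv.swap_apply_left, Equiv.swap_apply_right, Equiv.Perm.sign_swap (by decide),
          ← lie_skew, show fundamentalField I J (-⁅x 0, x 1⁆) =
            -fundamentalField I J (M := M) ⁅x 0, x 1⁆ from map_neg (fundamentalFieldMap I G J M) _]
        simp
    | m + 3, _ => exact (smul_zero _).symm
  · rw [Prod.smul_snd, obsBracket_snd n θ hm, obsBracket_snd n θ hm, smul_comm]
    congr 1
    exact interiorForms_perm m (fun i => fundamentalField I J (x i)) θ σ

/-- On forms this is `bracketSum_restrictToUnit` multiplied by ς(k+1), with the sign absorbed by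
`varsigma_succ`. -/
theorem bracketSum_momentMap {β : GradedForm (EG × EM) (G × M)} {η θ : GradedForm EM M}
    {n : ℕ} (hβ : IsInvariantForm (I.prod J) (leftTranslation G M) β)
    (hs : β ∈ Omega (I.prod J) (G × M) (n : ℤ))
    (hd : dForm (I.prod J) β = pullbackForm (I.prod J) J (fun q => q.2) η -
      pullbackForm (I.prod J) J (fun q => q.1 • q.2) θ) (k : ℕ)
    (x : Fin (k + 2) → GroupLieAlgebra I G) :
    bracketSum (fun k => (momentMap I J β k : (Fin k → GroupLieAlgebra I G) → ObsSpace EM M))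
        (k + 2) x =
      obsBracket J n θ 1 (fun _ => momentMap I J β (k + 2) x) +
        obsBracket J n θ (k + 2) fun i => momentMap I J β 1 fun _ => x i := by
  have hz : ∀ l, k + 2 + l ≠ n → (momentMap I J β (k + 2) x).2 l = 0 := fun l hl => by
    rw [momentMap_snd β (Nat.le_add_left 1 (k + 1)), Pi.smul_apply,
      restrictToUnit_eq_zero hs (k + 2) x hl, smul_zero]
  have h1 : obsBracket J n θ 1 (fun _ => momentMap I J β (k + 2) x) =
      (0, dForm J (momentMap I J β (k + 2) x).2) := by
    -- Either f_{k+2} has degree n - (k+2), whose differential lies below degree n, or f_{k+2} is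
    -- zero; the truncation in l_1 is harmless in both cases.
    rcases le_or_gt (k + 2) n with hkn | hkn
    · exact obsBracket_one n θ _ (d := n - (k + 2)) (by omega) fun l hl => hz l (by omega)
    · have h0 : (momentMap I J β (k + 2) x).2 = 0 := funext fun l => hz l (by omega)
      rw [h0, dForm_zero]
      exact obsBracket_one_eq_zero n θ _ fun l _ => hz l (by omega)
  rw [h1]
  refine Prod.ext ?_ ?_
  · rw [Prod.fst_add, obsBracket_momentMap_fst, zero_add]
  · rw [bracketSum_momentMap_snd, bracketSum_restrictToUnit hβ hs.1 hd, smul_smul,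
      mul_comm, ← varsigma_succ, smul_add, ← dForm_smul, Prod.snd_add,
      obsBracket_snd n θ (Nat.le_add_left 2 k), momentMap_snd β (Nat.le_add_left 1 (k + 1))]
    rfl

theorem bracketSum_momentMap_eq_sum {β : GradedForm (EG × EM) (G × M)} {η θ : GradedForm EM M}
    {n : ℕ} (hβ : IsInvariantForm (I.prod J) (leftTranslation G M) β)
    (hs : β ∈ Omega (I.prod J) (G × M) (n : ℤ))
    (hd : dForm (I.prod J) β = pullbackForm (I.prod J) J (fun q => q.2) η -
      pullbackForm (I.prod J) J (fun q => q.1 • q.2) θ) {m : ℕ} (hm : 1 ≤ m)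
    (x : Fin m → GroupLieAlgebra I G) :
    bracketSum (fun k => (momentMap I J β k : (Fin k → GroupLieAlgebra I G) → ObsSpace EM M)) m x =
      ∑ c : Composition m, ∑ σ ∈ unshuffles c,
        compositionTerm (hamInfty J n θ) (momentMap I J β) x c σ := by
  obtain rfl | ⟨k, rfl⟩ : m = 1 ∨ ∃ k, m = k + 2 := by
    rcases hm.eq_or_lt with h | h
    · exact Or.inl h.symm
    · exact Or.inr ⟨m - 2, by omega⟩
  · rw [sum_compositionTerm_one]
    -- For m = 1 the left side is an empty sum, and the truncation gives l_1 f_1 = 0.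
    refine (obsBracket_one_eq_zero n θ (fun _ => momentMap I J β 1 x) fun l hl => ?_).symm
    rw [momentMap_snd β le_rfl, Pi.smul_apply, restrictToUnit_eq_zero hs 1 x (by omega), smul_zero]
  · rw [bracketSum_momentMap hβ hs hd k x, sum_compositionTerm _ _ _ (Nat.le_add_left 2 k)]
    · rfl
    · rintro K y hK ⟨i, j, hj, z, hy⟩
      exact obsBracket_eq_zero n θ hK y (i := i)
        ((congrArg Prod.fst hy).trans (momentMap_fst β hj z))
    · exact fun σ => obsBracket_momentMap_perm n θ β (Nat.le_add_left 2 k) x σ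

/-- A left invariant form `β` on `G × M` whose differential is the difference of the pullbacks of
forms on `M` under the projection and the action defines a homotopy moment map. -/
theorem isHomotopyMomentMap_momentMap {β : GradedForm (EG × EM) (G × M)} {η θ : GradedForm EM M}
    {n : ℕ} (hn : 1 ≤ n) (hβ : IsInvariantForm (I.prod J) (leftTranslation G M) β)
    (hs : β ∈ Omega (I.prod J) (G × M) (n : ℤ))
    (hd : dForm (I.prod J) β = pullbackForm (I.prod J) J (fun q => q.2) η -
      pullbackForm (I.prod J) J (fun q => q.1 • q.2) θ) :
    IsHomotopyMomentMap I J n θ (momentMap I J β) where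
  lift_one x := momentMap_one_fst β x
  lift_higher _ hk x := momentMap_fst β hk x
  morphism :=
    { degree := fun _ hk x => momentMap_mem_obsDegree hn hβ hs hd hk x
      compat := fun _ hm x => bracketSum_momentMap_eq_sum hβ hs hd hm x }

end MomentMap

/-! ### Compatibility of integrals of forms with pullbacks -/

section Average

open MeasureTheory

variable {EK : Type*} [NormedAddCommGroup EK] [NormedSpace ℝ EK]
  {HK : Type*} [TopologicalSpace HK] {IK : ModelWithCorners ℝ EK HK} [IK.Boundaryless]
  {K : Type*} [TopologicalSpace K] [ChartedSpace HK K] [IsManifold IK ∞ K]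
  {E : Type*} [NormedAddCommGroup E] [NormedSpace ℝ E]
  {H : Type*} [TopologicalSpace H] {I : ModelWithCorners ℝ E H} [I.Boundaryless]
  {M : Type*} [TopologicalSpace M] [ChartedSpace H M] [IsManifold I ∞ M]
  {E' : Type*} [NormedAddCommGroup E'] [NormedSpace ℝ E']
  {H' : Type*} [TopologicalSpace H'] {I' : ModelWithCorners ℝ E' H'} [I'.Boundaryless]
  {M' : Type*} [TopologicalSpace M'] [ChartedSpace H' M'] [IsManifold I' ∞ M']
  {E'' : Type*} [NormedAddCommGroup E''] [NormedSpace ℝ E'']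
  {H'' : Type*} [TopologicalSpace H''] {I'' : ModelWithCorners ℝ E'' H''}
  {M'' : Type*} [TopologicalSpace M''] [ChartedSpace H'' M'']
  {Φ : K → M → M'} {θ η : GradedForm E' M'}
  [MeasurableSpace K] [CompactSpace K] [OpensMeasurableSpace K] {μ : Measure K} [IsFiniteMeasure μ]

theorem pullbackForm_integralForm (hΦ : ContMDiff (IK.prod I) I' ∞ (Function.uncurry Φ))
    (hθ : IsSmoothForm I' θ) {f : M'' → M} (hf : MDifferentiable I'' I f) :
    pullbackForm I'' I f (integralForm I I' μ Φ θ) =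
      integralForm I'' I' μ (fun k => Φ k ∘ f) θ := by
  funext m p
  refine ((ContinuousAlternatingMap.compContinuousLinearMapCLM
    (tangentMapAt I'' I f p)).integral_comp_comm (integrable_pullbackForm (μ := μ) hΦ hθ m (f p))).symm.trans
      (integral_congr_ae (ae_of_all _ fun k => ?_))
  exact congrFun (congrFun (pullbackForm_comp ((contMDiff_slice hΦ k).mdifferentiable (by simp))
    hf θ) m) p

theorem integralForm_pullbackForm {Ψ : K → M'' → M} {f : M → M'}
    (hΨ : ∀ k, MDifferentiable I'' I (Ψ k)) (hf : MDifferentiable I I' f) :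
    integralForm I'' I μ Ψ (pullbackForm I I' f θ) =
      integralForm I'' I' μ (fun k => f ∘ Ψ k) θ := by
  funext m p
  refine integral_congr_ae (ae_of_all _ fun k => ?_)
  exact congrFun (congrFun (pullbackForm_comp hf (hΨ k) θ) m) p

theorem integralForm_sub (hΦ : ContMDiff (IK.prod I) I' ∞ (Function.uncurry Φ))
    (hθ : IsSmoothForm I' θ) (hη : IsSmoothForm I' η) :
    integralForm I I' μ Φ (θ - η) = integralForm I I' μ Φ θ - integralForm I I' μ Φ η := by
  funext m p
  refine Eq.trans ?_ (integral_sub (integrable_pullbackForm hΦ hθ m p)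
    (integrable_pullbackForm hΦ hη m p))
  exact integral_congr_ae (ae_of_all _ fun k => by ext v; rfl)

theorem integralForm_const [IsProbabilityMeasure μ] (f : M → M') (θ : GradedForm E' M') :
    integralForm I I' μ (fun _ : K => f) θ = pullbackForm I I' f θ := by
  funext m p
  simp [integralForm]

end Average

/-! ### Averages over a compact group -/

section AverageInvariant

open MeasureTheory

variable {EG : Type*} [NormedAddCommGroup EG] [NormedSpace ℝ EG]
  {HG : Type*} [TopologicalSpace HG] {I : ModelWithCorners ℝ EG HG} [I.Boundaryless]
  {G : Type*} [TopologicalSpace G] [ChartedSpace HG G] [Group G] [LieGroup I ∞ G]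
  {EM : Type*} [NormedAddCommGroup EM] [NormedSpace ℝ EM]
  {HM : Type*} [TopologicalSpace HM] {J : ModelWithCorners ℝ EM HM} [J.Boundaryless]
  {M : Type*} [TopologicalSpace M] [ChartedSpace HM M] [IsManifold J ∞ M]

theorem contMDiff_leftTranslation : ContMDiff (I.prod (I.prod J)) (I.prod J) ∞
    (Function.uncurry fun (g : G) (q : G × M) => leftTranslation G M g q) :=
  (contMDiff_fst.mul (contMDiff_fst.comp contMDiff_snd)).prodMk (contMDiff_snd.comp contMDiff_snd)

theorem contMDiff_uncurry_inv {ρ : G → M → M}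
    (hρ : ContMDiff (I.prod J) J ∞ (Function.uncurry ρ)) :
    ContMDiff (I.prod J) J ∞ (Function.uncurry fun (g : G) p => ρ g⁻¹ p) :=
  hρ.comp (((contMDiff_inv I ∞).comp contMDiff_fst).prodMk contMDiff_snd)

variable [CompactSpace G] [MeasurableSpace G] [BorelSpace G] {μ : Measure G}
  [IsProbabilityMeasure μ]

/-- Pulling back by ρ(h) replaces ρ(g⁻¹) by ρ(g⁻¹h) = ρ((h⁻¹g)⁻¹) under the integral; left
invariance of the measure undoes this. -/
theorem isInvariantForm_averageForm [μ.IsMulLeftInvariant] {ρ : G → M → M}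
    (hρ : ContMDiff (I.prod J) J ∞ (Function.uncurry ρ))
    (hmul : ∀ g h p, ρ g (ρ h p) = ρ (g * h) p) {θ : GradedForm EM M} (hθ : IsSmoothForm J θ) :
    IsInvariantForm J ρ (averageForm J μ ρ θ) := by
  have : IsTopologicalGroup G := topologicalGroup_of_lieGroup I ∞
  intro h
  refine (pullbackForm_integralForm (Φ := fun g => ρ g⁻¹) (contMDiff_uncurry_inv hρ) hθ
    ((contMDiff_slice hρ h).mdifferentiable (by simp))).trans ?_
  have hc : ∀ g : G, ρ g⁻¹ ∘ ρ h = ρ (h⁻¹ * g)⁻¹ := fun g => by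
    funext p
    rw [Function.comp_apply, hmul, mul_inv_rev, inv_inv]
  funext m p
  simp only [integralForm, hc]
  exact integral_mul_left_eq_self (fun g => pullbackForm J J (ρ g⁻¹) θ m p) h⁻¹

variable [MulAction G M] [ContMDiffSMul I J ∞ G M] [FiniteDimensional ℝ EG]
  [FiniteDimensional ℝ EM]

/-- Left translations do not change the projection, so its term is constant in `g` and integrates to
itself over total mass 1. The action composed with translation by g⁻¹ is g⁻¹ applied after the
action, which gives the pullback of the average. -/
theorem dForm_averageForm_leftTranslation {β : GradedForm (EG × EM) (G × M)}
    (hβ : IsSmoothForm (I.prod J) β) {η : GradedForm EM M} (hη : IsSmoothForm J η)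
    (hd : dForm (I.prod J) β = pullbackForm (I.prod J) J (fun q => q.2) η -
      pullbackForm (I.prod J) J (fun q => q.1 • q.2) η) :
    dForm (I.prod J) (averageForm (I.prod J) μ (leftTranslation G M) β) =
      pullbackForm (I.prod J) J (fun q => q.2) η - pullbackForm (I.prod J) J (fun q => q.1 • q.2)
        (averageForm J μ (fun (g : G) (p : M) => g • p) η) := by
  have hΦ := contMDiff_uncurry_inv (contMDiff_leftTranslation (I := I) (J := J) (G := G) (M := M))
  have ha : ContMDiff (I.prod J) J ∞ fun q : G × M => q.1 • q.2 := contMDiff_smul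
  have hs : ContMDiff (I.prod J) J ∞ fun q : G × M => q.2 := contMDiff_snd
  have hΦ' : ∀ g : G, MDifferentiable (I.prod J) (I.prod J) (leftTranslation G M g⁻¹) := fun g =>
    (contMDiff_slice hΦ g).mdifferentiable (by simp)
  have hmd := hs.mdifferentiable (by simp)
  have had := ha.mdifferentiable (by simp)
  refine (dForm_integralForm (Φ := fun g => leftTranslation G M g⁻¹) hΦ hβ).trans ?_
  rw [hd, integralForm_sub hΦ (hη.pullback hs) (hη.pullback ha), integralForm_pullbackForm hΦ' hmd,
    integralForm_pullbackForm hΦ' had]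
  congr 1
  · exact integralForm_const _ _
  · refine Eq.trans ?_ (pullbackForm_integralForm (Φ := fun (g : G) (p : M) => g⁻¹ • p)
      (contMDiff_uncurry_inv ha) hη had).symm
    congr 1
    funext g q
    simp [leftTranslation, mul_smul]

end AverageInvariant

end Preliminaries

/-! ### The main theorem -/

theorem mainTheorem2
    {EG : Type*} [NormedAddCommGroup EG] [NormedSpace ℝ EG] [FiniteDimensional ℝ EG]
    {HG : Type*} [TopologicalSpace HG] (I : ModelWithCorners ℝ EG HG) [I.Boundaryless]
    {G : Type*} [TopologicalSpace G] [ChartedSpace HG G] [Group G] [LieGroup I ∞ G]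
    {EM : Type*} [NormedAddCommGroup EM] [NormedSpace ℝ EM] [FiniteDimensional ℝ EM]
    {HM : Type*} [TopologicalSpace HM] (J : ModelWithCorners ℝ EM HM) [J.Boundaryless]
    {M : Type*} [TopologicalSpace M] [ChartedSpace HM M] [IsManifold J ∞ M]
    [MulAction G M] [ContMDiffSMul I J ∞ G M]
    (n : ℕ) (hn : 1 ≤ n)
    (α : BSSCochain EG G EM M) (hα : IsBSSCocycle I J (n + 1) α) :
    (IsInvariantForm J (fun (g : G) (p : M) => g • p) (bssZero I J α) →
      IsInvariantForm (I.prod J) (leftTranslation G M) (bssOne I J α) →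
      IsInvariantPrePlectic (G := G) J n (bssZero I J α) ∧
      ∃ F : ∀ k : ℕ, GroupLieAlgebra I G [⋀^Fin k]→ₗ[ℝ] ObsSpace EM M,
        IsHomotopyMomentMap I J n (bssZero I J α) F ∧
        ∀ k : ℕ, 1 ≤ k → k ≤ n → ∀ x : Fin k → GroupLieAlgebra I G,
          varsigma k • (F k x).2 = restrictToUnit I J (bssOne I J α) k x) ∧
    (∀ [CompactSpace G] [MeasurableSpace G] [BorelSpace G] (μ : MeasureTheory.Measure G)
        [μ.IsHaarMeasure] [MeasureTheory.IsProbabilityMeasure μ],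
      IsInvariantPrePlectic (G := G) J n
        (averageForm J μ (fun (g : G) (p : M) => g • p) (bssZero I J α)) ∧
      ∃ F : ∀ k : ℕ, GroupLieAlgebra I G [⋀^Fin k]→ₗ[ℝ] ObsSpace EM M,
        IsHomotopyMomentMap I J n
          (averageForm J μ (fun (g : G) (p : M) => g • p) (bssZero I J α)) F ∧
        ∀ k : ℕ, 1 ≤ k → k ≤ n → ∀ x : Fin k → GroupLieAlgebra I G,
          varsigma k • (F k x).2 = restrictToUnit I J
            (averageForm (I.prod J) μ (leftTranslation G M) (bssOne I J α)) k x) := by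
  have hβ := hα.bssOne_mem
  have hω := hα.bssZero_mem
  have ha : ContMDiff (I.prod J) J ∞ (Function.uncurry fun (g : G) (p : M) => g • p) :=
    contMDiff_smul
  refine ⟨fun h₀ h₁ => ⟨⟨hω, hα.dForm_bssZero, h₀⟩, momentMap I J (bssOne I J α),
    isHomotopyMomentMap_momentMap hn h₁ hβ hα.dForm_bssOne, fun k hk _ x => ?_⟩, ?_⟩
  · rw [momentMap_snd _ hk, smul_smul, varsigma_mul_self, one_smul]
  · intro _ _ _ μ _ _
    -- By definition `averageForm` is `integralForm` for the family g ↦ ρ(g⁻¹), so the results on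
    -- integrals apply once these two families are smooth.
    have hΦ := contMDiff_uncurry_inv ha
    have hΨ := contMDiff_uncurry_inv
      (contMDiff_leftTranslation (I := I) (J := J) (G := G) (M := M))
    refine ⟨⟨integralForm_mem_Omega hΦ hω, ?_, isInvariantForm_averageForm ha
      (fun g h p => (mul_smul g h p).symm) hω.1⟩,
      momentMap I J (averageForm (I.prod J) μ (leftTranslation G M) (bssOne I J α)),
      isHomotopyMomentMap_momentMap hn (isInvariantForm_averageForm contMDiff_leftTranslation
        (fun g h q => by simp [leftTranslation, mul_assoc]) hβ.1) (integralForm_mem_Omega hΨ hβ)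
        (dForm_averageForm_leftTranslation hβ.1 hω.1 hα.dForm_bssOne), fun k hk _ x => ?_⟩
    · refine (dForm_integralForm (Φ := fun (g : G) (p : M) => g⁻¹ • p) hΦ hω.1).trans ?_
      rw [hα.dForm_bssZero]
      funext m p
      simp [integralForm, pullbackForm_zero]
    · rw [momentMap_snd _ hk, smul_smul, varsigma_mul_self, one_smul]
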